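/- **Corollary (achievability exponent).** All Hilbert spaces are finite-dimensional and all logarithms are to base $2$. Let $\rho_{AE}$ be a quantum state (positive semidefinite, trace one) on $A\otimes E$ and let $\mathcal T_{A\to C}$ be a quantum channel (a completely positive trace-preserving linear map). Define the decoupling error $$\epsilon_{\mathrm{dec}}(\mathcal T_{A\to C},\rho_{AE}) := \mathbb E_{\mathbb U(A)}\, D\big(\mathcal T_{A\to C}(U_A\rho_{AE}U_A^*)\,\big\|\,\omega_C\otimes\rho_E\big),$$ where $U_A$ is distributed according to the Haar probability measure on the unitary group $\mathbb U(A)$, $\omega_C:=\mathcal T_{A\to C}(I_A/|A|)$, and $D(\rho\|\sigma)=\operatorname{tr}\rho(\log\rho-\log\sigma)$ if $\operatorname{supp}\rho\subseteq\operatorname{supp}\sigma$ and $D(\rho\|\sigma)=+\infty$ otherwise. For $\alpha>1$ let $$\widetilde D_\alpha(\rho\|\sigma):=\frac1{\alpha-1}\log\operatorname{tr}\Big(\sigma^{\frac{1-\alpha}{2\alpha}}\rho\,\sigma^{\frac{1-\alpha}{2\alpha}}\Big)^{\alpha}-\frac1{\alpha-1}\log\operatorname{tr}\rho$$ if $\operatorname{supp}\rho\subseteq\operatorname{supp}\sigma$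 (negative powers being taken on the support of $\sigma$), $\widetilde D_\alpha(\rho\|\sigma):=+\infty$ otherwise, and let $$\widetilde H_\alpha(A|B)_\rho:=-\widetilde D_\alpha(\rho_{AB}\,\|\,I_A\otimes\rho_B).$$ Let $\omega_{A'C}:=\mathcal T_{A\to C}(\Phi_{AA'})$ be the normalized Choi state, where $\Phi_{AA'}=\frac1{|A|}\sum_{i,j}|i\rangle\langle j|_A\otimes|i\rangle\langle j|_{A'}$ and $A'\cong A$. Then the error exponent of i.i.d. quantum information decoupling satisfies $$\liminf_{n\to\infty}\frac{-1}{n}\log\epsilon_{\mathrm{dec}}\big(\mathcal T_{A\to C}^{\otimes n},\rho_{AE}^{\otimes n}\big)\;\ge\;\sup_{0<s<1}s\big(\widetilde H_{1+s}(A|E)_\rho+\widetilde H_{1+s}(A'|C)_\omega\big),$$ with the convention $-\log 0=+\infty$. Here the Haar average in $\epsilon_{\mathrm{dec}}(\mathcal T^{\otimes n},\rho^{\otimes n})$ is over the full unitary group $\mathbb U(A^n)$ of $A^{\otimes n}$. -/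

import Mathlib

open scoped Kronecker ENNReal ComplexOrder

noncomputable section

namespace QDec

/-! Quantum systems are finite-dimensional Hilbert spaces with a fixed orthonormal basis indexed by
a finite type, operators are complex matrices, a joint system `AE` is indexed by `A × E`, and the
`n`-fold system `Aⁿ` by `Fin n → A`. All logarithms are to base `2`. -/

section Operators

variable {ι κ : Type*} [Fintype ι] [Fintype κ]

/-- A quantum state: a positive semidefinite operator of trace one. -/
structure IsState (ρ : Matrix ι ι ℂ) : Prop where
  posSemidef : ρ.PosSemidef
  trace_eq_one : ρ.trace = 1

/-- The support of a positive semidefinite operator, which is its range. -/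
def supp (ρ : Matrix ι ι ℂ) : Submodule ℂ (ι → ℂ) :=
  LinearMap.range ρ.mulVecLin

/-- The supports of `ρ` and `σ` are orthogonal. -/
def SuppOrthogonal (ρ σ : Matrix ι ι ℂ) : Prop :=
  ∀ v ∈ supp ρ, ∀ w ∈ supp σ, star v ⬝ᵥ w = 0

variable [DecidableEq ι] [DecidableEq κ]

/-- The base-two logarithm of a positive semidefinite operator, with value `0` on its kernel. -/
def mlog (ρ : Matrix ι ι ℂ) : Matrix ι ι ℂ :=
  cfc (fun x : ℝ => Real.logb 2 x) ρ

/-- The real power `ρ ^ r` (`r ≠ 0`) of a positive semidefinite operator, with value `0` on its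
kernel also when `r` is negative. -/
def mpow (ρ : Matrix ι ι ℂ) (r : ℝ) : Matrix ι ι ℂ :=
  cfc (fun x : ℝ => x ^ r) ρ

open Classical in
/-- The Umegaki relative entropy `D(ρ‖σ)`. -/
def relEntropy (ρ σ : Matrix ι ι ℂ) : EReal :=
  if supp ρ ≤ supp σ then (((ρ * (mlog ρ - mlog σ)).trace.re : ℝ) : EReal) else ⊤

/-- `tr (σ^((1-α)/(2α)) ρ σ^((1-α)/(2α)))^α`. -/
def sandwichedQ (α : ℝ) (ρ σ : Matrix ι ι ℂ) : ℝ :=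
  (mpow (mpow σ ((1 - α) / (2 * α)) * ρ * mpow σ ((1 - α) / (2 * α))) α).trace.re

open Classical in
/-- The sandwiched Rényi divergence of order `α ∈ (0,1) ∪ (1,∞)`. -/
def sandwichedRenyi (α : ℝ) (ρ σ : Matrix ι ι ℂ) : EReal :=
  if (1 < α ∧ supp ρ ≤ supp σ) ∨ (α < 1 ∧ ¬ SuppOrthogonal ρ σ) then
    ((1 / (α - 1) * Real.logb 2 (sandwichedQ α ρ σ)
      - 1 / (α - 1) * Real.logb 2 ρ.trace.re : ℝ) : EReal)
  else ⊤

/-- The partial trace over the first tensor factor. -/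
def traceFst (ρ : Matrix (ι × κ) (ι × κ) ℂ) : Matrix κ κ ℂ :=
  Matrix.of fun e e' => ∑ a, ρ (a, e) (a, e')

/-- The sandwiched conditional Rényi entropy `H̃_α(A|B)_ρ = - D̃_α(ρ_AB ‖ I_A ⊗ ρ_B)`. -/
def condEntropy (α : ℝ) (ρ : Matrix (ι × κ) (ι × κ) ℂ) : EReal :=
  - sandwichedRenyi α ρ ((1 : Matrix ι ι ℂ) ⊗ₖ traceFst ρ)

end Operators

section Channels

variable {A C : Type*} [Fintype A] [Fintype C]

/-- The map `T ⊗ id_E` : `T` is applied to each `E`-block of the operator. -/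
def ampliation (T : Matrix A A ℂ →ₗ[ℂ] Matrix C C ℂ) (E : Type*)
    (X : Matrix (A × E) (A × E) ℂ) : Matrix (C × E) (C × E) ℂ :=
  Matrix.of fun p q => T (Matrix.of fun a a' => X (a, p.2) (a', q.2)) p.1 q.1

/-- A quantum channel: a completely positive, trace-preserving linear map. -/
structure IsChannel (T : Matrix A A ℂ →ₗ[ℂ] Matrix C C ℂ) : Prop where
  completelyPositive : ∀ (k : ℕ) (X : Matrix (A × Fin k) (A × Fin k) ℂ),
    X.PosSemidef → (ampliation T (Fin k) X).PosSemidef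
  trace_preserving : ∀ X : Matrix A A ℂ, (T X).trace = X.trace

variable [DecidableEq A]

variable (A) in
/-- The normalized maximally entangled state `|A|⁻¹ ∑ i j, |i⟩⟨j| ⊗ |i⟩⟨j|` on `A ⊗ A'`. -/
def maxEntangled : Matrix (A × A) (A × A) ℂ :=
  (Fintype.card A : ℂ)⁻¹ • ∑ i : A, ∑ j : A, Matrix.single i j (1 : ℂ) ⊗ₖ Matrix.single i j (1 : ℂ)

/-- The normalized Choi state `ω_{A'C} = T_{A → C}(Φ_{AA'})`, with the factors in the order
`A'`, `C`. -/
def choi (T : Matrix A A ℂ →ₗ[ℂ] Matrix C C ℂ) : Matrix (A × C) (A × C) ℂ :=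
  (ampliation T A (maxEntangled A)).submatrix Prod.swap Prod.swap

/-- The output `ω_C = T(I_A / |A|)` of the maximally mixed state. -/
def mixedOutput (T : Matrix A A ℂ →ₗ[ℂ] Matrix C C ℂ) : Matrix C C ℂ :=
  T ((Fintype.card A : ℂ)⁻¹ • (1 : Matrix A A ℂ))

end Channels

section TensorPowers

/-- The `n`-fold tensor power `ρ_{AE}^{⊗ n}`, as an operator on `Aⁿ ⊗ Eⁿ`. -/
def tensorPow {A E : Type*} (n : ℕ) (ρ : Matrix (A × E) (A × E) ℂ) :
    Matrix ((Fin n → A) × (Fin n → E)) ((Fin n → A) × (Fin n → E)) ℂ :=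
  Matrix.of fun p q => ∏ i, ρ (p.1 i, p.2 i) (q.1 i, q.2 i)

/-- The `n`-fold tensor power `T^{⊗ n}`: the linear map sending the matrix unit
`|a⟩⟨a'| = ⨂ i, |a i⟩⟨a' i|` to `⨂ i, T(|a i⟩⟨a' i|)`. -/
def channelPow {A C : Type*} [Fintype A] [DecidableEq A]
    (n : ℕ) (T : Matrix A A ℂ →ₗ[ℂ] Matrix C C ℂ) :
    Matrix (Fin n → A) (Fin n → A) ℂ →ₗ[ℂ] Matrix (Fin n → C) (Fin n → C) ℂ where
  toFun X := Matrix.of fun c c' => ∑ a : Fin n → A, ∑ a' : Fin n → A,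
    X a a' * ∏ i, T (Matrix.single (a i) (a' i) 1) (c i) (c' i)
  map_add' X Y := by
    ext c c'
    simp [add_mul, Finset.sum_add_distrib]
  map_smul' r X := by
    ext c c'
    simp [Finset.mul_sum, mul_assoc]

end TensorPowers

section Decoupling

variable {A E C : Type*} [Fintype A] [DecidableEq A] [Fintype E] [DecidableEq E]
  [Fintype C] [DecidableEq C]

instance compactSpace_unitaryGroup : CompactSpace (Matrix.unitaryGroup A ℂ) := by
  have hc : IsCompact
      (Set.pi Set.univ fun _ : A => Set.pi Set.univ fun _ : A => Metric.closedBall (0 : ℂ) 1) :=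
    isCompact_univ_pi fun _ => isCompact_univ_pi fun _ => isCompact_closedBall _ _
  have hu : IsCompact (Matrix.unitaryGroup A ℂ : Set (Matrix A A ℂ)) := by
    refine hc.of_isClosed_subset (isClosed_unitary (R := Matrix A A ℂ)) ?_
    intro U hU i _ j _
    simpa using entry_norm_bound_of_unitary hU i j
  exact isCompact_iff_compactSpace.mp hu

instance measurableSpace_unitaryGroup : MeasurableSpace (Matrix.unitaryGroup A ℂ) := borel _

instance borelSpace_unitaryGroup : BorelSpace (Matrix.unitaryGroup A ℂ) := ⟨rfl⟩

/-- The Haar probability measure on the unitary group `𝕌(A)`. -/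
def haarUnitary (A : Type*) [Fintype A] [DecidableEq A] :
    MeasureTheory.Measure (Matrix.unitaryGroup A ℂ) :=
  MeasureTheory.Measure.haarMeasure ⊤

/-- The expectation of an extended-real random variable: integral of the positive part minus
integral of the negative part. -/
def expectation {Ω : Type*} [MeasurableSpace Ω] (μ : MeasureTheory.Measure Ω) (f : Ω → EReal) :
    EReal :=
  ((∫⁻ ω, (f ω).toENNReal ∂μ : ℝ≥0∞) : EReal) - ((∫⁻ ω, (-f ω).toENNReal ∂μ : ℝ≥0∞) : EReal)

/-- The rotated state `U_A ρ_AE U_A^*`. -/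
def rotate (U : Matrix A A ℂ) (ρ : Matrix (A × E) (A × E) ℂ) : Matrix (A × E) (A × E) ℂ :=
  (U ⊗ₖ (1 : Matrix E E ℂ)) * ρ * (U ⊗ₖ (1 : Matrix E E ℂ)).conjTranspose

/-- The decoupling error `𝔼_U D(T(U_A ρ_AE U_A^*) ‖ ω_C ⊗ ρ_E)`. -/
def decouplingError (T : Matrix A A ℂ →ₗ[ℂ] Matrix C C ℂ) (ρ : Matrix (A × E) (A × E) ℂ) : EReal :=
  expectation (haarUnitary A) fun U =>
    relEntropy (ampliation T E (rotate (U : Matrix A A ℂ) ρ)) (mixedOutput T ⊗ₖ traceFst ρ)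

/-- The base-two logarithm on `[0,∞]`, with `log 0 = -∞`. -/
def log2 (x : EReal) : EReal :=
  ENNReal.log x.toENNReal / ((Real.log 2 : ℝ) : EReal)

/-- The i.i.d. decoupling error exponent
`liminf_{n → ∞} (-1/n) log ε_dec(T^{⊗ n}, ρ_AE^{⊗ n})`. -/
def decouplingExponent (T : Matrix A A ℂ →ₗ[ℂ] Matrix C C ℂ) (ρ : Matrix (A × E) (A × E) ℂ) :
    EReal :=
  Filter.liminf (fun n : ℕ => (((-1 : ℝ) / (n : ℝ) : ℝ) : EReal) *
    log2 (decouplingError (channelPow n T) (tensorPow n ρ))) Filter.atTop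

end Decoupling

end QDec

end

/-! Fix `0 < s ≤ 1` and put `p = 1 + s`. Write `S` for the rotated channel output and `σ = ω_C ⊗
ρ_E` for its Haar mean. The proof bounds the relative entropy of `S` and `σ` by the `p`-th power of
a Schatten `p`-norm, and then bounds the Haar average of that power by second moments.

Entropy to norm. From `e^u ≥ 1 + u` and Jensen's inequality, `D(S‖σ) ≤ (Q - 1) / (s ln 2)`, where `Q
= tr X^p`, `X = σ^t S σ^t` and `t = (1 - p) / (2p)` (`trace_mul_mlog_sub_le`). Clarkson's inequality
for `σ^(1/p)` and `X - σ^(1/p)` gives `Q ≤ 1 + 2 tr |X - σ^(1/p)|^p` (`clarkson`, `sandwichedQ_le`).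
The two constants `1` cancel, so only the deviation of `X` from its mean remains.

Norm to moments. The output is a bilinear contraction over `A` of the rotated state with the Choi
state, and the weights `σ^t` can be moved onto these two inputs. So `X - σ^(1/p)` is the deviation
of a rotated contraction of two positive operators, the weighted state and the weighted Choi state,
whose `p`-th power traces are the two sandwiched functionals of the theorem. If both inputs are
projections, `u^p ≤ u + u^2` bounds the average by a trace-norm term and a Hilbert–Schmidt term, and
both are at most a constant times the product of the ranks. The second comes from
`integral_normSq_trace_rotation_le`. General inputs are split into their spectral projections. The
power-mean triangle inequality then costs `N^(p - 1)`, where `N` is the number of pairs of distinct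
eigenvalues (`lintegral_absPow_deviation_le`).

Tensor powers. Weighting commutes with tensor powers, so the eigenvalues are products: there are
only polynomially many distinct ones, and their `p`-th power sums are exact `n`-th powers. The
polynomial prefactor does not affect the exponent. -/

namespace QDec
open Matrix

/-! ### Functional calculus in an eigenbasis and Peierls' inequality. -/

section Diag
variable {ι κ : Type*} [Fintype ι] [DecidableEq ι] [Fintype κ] [DecidableEq κ]

/-- The Hermitian matrix with eigenvector matrix `V` and eigenvalues `d`. -/
noncomputable def conjDiag (V : Matrix ι ι ℂ) (d : ι → ℝ) : Matrix ι ι ℂ :=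
  V * diagonal (fun i => (d i : ℂ)) * Vᴴ

theorem conjDiag_isHermitian (V : Matrix ι ι ℂ) (d : ι → ℝ) : (conjDiag V d).IsHermitian := by
  have : star (fun i => (d i : ℂ)) = fun i => (d i : ℂ) := by ext i; simp
  simp [conjDiag, Matrix.IsHermitian, Matrix.mul_assoc, diagonal_conjTranspose, this]

theorem conjDiag_mul {V : Matrix ι ι ℂ} (hV : V ∈ unitaryGroup ι ℂ) (d e : ι → ℝ) :
    conjDiag V d * conjDiag V e = conjDiag V (fun i => d i * e i) := by
  have h : Vᴴ * V = 1 := mem_unitaryGroup_iff'.1 hV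
  calc conjDiag V d * conjDiag V e
      = V * (diagonal (fun i => (d i : ℂ)) * (Vᴴ * V) * diagonal (fun i => (e i : ℂ))) * Vᴴ := by
        simp only [conjDiag, Matrix.mul_assoc]
    _ = _ := by rw [h]; simp [conjDiag, diagonal_mul_diagonal]

theorem conjDiag_one {V : Matrix ι ι ℂ} (hV : V ∈ unitaryGroup ι ℂ) :
    conjDiag V (fun _ => 1) = 1 := by
  have h : V * Vᴴ = 1 := mem_unitaryGroup_iff.1 hV
  simp [conjDiag, h]

theorem conjDiag_add (V : Matrix ι ι ℂ) (d e : ι → ℝ) :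
    conjDiag V d + conjDiag V e = conjDiag V (fun i => d i + e i) := by
  simp [conjDiag, ← Matrix.add_mul, ← Matrix.mul_add]

theorem conjDiag_smul (V : Matrix ι ι ℂ) (c : ℝ) (d : ι → ℝ) :
    conjDiag V (fun i => c * d i) = (c : ℂ) • conjDiag V d := by
  have : (diagonal fun i => ((c * d i : ℝ) : ℂ)) = (c : ℂ) • diagonal fun i => (d i : ℂ) := by
    ext i j; by_cases h : i = j <;> simp [h]
  rw [conjDiag, this, Matrix.mul_smul, Matrix.smul_mul, conjDiag]

theorem aeval_conjDiag {V : Matrix ι ι ℂ} (hV : V ∈ unitaryGroup ι ℂ) (d : ι → ℝ)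
    (q : Polynomial ℝ) :
    Polynomial.aeval (conjDiag V d) q = conjDiag V (fun i => q.eval (d i)) := by
  induction q using Polynomial.induction_on' with
  | add p q hp hq => simp [hp, hq, conjDiag_add]
  | monomial n a =>
    have hpow : conjDiag V d ^ n = conjDiag V (fun i => d i ^ n) := by
      induction n with
      | zero => simp [conjDiag_one hV]
      | succ n ih => rw [pow_succ, ih, conjDiag_mul hV]; simp [pow_succ]
    rw [Polynomial.aeval_monomial, hpow]
    simp only [Polynomial.eval_monomial]
    rw [conjDiag_smul, ← Algebra.smul_def]
    ext i j; simp

theorem cfc_conjDiag {V : Matrix ι ι ℂ} (hV : V ∈ unitaryGroup ι ℂ) (d : ι → ℝ) (f : ℝ → ℝ) :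
    cfc f (conjDiag V d) = conjDiag V (fun i => f (d i)) := by
  have hH := conjDiag_isHermitian V d
  classical
  -- The nodes contain the spectrum, so that the functional calculus sees `q` as `f`, and also the
  -- values of `d`, so that the final evaluation does. That the two sets agree is never needed.
  let t : Finset ℝ := (Matrix.finite_real_spectrum (A := conjDiag V d)).toFinset ∪ Finset.univ.image d
  let q := Lagrange.interpolate t id f
  have hq : ∀ x ∈ t, q.eval x = f x := fun x hx =>
    Lagrange.eval_interpolate_at_node (v := id) f (fun _ _ _ _ h => h) hx
  have h1 : cfc f (conjDiag V d) = cfc (fun x => q.eval x) (conjDiag V d) :=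
    cfc_congr fun x hx => (hq x (by simp [t, hx])).symm
  rw [h1, cfc_polynomial q (conjDiag V d) hH.isSelfAdjoint, aeval_conjDiag hV]
  congr 1; ext i
  exact hq _ (by simp [t])

theorem conjDiag_eigen {Z : Matrix ι ι ℂ} (hZ : Z.IsHermitian) :
    Z = conjDiag hZ.eigenvectorUnitary hZ.eigenvalues := hZ.spectral_theorem

theorem exists_conjDiag {Z : Matrix ι ι ℂ} (hZ : Z.IsHermitian) :
    ∃ V ∈ unitaryGroup ι ℂ, ∃ d, Z = conjDiag V d :=
  ⟨_, hZ.eigenvectorUnitary.2, _, conjDiag_eigen hZ⟩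

theorem exists_conjDiag_nonneg {Z : Matrix ι ι ℂ} (hZ : Z.PosSemidef) :
    ∃ V ∈ unitaryGroup ι ℂ, ∃ d : ι → ℝ, (∀ i, 0 ≤ d i) ∧ Z = conjDiag V d :=
  ⟨_, hZ.1.eigenvectorUnitary.2, _, hZ.eigenvalues_nonneg, conjDiag_eigen hZ.1⟩

theorem conjDiag_posSemidef (V : Matrix ι ι ℂ) {d : ι → ℝ} (hd : ∀ i, 0 ≤ d i) :
    (conjDiag V d).PosSemidef :=
  (PosSemidef.diagonal (d := fun i => (d i : ℂ))
    (fun i => by simpa using hd i)).mul_mul_conjTranspose_same V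

theorem trace_conjDiag {V : Matrix ι ι ℂ} (hV : V ∈ unitaryGroup ι ℂ) (d : ι → ℝ) :
    (conjDiag V d).trace = ((∑ i, d i : ℝ) : ℂ) := by
  rw [conjDiag, Matrix.trace_mul_comm, ← Matrix.mul_assoc,
    show Vᴴ * V = 1 from mem_unitaryGroup_iff'.1 hV]
  simp [Matrix.trace]

theorem conjDiag_apply (V : Matrix ι ι ℂ) (d : ι → ℝ) (i j : ι) :
    conjDiag V d i j = ∑ k, (d k : ℂ) * (V i k * star (V j k)) := by
  rw [conjDiag, Matrix.mul_apply]
  simp only [mul_diagonal, conjTranspose_apply]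
  exact Finset.sum_congr rfl fun k _ => by ring

theorem conjDiag_diag (V : Matrix ι ι ℂ) (d : ι → ℝ) (i : ι) :
    conjDiag V d i i = ((∑ k, d k * Complex.normSq (V i k) : ℝ) : ℂ) := by
  rw [conjDiag_apply]
  push_cast
  refine Finset.sum_congr rfl fun k _ => ?_
  rw [← Complex.mul_conj]; rfl

theorem conjDiag_diag_re (V : Matrix ι ι ℂ) (d : ι → ℝ) (i : ι) :
    (conjDiag V d i i).re = ∑ k, d k * Complex.normSq (V i k) := by
  rw [conjDiag_diag, Complex.ofReal_re]

theorem conj_conjDiag (W V : Matrix ι ι ℂ) (d : ι → ℝ) :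
    W * conjDiag V d * Wᴴ = conjDiag (W * V) d := by
  simp [conjDiag, Matrix.mul_assoc]

theorem unitary_row_sum {V : Matrix ι ι ℂ} (hV : V ∈ unitaryGroup ι ℂ) (i : ι) :
    ∑ k, Complex.normSq (V i k) = 1 := by
  have := conjDiag_diag_re V (fun _ => 1) i
  rw [conjDiag_one hV] at this
  simpa using this.symm

theorem unitary_conjTranspose {V : Matrix ι ι ℂ} (hV : V ∈ unitaryGroup ι ℂ) :
    Vᴴ ∈ unitaryGroup ι ℂ := Unitary.star_mem hV

theorem unitary_col_sum {V : Matrix ι ι ℂ} (hV : V ∈ unitaryGroup ι ℂ) (k : ι) :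
    ∑ i, Complex.normSq (V i k) = 1 := by
  simpa using unitary_row_sum (unitary_conjTranspose hV) k

theorem unitary_mul {V W : Matrix ι ι ℂ} (hV : V ∈ unitaryGroup ι ℂ) (hW : W ∈ unitaryGroup ι ℂ) :
    V * W ∈ unitaryGroup ι ℂ := mul_mem hV hW

/-- **Peierls' inequality** for a convex trace function. -/
theorem peierls {V W : Matrix ι ι ℂ} (hV : V ∈ unitaryGroup ι ℂ) (hW : W ∈ unitaryGroup ι ℂ)
    {d : ι → ℝ} {s : Set ℝ} (hd : ∀ i, d i ∈ s) {f : ℝ → ℝ} (hf : ConvexOn ℝ s f) :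
    ∑ k, f ((Wᴴ * conjDiag V d * W) k k).re ≤ ∑ i, f (d i) := by
  -- In the basis `W` the diagonal entries are averages of the eigenvalues with weights `|U k i|²`.
  -- These weights are doubly stochastic: the row sums permit Jensen's inequality, and the column
  -- sums recover the full sum.
  have hU := unitary_mul (unitary_conjTranspose hW) hV
  set U := Wᴴ * V with hUdef
  have hc : Wᴴ * conjDiag V d * W = conjDiag U d := by
    have := conj_conjDiag Wᴴ V d
    rwa [conjTranspose_conjTranspose] at this
  rw [hc]
  calc ∑ k, f (conjDiag U d k k).re
      ≤ ∑ k, ∑ i, Complex.normSq (U k i) * f (d i) := by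
        refine Finset.sum_le_sum fun k _ => ?_
        rw [conjDiag_diag_re]
        have := hf.map_sum_le (t := Finset.univ) (w := fun i => Complex.normSq (U k i)) (p := d)
          (fun i _ => Complex.normSq_nonneg _) (unitary_row_sum hU k) (fun i _ => hd i)
        simpa [mul_comm] using this
    _ = ∑ i, f (d i) := by
        rw [Finset.sum_comm]
        refine Finset.sum_congr rfl fun i _ => ?_
        rw [← Finset.sum_mul, unitary_col_sum hU, one_mul]

theorem peierls_concave {V W : Matrix ι ι ℂ} (hV : V ∈ unitaryGroup ι ℂ)
    (hW : W ∈ unitaryGroup ι ℂ) {d : ι → ℝ} {s : Set ℝ} (hd : ∀ i, d i ∈ s) {f : ℝ → ℝ}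
    (hf : ConcaveOn ℝ s f) :
    ∑ i, f (d i) ≤ ∑ k, f ((Wᴴ * conjDiag V d * W) k k).re := by
  have := peierls hV hW hd hf.neg
  simpa using this

end Diag
end QDec

namespace QDec
open Matrix

/-! ### Power traces: triangle and Clarkson inequalities. -/

section Schatten
variable {ι κ : Type*} [Fintype ι] [DecidableEq ι] [Fintype κ] [DecidableEq κ]

/-- `tr |Z|^p` for a Hermitian matrix `Z`. -/
noncomputable def absPow (p : ℝ) (Z : Matrix ι ι ℂ) : ℝ :=
  (cfc (fun x : ℝ => |x| ^ p) Z).trace.re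

theorem absPow_conjDiag {V : Matrix ι ι ℂ} (hV : V ∈ unitaryGroup ι ℂ) (p : ℝ) (d : ι → ℝ) :
    absPow p (conjDiag V d) = ∑ i, |d i| ^ p := by
  rw [absPow, cfc_conjDiag hV, trace_conjDiag hV, Complex.ofReal_re]

theorem mpow_conjDiag {V : Matrix ι ι ℂ} (hV : V ∈ unitaryGroup ι ℂ) (r : ℝ) (d : ι → ℝ) :
    mpow (conjDiag V d) r = conjDiag V (fun i => d i ^ r) := cfc_conjDiag hV d _

theorem mlog_conjDiag {V : Matrix ι ι ℂ} (hV : V ∈ unitaryGroup ι ℂ) (d : ι → ℝ) :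
    mlog (conjDiag V d) = conjDiag V (fun i => Real.logb 2 (d i)) := cfc_conjDiag hV d _

theorem trace_mpow_conjDiag {V : Matrix ι ι ℂ} (hV : V ∈ unitaryGroup ι ℂ) (r : ℝ) (d : ι → ℝ) :
    (mpow (conjDiag V d) r).trace.re = ∑ i, d i ^ r := by
  rw [mpow_conjDiag hV, trace_conjDiag hV, Complex.ofReal_re]

theorem absPow_nonneg {Z : Matrix ι ι ℂ} (hZ : Z.IsHermitian) (p : ℝ) : 0 ≤ absPow p Z := by
  obtain ⟨V, hV, d, rfl⟩ := exists_conjDiag hZ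
  rw [absPow_conjDiag hV]
  exact Finset.sum_nonneg fun i _ => Real.rpow_nonneg (abs_nonneg _) _

theorem absPow_eq_trace_mpow {Z : Matrix ι ι ℂ} (hZ : Z.PosSemidef) (p : ℝ) :
    absPow p Z = (mpow Z p).trace.re := by
  obtain ⟨V, hV, d, hd, rfl⟩ := exists_conjDiag_nonneg hZ
  rw [absPow_conjDiag hV, trace_mpow_conjDiag hV]
  exact Finset.sum_congr rfl fun i _ => by rw [abs_of_nonneg (hd i)]

theorem convexOn_abs_rpow {p : ℝ} (hp : 1 ≤ p) : ConvexOn ℝ Set.univ fun x : ℝ => |x| ^ p := by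
  refine ⟨convex_univ, fun x _ y _ a b ha hb hab => ?_⟩
  have h := (convexOn_rpow hp).2 (Set.mem_Ici.2 (abs_nonneg x)) (Set.mem_Ici.2 (abs_nonneg y))
    ha hb hab
  refine le_trans ?_ h
  refine Real.rpow_le_rpow (abs_nonneg _) ?_ (by linarith)
  calc |a • x + b • y| ≤ |a • x| + |b • y| := abs_add_le _ _
    _ = _ := by simp [abs_mul, abs_of_nonneg ha, abs_of_nonneg hb]

/-- Peierls' inequality for `|x|^p`. It yields lower bounds on `absPow` from the diagonal in any
convenient basis, and equality holds in an eigenbasis of `Z`. -/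
theorem sum_diag_abs_rpow_le {Z W : Matrix ι ι ℂ} (hZ : Z.IsHermitian)
    (hW : W ∈ unitaryGroup ι ℂ) {p : ℝ} (hp : 1 ≤ p) :
    ∑ k, |((Wᴴ * Z * W) k k).re| ^ p ≤ absPow p Z := by
  obtain ⟨V, hV, d, rfl⟩ := exists_conjDiag hZ
  rw [absPow_conjDiag hV]
  exact peierls hV hW (fun i => Set.mem_univ (d i)) (convexOn_abs_rpow hp)

theorem conj_conjDiag_self {V : Matrix ι ι ℂ} (hV : V ∈ unitaryGroup ι ℂ) (d : ι → ℝ) :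
    Vᴴ * conjDiag V d * V = diagonal (fun i => (d i : ℂ)) := by
  have h : Vᴴ * V = 1 := mem_unitaryGroup_iff'.1 hV
  calc Vᴴ * conjDiag V d * V
      = (Vᴴ * V) * diagonal (fun i => (d i : ℂ)) * (Vᴴ * V) := by
        simp only [conjDiag, Matrix.mul_assoc]
    _ = _ := by rw [h]; simp

/-- In an eigenbasis of the sum, each eigenvalue is a sum of diagonal entries of the `Z i`. The
scalar power-mean inequality produces the constant, and Peierls' inequality bounds the diagonal of
each summand. -/
theorem absPow_sum_le {α : Type*} (t : Finset α) (Z : α → Matrix ι ι ℂ)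
    (hZ : ∀ i ∈ t, (Z i).IsHermitian) {p : ℝ} (hp : 1 ≤ p) :
    absPow p (∑ i ∈ t, Z i) ≤ (t.card : ℝ) ^ (p - 1) * ∑ i ∈ t, absPow p (Z i) := by
  have hsum : (∑ i ∈ t, Z i).IsHermitian := by
    rw [Matrix.IsHermitian, conjTranspose_sum]
    exact Finset.sum_congr rfl hZ
  obtain ⟨V, hV, d, hd⟩ := exists_conjDiag hsum
  rw [hd, absPow_conjDiag hV]
  have hdk : ∀ k, d k = ∑ i ∈ t, ((Vᴴ * Z i * V) k k).re := by
    intro k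
    have h1 : (Vᴴ * (∑ i ∈ t, Z i) * V) k k = (d k : ℂ) := by
      rw [hd, conj_conjDiag_self hV]; simp
    rw [Matrix.mul_sum, Matrix.sum_mul, Matrix.sum_apply] at h1
    rw [← Complex.re_sum, h1, Complex.ofReal_re]
  calc ∑ k, |d k| ^ p
      ≤ ∑ k, (t.card : ℝ) ^ (p - 1) * ∑ i ∈ t, |((Vᴴ * Z i * V) k k).re| ^ p := by
        refine Finset.sum_le_sum fun k _ => ?_
        rw [hdk]
        exact (Real.rpow_le_rpow (abs_nonneg _) (Finset.abs_sum_le_sum_abs _ _)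
          (by linarith)).trans (Real.rpow_sum_le_const_mul_sum_rpow t _ hp)
    _ = (t.card : ℝ) ^ (p - 1) * ∑ i ∈ t, ∑ k, |((Vᴴ * Z i * V) k k).re| ^ p := by
        rw [← Finset.mul_sum, Finset.sum_comm]
    _ ≤ _ := by
        gcongr with i hi
        exact sum_diag_abs_rpow_le (hZ i hi) hV hp

theorem trace_cfc_eq_sum_roots {Z : Matrix ι ι ℂ} (hZ : Z.IsHermitian) (f : ℝ → ℝ) :
    (cfc f Z).trace.re = (Z.charpoly.roots.map fun z => f z.re).sum := by
  rw [hZ.roots_charpoly_eq_eigenvalues]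
  conv_lhs => rw [conjDiag_eigen hZ, cfc_conjDiag hZ.eigenvectorUnitary.2,
    trace_conjDiag hZ.eigenvectorUnitary.2, Complex.ofReal_re]
  simp [Multiset.map_map]

/-- The characteristic polynomials of `Kᴴ * K` and `K * Kᴴ` agree up to powers of `X`, so the
nonzero eigenvalues coincide with multiplicity. The surplus zeros contribute `f 0 = 0`. -/
theorem trace_cfc_conjTranspose_mul_self (K : Matrix κ ι ℂ) {f : ℝ → ℝ} (hf : f 0 = 0) :
    (cfc f (Kᴴ * K)).trace.re = (cfc f (K * Kᴴ)).trace.re := by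
  have h1 := isHermitian_conjTranspose_mul_self K
  have h2 := isHermitian_mul_conjTranspose_self K
  rw [trace_cfc_eq_sum_roots h1, trace_cfc_eq_sum_roots h2]
  have h := congrArg (fun q : Polynomial ℂ => (q.roots.map fun z => f z.re).sum)
    (charpoly_mul_comm' Kᴴ K)
  have hX : ∀ k : ℕ, (Polynomial.X ^ k : Polynomial ℂ) ≠ 0 := fun k => pow_ne_zero _ Polynomial.X_ne_zero
  rw [Polynomial.roots_mul (mul_ne_zero (hX _) (charpoly_monic _).ne_zero),
    Polynomial.roots_mul (mul_ne_zero (hX _) (charpoly_monic _).ne_zero)] at h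
  simpa [hf, Multiset.map_nsmul, Multiset.sum_nsmul] using h

/-- Stacking `x` over `y` gives `K` with `Kᴴ * K = x² + y²`, while `K * Kᴴ` has diagonal blocks `x²`
and `y²`. Concave Peierls in a basis that diagonalises these two blocks bounds the trace of the
`q`-th power by the contribution of the blocks. -/
theorem trace_mpow_sq_add_sq_le {x y : Matrix ι ι ℂ} (hx : x.IsHermitian) (hy : y.IsHermitian)
    {q : ℝ} (hq0 : 0 < q) (hq1 : q ≤ 1) :
    (mpow (x * x + y * y) q).trace.re ≤ absPow (2 * q) x + absPow (2 * q) y := by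
  obtain ⟨V, hV, d, rfl⟩ := exists_conjDiag hx
  obtain ⟨W, hW, e, rfl⟩ := exists_conjDiag hy
  set x := conjDiag V d with hxd
  set y := conjDiag W e with hye
  have hxx : x * x = conjDiag V (fun i => d i * d i) := conjDiag_mul hV _ _
  have hyy : y * y = conjDiag W (fun i => e i * e i) := conjDiag_mul hW _ _
  let K : Matrix (ι ⊕ ι) ι ℂ := fromRows x y
  have hK1 : Kᴴ * K = x * x + y * y := by
    simp only [K, conjTranspose_fromRows_eq_fromCols_conjTranspose, fromCols_mul_fromRows]
    rw [hx.eq, hy.eq]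
  have hK2 : K * Kᴴ = fromBlocks (x * x) (x * y) (y * x) (y * y) := by
    simp only [K, conjTranspose_fromRows_eq_fromCols_conjTranspose, fromRows_mul_fromCols]
    rw [hx.eq, hy.eq]
  let U : Matrix (ι ⊕ ι) (ι ⊕ ι) ℂ := fromBlocks V 0 0 W
  have hU : U ∈ unitaryGroup (ι ⊕ ι) ℂ := by
    have h1 : V * Vᴴ = 1 := mem_unitaryGroup_iff.1 hV
    have h2 : W * Wᴴ = 1 := mem_unitaryGroup_iff.1 hW
    rw [mem_unitaryGroup_iff, star_eq_conjTranspose]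
    simp [U, fromBlocks_conjTranspose, fromBlocks_multiply, h1, h2]
  have hUK : Uᴴ * (K * Kᴴ) * U = fromBlocks (Vᴴ * (x * x) * V) (Vᴴ * (x * y) * W)
      (Wᴴ * (y * x) * V) (Wᴴ * (y * y) * W) := by
    rw [hK2]
    simp [U, fromBlocks_conjTranspose, fromBlocks_multiply]
  have hq : (0 : ℝ) ^ q = 0 := Real.zero_rpow hq0.ne'
  rw [mpow, ← hK1, trace_cfc_conjTranspose_mul_self K hq]
  obtain ⟨R, hR, c, hc0, hc⟩ := exists_conjDiag_nonneg (posSemidef_self_mul_conjTranspose K)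
  have hP := peierls_concave hR hU (s := Set.Ici 0) hc0 (Real.concaveOn_rpow hq0.le hq1)
  rw [hc, cfc_conjDiag hR, trace_conjDiag hR, Complex.ofReal_re]
  refine hP.trans (le_of_eq ?_)
  have habs : ∀ t : ℝ, (t * t) ^ q = |t| ^ (2 * q) := fun t => by
    rw [Real.rpow_mul (abs_nonneg t), ← abs_mul_abs_self]; norm_cast; rw [pow_two]
  rw [← hc, hUK, Fintype.sum_sum_type, hxx, hyy, conj_conjDiag_self hV, conj_conjDiag_self hW,
    hxd, hye, absPow_conjDiag hV, absPow_conjDiag hW]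
  simp only [fromBlocks_apply₁₁, fromBlocks_apply₂₂, diagonal_apply_eq, Complex.ofReal_re, habs]

theorem absPow_eq_trace_mpow_sq {x : Matrix ι ι ℂ} (hx : x.IsHermitian) (p : ℝ) :
    absPow p x = (mpow (x * x) (p / 2)).trace.re := by
  obtain ⟨V, hV, d, rfl⟩ := exists_conjDiag hx
  rw [conjDiag_mul hV, trace_mpow_conjDiag hV, absPow_conjDiag hV]
  refine Finset.sum_congr rfl fun i _ => ?_
  rw [← abs_mul_abs_self, ← pow_two, ← Real.rpow_natCast, ← Real.rpow_mul (abs_nonneg _)]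
  congr 1; push_cast; ring

omit [DecidableEq ι] in
theorem posSemidef_mul_self {x : Matrix ι ι ℂ} (hx : x.IsHermitian) : (x * x).PosSemidef := by
  have := posSemidef_conjTranspose_mul_self x
  rwa [hx.eq] at this

/-- A **Clarkson inequality** for the Schatten norms of order between `1` and `2`. -/
theorem clarkson {x y : Matrix ι ι ℂ} (hx : x.IsHermitian) (hy : y.IsHermitian)
    {p : ℝ} (hp0 : 0 < p) (hp2 : p ≤ 2) :
    absPow p (x + y) + absPow p (x - y) ≤ 2 * (absPow p x + absPow p y) := by
  have hq0 : 0 < p / 2 := by linarith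
  have hq1 : p / 2 ≤ 1 := by linarith
  have hconc := Real.concaveOn_rpow hq0.le hq1
  have hm := (posSemidef_mul_self hx).add (posSemidef_mul_self hy)
  have hB := trace_mpow_sq_add_sq_le hx hy hq0 hq1
  rw [mul_div_cancel₀ p (two_ne_zero)] at hB
  refine le_trans ?_ (mul_le_mul_of_nonneg_left hB zero_le_two)
  obtain ⟨W, hW, e, he0, he⟩ := exists_conjDiag_nonneg hm
  have one_side : ∀ {z : Matrix ι ι ℂ}, z.IsHermitian →
      absPow p z ≤ ∑ k, ((Wᴴ * (z * z) * W) k k).re ^ (p / 2) := by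
    intro z hz
    rw [absPow_eq_trace_mpow_sq hz]
    obtain ⟨R, hR, c, hc0, hc⟩ := exists_conjDiag_nonneg (posSemidef_mul_self hz)
    rw [hc, trace_mpow_conjDiag hR]
    exact peierls_concave hR hW (s := Set.Ici 0) hc0 hconc
  have hdiag : ∀ {z : Matrix ι ι ℂ}, z.IsHermitian → ∀ k, 0 ≤ ((Wᴴ * (z * z) * W) k k).re := by
    intro z hz k
    have := ((posSemidef_mul_self hz).conjTranspose_mul_mul_same W).diag_nonneg (i := k)
    exact (Complex.le_def.1 this).1
  have hadd := hx.add hy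
  have hsub := hx.sub hy
  -- The parallelogram identity `(x + y)² + (x - y)² = 2(x² + y²)`, read on the diagonal in an
  -- eigenbasis of `x² + y²`. Midpoint concavity of `u ^ (p / 2)` then finishes the comparison.
  have hmid : ∀ k, e k = (1 / 2 : ℝ) * ((Wᴴ * ((x + y) * (x + y)) * W) k k).re
      + (1 / 2 : ℝ) * ((Wᴴ * ((x - y) * (x - y)) * W) k k).re := by
    intro k
    have h1 : (Wᴴ * (x * x + y * y) * W) k k = (e k : ℂ) := by
      rw [he, conj_conjDiag_self hW]; simp
    have h2 : (Wᴴ * ((x + y) * (x + y)) * W) + (Wᴴ * ((x - y) * (x - y)) * W)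
        = (2 : ℂ) • (Wᴴ * (x * x + y * y) * W) := by
      rw [← Matrix.add_mul, ← Matrix.mul_add, ← Matrix.smul_mul, ← Matrix.mul_smul]
      congr 2
      rw [two_smul]; noncomm_ring
    have h3 := congrArg (fun M : Matrix ι ι ℂ => (M k k).re) h2
    simp only [Matrix.add_apply, Matrix.smul_apply, h1, Complex.add_re] at h3
    simp at h3
    linarith
  rw [he, trace_mpow_conjDiag hW, Finset.mul_sum]
  refine (add_le_add (one_side hadd) (one_side hsub)).trans ?_
  rw [← Finset.sum_add_distrib]
  refine Finset.sum_le_sum fun k _ => ?_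
  have := hconc.2 (Set.mem_Ici.2 (hdiag hadd k)) (Set.mem_Ici.2 (hdiag hsub k))
    (by norm_num : (0 : ℝ) ≤ 1 / 2) (by norm_num : (0 : ℝ) ≤ 1 / 2) (by norm_num)
  simp only [smul_eq_mul] at this
  rw [hmid k]
  linarith

end Schatten
end QDec

namespace QDec
open Matrix

/-! ### Relative entropy bounded by the sandwiched functional. -/

section Entropy
variable {ι κ : Type*} [Fintype ι] [DecidableEq ι] [Fintype κ] [DecidableEq κ]

/-- The columns of `S` lie in the range of `conjDiag W b`, which is orthogonal to the eigenvectors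
of eigenvalue `0`. -/
theorem conjTranspose_mul_eq_zero_of_supp_le {S W : Matrix ι ι ℂ} {b : ι → ℝ}
    (hW : W ∈ unitaryGroup ι ℂ) (h : supp S ≤ supp (conjDiag W b)) {j : ι} (hj : b j = 0) (k : ι) :
    (Wᴴ * S) j k = 0 := by
  have hmem : S *ᵥ Pi.single k 1 ∈ supp (conjDiag W b) := h ⟨_, rfl⟩
  obtain ⟨u, hu⟩ := hmem
  have hu' : conjDiag W b *ᵥ u = S *ᵥ Pi.single k 1 := hu
  have h1 : (Wᴴ * S) j k = (Wᴴ *ᵥ (S *ᵥ Pi.single k 1)) j := by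
    rw [mulVec_mulVec]; simp
  have h2 : Wᴴ * W = 1 := mem_unitaryGroup_iff'.1 hW
  have h3 : Wᴴ * conjDiag W b = diagonal (fun i => (b i : ℂ)) * Wᴴ := by
    rw [conjDiag, ← Matrix.mul_assoc, ← Matrix.mul_assoc, h2, Matrix.one_mul]
  rw [h1, ← hu', mulVec_mulVec, h3, ← mulVec_mulVec, mulVec_diagonal]
  simp [hj]

/-- This is `1 + u ≤ exp u` at `u = s (log a - L)`, multiplied by `a`. Since `2t(1 + s) = -s`, the
right side becomes `(a * exp (t L)²)^(1 + s)`. In the application `a` is an eigenvalue of the state,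
`L` the mean of `log σ` in its eigenvector, and `g` the mean of `σ^t`. -/
theorem rpow_mul_ge {a L g s t : ℝ} (ha : 0 ≤ a) (hs : 0 < s)
    (ht : t = (1 - (1 + s)) / (2 * (1 + s))) (hg : 0 < a → Real.exp (t * L) ≤ g) :
    a + s * (a * Real.log a - a * L) ≤ |a * g ^ 2| ^ (1 + s) := by
  rcases ha.eq_or_lt with rfl | ha'
  · simp [Real.zero_rpow (by linarith : 1 + s ≠ 0)]
  have hg' := hg ha'
  have hpos : 0 < Real.exp (t * L) := Real.exp_pos _
  have h1 : a * Real.exp (s * Real.log a - s * L) = (a * Real.exp (t * L) ^ 2) ^ (1 + s) := by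
    have hae : a = Real.exp (Real.log a) := (Real.exp_log ha').symm
    have h2t : 2 * t * (1 + s) = - s := by rw [ht]; field_simp; ring
    calc a * Real.exp (s * Real.log a - s * L)
        = Real.exp (Real.log a) * Real.exp (s * Real.log a - s * L) := by rw [← hae]
      _ = Real.exp ((Real.log a + 2 * (t * L)) * (1 + s)) := by
          rw [← Real.exp_add]; congr 1
          linear_combination (-L) * h2t
      _ = (Real.exp (Real.log a) * Real.exp (t * L) ^ 2) ^ (1 + s) := by
          rw [← Real.exp_nat_mul, ← Real.exp_add, Real.exp_mul]; norm_num
      _ = _ := by rw [← hae]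
  calc a + s * (a * Real.log a - a * L) = a * ((s * Real.log a - s * L) + 1) := by ring
    _ ≤ a * Real.exp (s * Real.log a - s * L) :=
        mul_le_mul_of_nonneg_left (Real.add_one_le_exp _) ha
    _ = (a * Real.exp (t * L) ^ 2) ^ (1 + s) := h1
    _ ≤ (a * g ^ 2) ^ (1 + s) := by gcongr
    _ = _ := by rw [abs_of_nonneg (by positivity)]

/-- The relative entropy is bounded by the sandwiched Rényi functional. -/
theorem trace_mul_mlog_sub_le {S σ : Matrix ι ι ℂ} (hS : IsState S) (hσ : σ.PosSemidef)
    (h : supp S ≤ supp σ) {s : ℝ} (hs : 0 < s) :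
    (S * (mlog S - mlog σ)).trace.re ≤ (sandwichedQ (1 + s) S σ - 1) / (s * Real.log 2) := by
  obtain ⟨hSp, hS1⟩ := hS
  obtain ⟨V, hV, a, ha, rfl⟩ := exists_conjDiag_nonneg hSp
  obtain ⟨W, hW, b, hb, rfl⟩ := exists_conjDiag_nonneg hσ
  have hVV : Vᴴ * V = 1 := mem_unitaryGroup_iff'.1 hV
  set U := Vᴴ * W with hUd
  have hU : U ∈ unitaryGroup ι ℂ := unitary_mul (unitary_conjTranspose hV) hW
  set w : ι → ι → ℝ := fun i j => Complex.normSq (U i j) with hw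
  set t : ℝ := (1 - (1 + s)) / (2 * (1 + s)) with ht
  -- An eigenvector of `S` of positive eigenvalue has no overlap with the kernel of `σ`. Hence the
  -- default values of `log 0` and of `0 ^ t` never count.
  have hw0 : ∀ i j, 0 < a i → b j = 0 → w i j = 0 := by
    intro i j hai hbj
    have h0 : (Wᴴ * conjDiag V a * V) j i = 0 := by
      rw [Matrix.mul_apply]
      exact Finset.sum_eq_zero fun k _ => by
        rw [conjTranspose_mul_eq_zero_of_supp_le hW h hbj, zero_mul]
    have h1 : Wᴴ * conjDiag V a * V = Uᴴ * diagonal (fun i => (a i : ℂ)) := by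
      calc Wᴴ * conjDiag V a * V = Wᴴ * V * diagonal (fun i => (a i : ℂ)) * (Vᴴ * V) := by
            simp only [conjDiag, Matrix.mul_assoc]
        _ = _ := by rw [hVV]; simp [hUd]
    rw [h1, mul_diagonal] at h0
    simpa [hai.ne', hw] using h0
  have htr1 : ∑ i, a i = 1 := by
    rw [trace_conjDiag hV] at hS1; exact_mod_cast hS1
  have hconj : ∀ c : ι → ℝ, Vᴴ * conjDiag W c * V = conjDiag U c := fun c => by
    have := conj_conjDiag Vᴴ W c
    rwa [conjTranspose_conjTranspose] at this
  set L : ι → ℝ := fun i => ∑ j, w i j * Real.log (b j) with hL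
  have hD : (conjDiag V a * (mlog (conjDiag V a) - mlog (conjDiag W b))).trace.re
      = (∑ i, (a i * Real.log (a i) - a i * L i)) / Real.log 2 := by
    rw [mlog_conjDiag hV, mlog_conjDiag hW, Matrix.mul_sub, trace_sub, conjDiag_mul hV,
      trace_conjDiag hV, Complex.sub_re, Complex.ofReal_re, Finset.sum_sub_distrib, sub_div,
      Finset.sum_div, Finset.sum_div]
    congr 1
    · exact Finset.sum_congr rfl fun i _ => by rw [Real.logb, mul_div_assoc]
    · have : (conjDiag V a * conjDiag W fun i => Real.logb 2 (b i)).trace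
          = (diagonal (fun i => (a i : ℂ)) * conjDiag U fun i => Real.logb 2 (b i)).trace := by
        rw [← hconj, conjDiag]
        rw [Matrix.mul_assoc, Matrix.mul_assoc, Matrix.trace_mul_comm]
        simp only [Matrix.mul_assoc]
      rw [this, Matrix.trace, Complex.re_sum]
      refine Finset.sum_congr rfl fun i _ => ?_
      rw [Matrix.diag_apply, diagonal_mul, conjDiag_diag, ← Complex.ofReal_mul, Complex.ofReal_re,
        hL, mul_div_assoc, Finset.sum_div]
      congr 1
      exact Finset.sum_congr rfl fun j _ => by rw [Real.logb, hw]; ring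
  set G := conjDiag U (fun j => b j ^ t) with hG
  have hGH : Gᴴ = G := conjDiag_isHermitian _ _
  set X := mpow (conjDiag W b) t * conjDiag V a * mpow (conjDiag W b) t with hX
  -- In the eigenbasis of `S`, `X` becomes `G diag(a) G` with `G` Hermitian but in general not
  -- unitary. Its `i`-th diagonal entry is `∑ k, a k |G i k|²`, which is at least `a i * (G i i)²`.
  have hXV : Vᴴ * X * V = conjDiag G a := by
    have : Vᴴ * X * V = (Vᴴ * mpow (conjDiag W b) t * V) * diagonal (fun i => (a i : ℂ)) *
        (Vᴴ * mpow (conjDiag W b) t * V) := by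
      simp only [hX, conjDiag, Matrix.mul_assoc]
    rw [this, mpow_conjDiag hW, hconj, ← hG]
    conv_rhs => rw [conjDiag, hGH]
  have hXp : X.PosSemidef := by
    have hM : (mpow (conjDiag W b) t)ᴴ = mpow (conjDiag W b) t := by
      rw [mpow_conjDiag hW]; exact conjDiag_isHermitian _ _
    have := hSp.mul_mul_conjTranspose_same (mpow (conjDiag W b) t)
    rwa [hM] at this
  have hQ : sandwichedQ (1 + s) (conjDiag V a) (conjDiag W b) = absPow (1 + s) X :=
    (absPow_eq_trace_mpow hXp _).symm
  -- Jensen's inequality for `exp`, with the overlaps `w i j` as weights. Terms with `b j = 0` have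
  -- weight zero by `hw0`.
  have hGii : ∀ i, 0 < a i → Real.exp (t * L i) ≤ (G i i).re := by
    intro i hai
    have hj := convexOn_exp.map_sum_le (t := Finset.univ) (w := fun j => w i j)
      (p := fun j => t * Real.log (b j)) (fun j _ => Complex.normSq_nonneg _)
      (unitary_row_sum hU i) (fun _ _ => Set.mem_univ _)
    simp only [smul_eq_mul] at hj
    rw [hG, conjDiag_diag_re]
    calc Real.exp (t * L i) = Real.exp (∑ j, w i j * (t * Real.log (b j))) := by
          rw [hL, Finset.mul_sum]; congr 1
          exact Finset.sum_congr rfl fun j _ => by ring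
      _ ≤ _ := hj
      _ = _ := by
          refine Finset.sum_congr rfl fun j _ => ?_
          rcases (hb j).eq_or_lt with h0 | h0
          · have := hw0 i j hai h0.symm
            simp only [hw] at this ⊢
            rw [this]; ring
          · rw [mul_comm t, Real.exp_mul, Real.exp_log h0, mul_comm]
  have hlow : ∀ i, a i + s * (a i * Real.log (a i) - a i * L i)
      ≤ |((Vᴴ * X * V) i i).re| ^ (1 + s) := by
    intro i
    refine (rpow_mul_ge (ha i) hs ht (hGii i)).trans ?_
    refine Real.rpow_le_rpow (abs_nonneg _) ?_ (by linarith)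
    rw [hXV, conjDiag_diag_re G a i, abs_of_nonneg (mul_nonneg (ha i) (sq_nonneg _))]
    refine le_trans ?_ (le_abs_self _)
    refine le_trans ?_ (Finset.single_le_sum
      (f := fun k => a k * Complex.normSq (G i k))
      (fun k _ => mul_nonneg (ha k) (Complex.normSq_nonneg _)) (Finset.mem_univ i))
    refine mul_le_mul_of_nonneg_left ?_ (ha i)
    rw [Complex.normSq_apply]
    nlinarith [mul_self_nonneg (G i i).im]
  have hmain : 1 + s * ∑ i, (a i * Real.log (a i) - a i * L i) ≤ absPow (1 + s) X := by
    refine le_trans ?_ (sum_diag_abs_rpow_le hXp.1 hV (by linarith))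
    refine le_trans (le_of_eq ?_) (Finset.sum_le_sum fun i _ => hlow i)
    rw [Finset.sum_add_distrib, htr1, Finset.mul_sum]
  have hlog : 0 < Real.log 2 := Real.log_pos (by norm_num)
  rw [hD, hQ, ← div_div]
  gcongr
  rw [le_div_iff₀ hs]
  linarith

end Entropy
end QDec

namespace QDec
open Matrix

/-! ### From the sandwiched functional to the deviation from the mean. -/

section Entropy
variable {ι κ : Type*} [Fintype ι] [DecidableEq ι] [Fintype κ] [DecidableEq κ]

/-- Bernoulli's inequality, extended below `-1`, where the left side is negative because `p ≥ 1`. -/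
theorem one_add_mul_le_abs_rpow {p : ℝ} (hp : 1 ≤ p) (x : ℝ) : 1 + p * x ≤ |1 + x| ^ p := by
  rcases le_or_gt (-1) x with h | h
  · rw [abs_of_nonneg (by linarith)]
    exact one_add_mul_self_le_rpow_one_add h hp
  · have : 0 ≤ |1 + x| ^ p := Real.rpow_nonneg (abs_nonneg _) _
    nlinarith

/-- For `b > 0` the quantity inside the absolute value is `b^(1/p) * (1 + (1 - c/b))`, so Bernoulli
at `1 - c/b` applies. For `b = 0` the left side is `-p c ≤ 0`. -/
theorem add_mul_sub_le_abs_rpow {p b c : ℝ} (hp : 1 < p) (hb : 0 ≤ b) (hc : 0 ≤ c) :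
    b + p * (b - c) ≤
      |2 * b ^ (1 / p) - b ^ ((1 - p) / (2 * p)) * c * b ^ ((1 - p) / (2 * p))| ^ p := by
  have hp0 : 0 < p := by linarith
  rcases hb.eq_or_lt with rfl | hb
  · refine le_trans ?_ (Real.rpow_nonneg (abs_nonneg _) _)
    nlinarith
  have h1 : b ^ ((1 - p) / (2 * p)) * c * b ^ ((1 - p) / (2 * p)) = b ^ (1 / p) * (c / b) := by
    have : b ^ ((1 - p) / (2 * p)) * b ^ ((1 - p) / (2 * p)) = b ^ (1 / p) / b := by
      rw [← Real.rpow_add hb, ← Real.rpow_sub_one hb.ne']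
      congr 1; field_simp; ring
    calc _ = b ^ ((1 - p) / (2 * p)) * b ^ ((1 - p) / (2 * p)) * c := by ring
      _ = _ := by rw [this]; ring
  have h2 : 2 * b ^ (1 / p) - b ^ (1 / p) * (c / b) = b ^ (1 / p) * (1 + (1 - c / b)) := by ring
  rw [h1, h2, abs_mul, Real.mul_rpow (abs_nonneg _) (abs_nonneg _),
    abs_of_nonneg (Real.rpow_nonneg hb.le _), ← Real.rpow_mul hb.le, one_div_mul_cancel hp0.ne',
    Real.rpow_one]
  calc b + p * (b - c) = b * (1 + p * (1 - c / b)) := by field_simp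
    _ ≤ _ := mul_le_mul_of_nonneg_left (one_add_mul_le_abs_rpow hp.le _) hb.le

theorem mpow_isHermitian {σ : Matrix ι ι ℂ} (hσ : σ.IsHermitian) (r : ℝ) :
    (mpow σ r).IsHermitian := by
  obtain ⟨W, hW, b, rfl⟩ := exists_conjDiag hσ
  rw [mpow_conjDiag hW]
  exact conjDiag_isHermitian _ _

theorem mpow_mul_mul_mpow_posSemidef {S σ : Matrix ι ι ℂ} (hS : S.PosSemidef)
    (hσ : σ.IsHermitian) (r : ℝ) : (mpow σ r * S * mpow σ r).PosSemidef := by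
  have := hS.mul_mul_conjTranspose_same (mpow σ r)
  rwa [(mpow_isHermitian hσ r).eq] at this

/-- Clarkson for `x = σ^(1/p)` and `X - x` gives `tr X^p + tr |2x - X|^p ≤ 2(1 + tr |X - x|^p)`,
because `tr x^p = tr σ = 1`. It remains to see that `tr |2x - X|^p ≥ 1`. The leading constant must
be exactly `1`, in order to cancel against the entropy bound. -/
theorem sandwichedQ_le {S σ : Matrix ι ι ℂ} (hS : IsState S) (hσ : IsState σ) {p : ℝ}
    (hp : 1 < p) (hp2 : p ≤ 2) :
    sandwichedQ p S σ ≤ 1 + 2 * absPow p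
      (mpow σ ((1 - p) / (2 * p)) * S * mpow σ ((1 - p) / (2 * p)) - mpow σ (1 / p)) := by
  have hX := mpow_mul_mul_mpow_posSemidef hS.1 hσ.1.1 ((1 - p) / (2 * p))
  rw [sandwichedQ, ← absPow_eq_trace_mpow hX]
  obtain ⟨W, hW, b, hb, hσW⟩ := exists_conjDiag_nonneg hσ.1
  have htr : ∑ i, b i = 1 := by
    have := hσ.2
    rw [hσW, trace_conjDiag hW] at this; exact_mod_cast this
  set X := mpow σ ((1 - p) / (2 * p)) * S * mpow σ ((1 - p) / (2 * p)) with hXd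
  set x := mpow σ (1 / p) with hx
  have hxH : x.IsHermitian := mpow_isHermitian hσ.1.1 _
  have hp0 : 0 < p := by linarith
  have hxp : absPow p x = 1 := by
    rw [hx, hσW, mpow_conjDiag hW, absPow_conjDiag hW]
    refine Eq.trans ?_ htr
    refine Finset.sum_congr rfl fun i _ => ?_
    rw [abs_of_nonneg (Real.rpow_nonneg (hb i) _), ← Real.rpow_mul (hb i),
      one_div_mul_cancel hp0.ne', Real.rpow_one]
  have hcl := clarkson hxH (hX.1.sub hxH) hp0 hp2
  rw [add_sub_cancel, hxp] at hcl
  -- Peierls in an eigenbasis of `σ` reduces the claim to the scalar inequality for the eigenvalues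
  -- `b k` of `σ` and the diagonal entries of `S`. The linear terms `p (b - c)` sum to zero because
  -- both traces are one.
  have hlow : 1 ≤ absPow p (x - (X - x)) := by
    refine le_trans ?_ (sum_diag_abs_rpow_le (hxH.sub (hX.1.sub hxH)) hW hp.le)
    have hWW : Wᴴ * W = 1 := mem_unitaryGroup_iff'.1 hW
    have hWS := hS.1.conjTranspose_mul_mul_same W
    have hc : ∀ k, 0 ≤ ((Wᴴ * S * W) k k).re := fun k =>
      (Complex.le_def.1 (hWS.diag_nonneg (i := k))).1
    have htrS : ∑ k, ((Wᴴ * S * W) k k).re = 1 := by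
      rw [← Complex.re_sum]
      change (Wᴴ * S * W).trace.re = 1
      rw [Matrix.trace_mul_comm, ← Matrix.mul_assoc,
        show W * Wᴴ = 1 from mem_unitaryGroup_iff.1 hW, Matrix.one_mul,
        hS.2, Complex.one_re]
    have hdiag : ∀ k, ((Wᴴ * (x - (X - x)) * W) k k).re = 2 * b k ^ (1 / p) -
        b k ^ ((1 - p) / (2 * p)) * ((Wᴴ * S * W) k k).re * b k ^ ((1 - p) / (2 * p)) := by
      intro k
      have hXW : Wᴴ * X * W = diagonal (fun i => ((b i ^ ((1 - p) / (2 * p)) : ℝ) : ℂ)) *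
          (Wᴴ * S * W) * diagonal (fun i => ((b i ^ ((1 - p) / (2 * p)) : ℝ) : ℂ)) := by
        rw [hXd, hσW, mpow_conjDiag hW, conjDiag]
        calc _ = (Wᴴ * W) * diagonal (fun i => ((b i ^ ((1 - p) / (2 * p)) : ℝ) : ℂ)) *
              (Wᴴ * S * W) * diagonal (fun i => ((b i ^ ((1 - p) / (2 * p)) : ℝ) : ℂ)) *
              (Wᴴ * W) := by simp only [Matrix.mul_assoc]
          _ = _ := by rw [hWW]; simp
      have hxW : Wᴴ * x * W = diagonal (fun i => ((b i ^ (1 / p) : ℝ) : ℂ)) := by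
        rw [hx, hσW, mpow_conjDiag hW, conj_conjDiag_self hW]
      have : Wᴴ * (x - (X - x)) * W = Wᴴ * x * W - (Wᴴ * X * W - Wᴴ * x * W) := by
        simp only [Matrix.mul_sub, Matrix.sub_mul]
      rw [this, hXW, hxW]
      simp only [Matrix.sub_apply, diagonal_apply_eq, mul_diagonal, diagonal_mul, Complex.sub_re,
        Complex.ofReal_re, Complex.re_mul_ofReal, Complex.re_ofReal_mul]
      ring
    calc (1 : ℝ) = ∑ k, (b k + p * (b k - ((Wᴴ * S * W) k k).re)) := by
          rw [Finset.sum_add_distrib, ← Finset.mul_sum, Finset.sum_sub_distrib, htr, htrS]; ring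
      _ ≤ _ := Finset.sum_le_sum fun k _ => by
          rw [hdiag]; exact add_mul_sub_le_abs_rpow hp (hb k) (hc k)
  linarith

theorem trace_mul_mlog_sub_le_absPow {S σ : Matrix ι ι ℂ} (hS : IsState S) (hσ : IsState σ)
    (h : supp S ≤ supp σ) {s : ℝ} (hs : 0 < s) (hs1 : s ≤ 1) :
    (S * (mlog S - mlog σ)).trace.re ≤ 2 / (s * Real.log 2) * absPow (1 + s)
      (mpow σ ((1 - (1 + s)) / (2 * (1 + s))) * S * mpow σ ((1 - (1 + s)) / (2 * (1 + s)))
        - mpow σ (1 / (1 + s))) := by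
  have h1 := trace_mul_mlog_sub_le hS hσ.1 h hs
  have h2 := sandwichedQ_le hS hσ (by linarith : 1 < 1 + s) (by linarith)
  have hlog : 0 < Real.log 2 := Real.log_pos (by norm_num)
  refine h1.trans ?_
  rw [div_mul_eq_mul_div]
  gcongr
  linarith

end Entropy
end QDec

namespace QDec
open Matrix MeasureTheory

/-! ### Haar moments of the entries of a unitary matrix. -/

section Haar
variable {A : Type*} [Fintype A] [DecidableEq A]

instance isHaarMeasure_haarUnitary : (haarUnitary A).IsHaarMeasure := by
  unfold haarUnitary; infer_instance

instance isProbabilityMeasure_haarUnitary : IsProbabilityMeasure (haarUnitary A) :=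
  ⟨by simpa [haarUnitary] using Measure.haarMeasure_self (K₀ := (⊤ : TopologicalSpace.PositiveCompacts (unitaryGroup A ℂ)))⟩

/-- A right translate of the Haar measure is again a left-invariant probability measure, hence equal
to it by uniqueness. -/
instance isMulRightInvariant_haarUnitary : (haarUnitary A).IsMulRightInvariant := by
  refine ⟨fun g => ?_⟩
  have : IsProbabilityMeasure (Measure.map (· * g) (haarUnitary A)) :=
    Measure.isProbabilityMeasure_map (by fun_prop)
  exact Measure.isHaarMeasure_eq_of_isProbabilityMeasure _ _

theorem integrable_haarUnitary {f : unitaryGroup A ℂ → ℝ} (hf : Continuous f) :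
    Integrable f (haarUnitary A) :=
  hf.integrable_of_hasCompactSupport (HasCompactSupport.of_compactSpace f)

theorem integral_haarUnitary_sum {α : Type*} {t : Finset α} {f : α → unitaryGroup A ℂ → ℝ}
    (hf : ∀ i, Continuous (f i)) :
    ∫ U, ∑ i ∈ t, f i U ∂haarUnitary A = ∑ i ∈ t, ∫ U, f i U ∂haarUnitary A :=
  integral_finsetSum _ fun i _ => integrable_haarUnitary (hf i)

theorem continuous_normSq_entry (i j : A) :
    Continuous fun U : unitaryGroup A ℂ => Complex.normSq ((U : Matrix A A ℂ) i j) := by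
  have : Continuous fun U : unitaryGroup A ℂ => (U : Matrix A A ℂ) i j :=
    (continuous_apply_apply i j).comp continuous_subtype_val
  exact Complex.continuous_normSq.comp this

/-- The reflection acting on `span (e_j, e_l)` as `!![α, conj β; β, -α]`. -/
noncomputable def planeReflection (j l : A) (α : ℝ) (β : ℂ) : Matrix A A ℂ :=
  1 + (single j j ((α : ℂ) - 1) + single l j β + single j l (star β) + single l l (-(α : ℂ) - 1))

theorem planeReflection_mem {j l : A} (h : j ≠ l) {α : ℝ} {β : ℂ}
    (hαβ : α ^ 2 + Complex.normSq β = 1) : planeReflection j l α β ∈ unitaryGroup A ℂ := by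
  have hβ : (α : ℂ) ^ 2 + star β * β = 1 := by
    have := congrArg (fun x : ℝ => (x : ℂ)) hαβ
    push_cast at this
    rw [← Complex.mul_conj, mul_comm β] at this
    exact this
  have hH : (planeReflection j l α β)ᴴ = planeReflection j l α β := by
    simp [planeReflection, conjTranspose_add]
    abel
  rw [mem_unitaryGroup_iff, star_eq_conjTranspose, hH, planeReflection]
  set N := single j j ((α : ℂ) - 1) + single l j β + single j l (star β) +
    single l l (-(α : ℂ) - 1) with hN
  -- `1 + N` is Hermitian, so it is unitary once it squares to `1`, which amounts to `N² = -2N`.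
  have hNN : N * N = - (N + N) := by
    have h1 : N * N = single j j (((α : ℂ) - 1) * (α - 1) + star β * β)
        + single l j (β * (α - 1) + (-(α : ℂ) - 1) * β)
        + single j l (((α : ℂ) - 1) * star β + star β * (-(α : ℂ) - 1))
        + single l l (β * star β + (-(α : ℂ) - 1) * (-(α : ℂ) - 1)) := by
      rw [hN]
      simp only [Matrix.add_mul, Matrix.mul_add, single_mul_single_same,
        single_mul_single_of_ne _ _ _ _ h, single_mul_single_of_ne _ _ _ _ h.symm, add_zero,
        zero_add, single_add]
      abel
    have e1 : ((α : ℂ) - 1) * (α - 1) + star β * β = -(((α : ℂ) - 1) + (α - 1)) := by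
      linear_combination hβ
    have e2 : β * (α - 1) + (-(α : ℂ) - 1) * β = -(β + β) := by ring
    have e3 : ((α : ℂ) - 1) * star β + star β * (-(α : ℂ) - 1) = -(star β + star β) := by ring
    have e4 : β * star β + (-(α : ℂ) - 1) * (-(α : ℂ) - 1)
        = -((-(α : ℂ) - 1) + (-(α : ℂ) - 1)) := by linear_combination hβ
    rw [h1, e1, e2, e3, e4, hN]
    ext a b
    simp only [Matrix.add_apply, Matrix.neg_apply, Matrix.single_apply]
    split_ifs <;> ring
  rw [show (1 + N) * (1 + N) = 1 + (N + N) + N * N by noncomm_ring, hNN]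
  abel

theorem mul_planeReflection_apply {j l : A} (h : j ≠ l) (α : ℝ) (β : ℂ) (U : Matrix A A ℂ) (i : A) :
    (U * planeReflection j l α β) i j = α * U i j + β * U i l := by
  simp [planeReflection, Matrix.mul_add, mul_single_apply_of_ne _ _ _ _ _ h]
  ring

/-- At `α = 0`, `β = 1` the reflection is the transposition of the basis vectors `j` and `l`. -/
theorem swapReflection_mul_apply {j l : A} (h : j ≠ l) (U : Matrix A A ℂ) (k : A) :
    (planeReflection j l 0 1 * U) j k = U l k := by
  simp [planeReflection, Matrix.add_mul, single_mul_apply_of_ne _ _ _ _ _ h]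

theorem swapReflection_mul_apply_of_ne {j l i : A} (hj : i ≠ j) (hl : i ≠ l) (U : Matrix A A ℂ)
    (k : A) : (planeReflection j l 0 1 * U) i k = U i k := by
  simp [planeReflection, Matrix.add_mul, single_mul_apply_of_ne _ _ _ _ _ hj,
    single_mul_apply_of_ne _ _ _ _ _ hl]

theorem integral_entry_planeReflection (i : A) {j l : A} (h : j ≠ l) {α : ℝ} {β : ℂ}
    (hαβ : α ^ 2 + Complex.normSq β = 1) (f : ℂ → ℝ) :
    ∫ U, f (α * (U : Matrix A A ℂ) i j + β * (U : Matrix A A ℂ) i l) ∂haarUnitary A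
      = ∫ U, f ((U : Matrix A A ℂ) i j) ∂haarUnitary A := by
  rw [← integral_mul_right_eq_self (μ := haarUnitary A)
    (fun U : unitaryGroup A ℂ => f ((U : Matrix A A ℂ) i j)) ⟨_, planeReflection_mem h hαβ⟩]
  refine integral_congr_ae (Filter.Eventually.of_forall fun U => ?_)
  change _ = f (((U : Matrix A A ℂ) * planeReflection j l α β) i j)
  rw [mul_planeReflection_apply h]

theorem integral_entry_eq (i j l : A) (f : ℂ → ℝ) :
    ∫ U, f ((U : Matrix A A ℂ) i l) ∂haarUnitary A
      = ∫ U, f ((U : Matrix A A ℂ) i j) ∂haarUnitary A := by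
  rcases eq_or_ne j l with rfl | h
  · rfl
  · simpa using integral_entry_planeReflection i h (α := 0) (β := 1) (by simp) f

theorem integral_normSq_entry (i j : A) :
    ∫ U, Complex.normSq ((U : Matrix A A ℂ) i j) ∂haarUnitary A = 1 / Fintype.card A := by
  have h1 : ∑ l, ∫ U, Complex.normSq ((U : Matrix A A ℂ) i l) ∂haarUnitary A = 1 := by
    rw [← integral_finsetSum _ fun l _ => integrable_haarUnitary (continuous_normSq_entry i l)]
    simp [fun U : unitaryGroup A ℂ => unitary_row_sum U.2 i]
  rw [Finset.sum_congr rfl fun l _ => integral_entry_eq i j l Complex.normSq] at h1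
  simp only [Finset.sum_const, Finset.card_univ, nsmul_eq_mul] at h1
  exact eq_one_div_of_mul_eq_one_right h1

/-- Replacing `U i j` by `(3/5) U i j + (4/5) ζ U i l` preserves the fourth moment `a`, for every
phase `ζ`. Summing over the fourth roots of unity cancels the phase-dependent terms and leaves `4a =
(324/625 + 1024/625) a + (2304/625) m`, where `m` is the mixed moment. This gives `a = 2m`. The pair
`(3/5, 4/5)` is just a rational point of the unit circle. -/
theorem integral_normSq_mul_normSq (i : A) {j l : A} (h : j ≠ l) :
    ∫ U, (Complex.normSq ((U : Matrix A A ℂ) i j)) ^ 2 ∂haarUnitary A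
      = 2 * ∫ U, Complex.normSq ((U : Matrix A A ℂ) i j) * Complex.normSq ((U : Matrix A A ℂ) i l)
        ∂haarUnitary A := by
  set a := ∫ U, (Complex.normSq ((U : Matrix A A ℂ) i j)) ^ 2 ∂haarUnitary A with ha
  have hc := continuous_normSq_entry (A := A) i
  have key : ∀ ζ : ℂ, Complex.normSq ζ = 1 →
      ∫ U, (Complex.normSq (((3 / 5 : ℝ) : ℂ) * (U : Matrix A A ℂ) i j +
        (((4 / 5 : ℝ) : ℂ) * ζ) * (U : Matrix A A ℂ) i l)) ^ 2 ∂haarUnitary A = a := fun ζ hζ =>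
    integral_entry_planeReflection i h (α := 3 / 5) (β := ((4 / 5 : ℝ) : ℂ) * ζ)
      (by rw [Complex.normSq_mul, hζ, Complex.normSq_ofReal]; norm_num)
      (fun z => Complex.normSq z ^ 2)
  have hcont : ∀ ζ : ℂ, Continuous fun U : unitaryGroup A ℂ =>
      (Complex.normSq (((3 / 5 : ℝ) : ℂ) * (U : Matrix A A ℂ) i j +
        (((4 / 5 : ℝ) : ℂ) * ζ) * (U : Matrix A A ℂ) i l)) ^ 2 := by
    intro ζ
    have : ∀ j, Continuous fun U : unitaryGroup A ℂ => (U : Matrix A A ℂ) i j := fun j =>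
      (continuous_apply_apply i j).comp continuous_subtype_val
    exact (Complex.continuous_normSq.comp ((continuous_const.mul (this j)).add
      (continuous_const.mul (this l)))).pow 2
  have hsum : ∫ U, ((Complex.normSq (((3 / 5 : ℝ) : ℂ) * (U : Matrix A A ℂ) i j +
        (((4 / 5 : ℝ) : ℂ) * 1) * (U : Matrix A A ℂ) i l)) ^ 2
      + (Complex.normSq (((3 / 5 : ℝ) : ℂ) * (U : Matrix A A ℂ) i j +
        (((4 / 5 : ℝ) : ℂ) * (-1)) * (U : Matrix A A ℂ) i l)) ^ 2)
      + ((Complex.normSq (((3 / 5 : ℝ) : ℂ) * (U : Matrix A A ℂ) i j +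
        (((4 / 5 : ℝ) : ℂ) * Complex.I) * (U : Matrix A A ℂ) i l)) ^ 2
      + (Complex.normSq (((3 / 5 : ℝ) : ℂ) * (U : Matrix A A ℂ) i j +
        (((4 / 5 : ℝ) : ℂ) * (-Complex.I)) * (U : Matrix A A ℂ) i l)) ^ 2) ∂haarUnitary A
      = (a + a) + (a + a) := by
    rw [integral_add, integral_add, integral_add, key _ (by simp), key _ (by simp),
      key _ (by simp), key _ (by simp)]
    all_goals
      first
      | exact integrable_haarUnitary (hcont _)
      | exact integrable_haarUnitary ((hcont _).add (hcont _))
  have hpt : ∀ x y : ℂ, ((Complex.normSq (((3 / 5 : ℝ) : ℂ) * x + (((4 / 5 : ℝ) : ℂ) * 1) * y)) ^ 2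
      + (Complex.normSq (((3 / 5 : ℝ) : ℂ) * x + (((4 / 5 : ℝ) : ℂ) * (-1)) * y)) ^ 2)
      + ((Complex.normSq (((3 / 5 : ℝ) : ℂ) * x + (((4 / 5 : ℝ) : ℂ) * Complex.I) * y)) ^ 2
      + (Complex.normSq (((3 / 5 : ℝ) : ℂ) * x + (((4 / 5 : ℝ) : ℂ) * (-Complex.I)) * y)) ^ 2)
      = (324 / 625 : ℝ) * Complex.normSq x ^ 2 + (1024 / 625 : ℝ) * Complex.normSq y ^ 2
        + (2304 / 625 : ℝ) * (Complex.normSq x * Complex.normSq y) := by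
    intro x y
    simp only [Complex.normSq_apply, Complex.add_re, Complex.add_im, Complex.mul_re,
      Complex.mul_im, Complex.ofReal_re, Complex.ofReal_im, Complex.I_re, Complex.I_im,
      Complex.one_re, Complex.one_im, Complex.neg_re, Complex.neg_im]
    ring
  simp only [hpt] at hsum
  have hl : ∫ U, (Complex.normSq ((U : Matrix A A ℂ) i l)) ^ 2 ∂haarUnitary A = a :=
    integral_entry_eq i j l fun z => Complex.normSq z ^ 2
  rw [integral_add, integral_add, integral_const_mul, integral_const_mul, integral_const_mul, hl,
    ← ha] at hsum
  · linarith
  all_goals apply integrable_haarUnitary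
  · exact continuous_const.mul ((hc j).pow 2)
  · exact continuous_const.mul ((hc l).pow 2)
  · exact (continuous_const.mul ((hc j).pow 2)).add (continuous_const.mul ((hc l).pow 2))
  · exact continuous_const.mul ((hc j).mul (hc l))

theorem integral_rowSum_sq (i : A) (c : A → ℝ) :
    ∫ U, (∑ j, c j * Complex.normSq ((U : Matrix A A ℂ) i j)) ^ 2 ∂haarUnitary A
      = (∑ j, c j ^ 2 + (∑ j, c j) ^ 2) / (Fintype.card A * (Fintype.card A + 1)) := by
  have hc := continuous_normSq_entry (A := A) i
  set b := (∫ U, (Complex.normSq ((U : Matrix A A ℂ) i i)) ^ 2 ∂haarUnitary A) / 2 with hb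
  have hq : ∀ j l, ∫ U, Complex.normSq ((U : Matrix A A ℂ) i j) *
      Complex.normSq ((U : Matrix A A ℂ) i l) ∂haarUnitary A = b * ((if j = l then 1 else 0) + 1) := by
    intro j l
    have hj : ∫ U, (Complex.normSq ((U : Matrix A A ℂ) i j)) ^ 2 ∂haarUnitary A = 2 * b := by
      rw [integral_entry_eq i i j fun z => Complex.normSq z ^ 2, hb]; ring
    rcases eq_or_ne j l with rfl | h
    · simp only [← pow_two, hj]; simp; ring
    · have := integral_normSq_mul_normSq i h
      simp [h]; linarith
  have hgen : ∀ c : A → ℝ,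
      ∫ U, (∑ j, c j * Complex.normSq ((U : Matrix A A ℂ) i j)) ^ 2 ∂haarUnitary A
        = b * (∑ j, c j ^ 2 + (∑ j, c j) ^ 2) := by
    intro c
    have hpt : ∀ U : unitaryGroup A ℂ, (∑ j, c j * Complex.normSq ((U : Matrix A A ℂ) i j)) ^ 2
        = ∑ j, ∑ l, (c j * c l) * (Complex.normSq ((U : Matrix A A ℂ) i j) *
          Complex.normSq ((U : Matrix A A ℂ) i l)) := by
      intro U
      rw [pow_two, Finset.sum_mul_sum]
      exact Finset.sum_congr rfl fun j _ => Finset.sum_congr rfl fun l _ => by ring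
    simp only [hpt]
    have hint : ∀ j l, Continuous fun U : unitaryGroup A ℂ => (c j * c l) *
        (Complex.normSq ((U : Matrix A A ℂ) i j) * Complex.normSq ((U : Matrix A A ℂ) i l)) :=
      fun j l => continuous_const.mul ((hc j).mul (hc l))
    rw [integral_haarUnitary_sum fun j => continuous_finsetSum _ fun l _ => hint j l]
    rw [Finset.sum_congr rfl fun j _ => integral_haarUnitary_sum fun l => hint j l]
    simp only [integral_const_mul, hq]
    simp only [mul_add, Finset.sum_add_distrib, mul_ite, mul_one, mul_zero, Finset.sum_ite_eq,
      Finset.mem_univ, if_true]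
    rw [pow_two (∑ j, c j), Finset.sum_mul_sum, Finset.mul_sum, Finset.mul_sum]
    congr 1
    · exact Finset.sum_congr rfl fun j _ => by ring
    · refine Finset.sum_congr rfl fun j _ => ?_
      rw [Finset.mul_sum]
      exact Finset.sum_congr rfl fun l _ => by ring
  -- The remaining constant `b` is found at `c = 1`, where the row sum is identically one.
  have h1 := hgen fun _ => 1
  have hcard : (0 : ℝ) < Fintype.card A := by
    exact_mod_cast Fintype.card_pos_iff.2 ⟨i⟩
  have h2 : b * (Fintype.card A * (Fintype.card A + 1)) = 1 := by
    have : ∫ U, (∑ j, (1 : ℝ) * Complex.normSq ((U : Matrix A A ℂ) i j)) ^ 2 ∂haarUnitary A = 1 := by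
      simp [fun U : unitaryGroup A ℂ => unitary_row_sum U.2 i]
    rw [this] at h1
    simp at h1
    linarith
  rw [hgen, eq_div_iff (by positivity)]
  linear_combination (∑ j, c j ^ 2 + (∑ j, c j) ^ 2) * h2

end Haar
end QDec

namespace QDec
open Matrix MeasureTheory

/-! ### Second moments of the trace of a rotated operator. -/

section Haar
variable {A : Type*} [Fintype A] [DecidableEq A]

/-- With `g i` the weighted row sums, `E (g i)²` is a constant `a`. Invariance under transpositions
makes `E (g i * g k)` independent of `k ≠ i`. Unit column sums and `∑ c = 0` force `∑ k, g k = 0`,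
so these mixed moments equal `-a / (d - 1)`. The quadratic form in `n` is then explicit, and its
term in `(∑ n)²` is nonpositive. -/
theorem integral_sum_rowSum_sq_le {c : A → ℝ} (hc0 : ∑ j, c j = 0) (n : A → ℝ) :
    ∫ U, (∑ i, n i * ∑ j, c j * Complex.normSq ((U : Matrix A A ℂ) i j)) ^ 2 ∂haarUnitary A
      ≤ 2 / (Fintype.card A : ℝ) ^ 2 * (∑ j, c j ^ 2) * ∑ i, n i ^ 2 := by
  rcases isEmpty_or_nonempty A with hA | hA
  · simp
  set d : ℝ := ((Fintype.card A : ℕ) : ℝ) with hd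
  have hd1 : 1 ≤ d := by
    rw [hd]; exact_mod_cast Fintype.card_pos
  set g : A → unitaryGroup A ℂ → ℝ := fun i U =>
    ∑ j, c j * Complex.normSq ((U : Matrix A A ℂ) i j) with hg
  have hgc : ∀ i, Continuous (g i) := fun i =>
    continuous_finsetSum _ fun j _ => continuous_const.mul (continuous_normSq_entry i j)
  set a : ℝ := (∑ j, c j ^ 2) / (d * (d + 1)) with ha
  have ha0 : 0 ≤ a := div_nonneg (Finset.sum_nonneg fun _ _ => sq_nonneg _) (by positivity)
  set h : A → A → ℝ := fun i k => ∫ U, g i U * g k U ∂haarUnitary A with hh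
  have hdiag : ∀ i, h i i = a := fun i => by
    have := integral_rowSum_sq i c
    rw [hc0] at this
    simp only [hh, ← pow_two, hg, this, ha, hd]
    simp
  have hswap : ∀ i k l, k ≠ i → l ≠ i → h i k = h i l := by
    intro i k l hk hl
    rcases eq_or_ne k l with rfl | hkl
    · rfl
    have hmem := planeReflection_mem hkl (α := 0) (β := 1) (by simp)
    simp only [hh]
    rw [← integral_mul_left_eq_self (μ := haarUnitary A) (fun U => g i U * g k U) ⟨_, hmem⟩]
    refine integral_congr_ae (Filter.Eventually.of_forall fun U => ?_)
    change (∑ j, c j * Complex.normSq ((planeReflection k l 0 1 * (U : Matrix A A ℂ)) i j)) *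
      (∑ j, c j * Complex.normSq ((planeReflection k l 0 1 * (U : Matrix A A ℂ)) k j)) = _
    simp only [swapReflection_mul_apply hkl, swapReflection_mul_apply_of_ne hk.symm hl.symm]
    rfl
  have hzero : ∀ i, ∑ k, h i k = 0 := by
    intro i
    simp only [hh]
    rw [← integral_haarUnitary_sum (f := fun k U => g i U * g k U) fun k => (hgc i).mul (hgc k)]
    have : ∀ U : unitaryGroup A ℂ, ∑ k, g i U * g k U = 0 := by
      intro U
      rw [← Finset.mul_sum, hg, Finset.sum_comm]
      simp_rw [← Finset.mul_sum, fun j => unitary_col_sum U.2 j, mul_one, hc0, mul_zero]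
    simp [this]
  have hoff : ∀ i k, i ≠ k → h i k = -(a / (d - 1)) := by
    intro i k hik
    have h1 := hzero i
    rw [← Finset.add_sum_erase _ _ (Finset.mem_univ i), hdiag,
      Finset.sum_congr rfl fun l hl => hswap i l k (Finset.ne_of_mem_erase hl) hik.symm,
      Finset.sum_const, Finset.card_erase_of_mem (Finset.mem_univ i), Finset.card_univ,
      nsmul_eq_mul, Nat.cast_sub Fintype.card_pos, ← hd, Nat.cast_one] at h1
    have hd2 : 0 < d - 1 := by
      have : 1 < Fintype.card A := Fintype.one_lt_card_iff.2 ⟨i, k, hik⟩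
      have : (1 : ℝ) < d := by rw [hd]; exact_mod_cast this
      linarith
    rw [← neg_div, eq_div_iff hd2.ne']
    linarith
  have hexp : ∫ U, (∑ i, n i * g i U) ^ 2 ∂haarUnitary A = ∑ i, ∑ k, n i * n k * h i k := by
    have hpt : ∀ U, (∑ i, n i * g i U) ^ 2 = ∑ i, ∑ k, n i * n k * (g i U * g k U) := by
      intro U
      rw [pow_two, Finset.sum_mul_sum]
      exact Finset.sum_congr rfl fun j _ => Finset.sum_congr rfl fun l _ => by ring
    have hint : ∀ i k, Continuous fun U => n i * n k * (g i U * g k U) := fun i k =>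
      continuous_const.mul ((hgc i).mul (hgc k))
    simp only [hpt]
    rw [integral_haarUnitary_sum fun i => continuous_finsetSum _ fun k _ => hint i k]
    rw [Finset.sum_congr rfl fun i _ => integral_haarUnitary_sum fun k => hint i k]
    simp only [integral_const_mul, hh]
  have hval : ∑ i, ∑ k, n i * n k * h i k
      = (a + a / (d - 1)) * ∑ i, n i ^ 2 - a / (d - 1) * (∑ i, n i) ^ 2 := by
    have : ∀ i k, n i * n k * h i k = (if i = k then (a + a / (d - 1)) * n i ^ 2 else 0)
        - a / (d - 1) * (n i * n k) := by
      intro i k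
      rcases eq_or_ne i k with rfl | hik
      · rw [hdiag]; simp; ring
      · rw [hoff i k hik]; simp [hik]; ring
    simp only [this, Finset.sum_sub_distrib, Finset.sum_ite_eq, Finset.mem_univ, if_true]
    rw [Finset.mul_sum, pow_two (∑ i, n i), Finset.sum_mul_sum, Finset.mul_sum]
    simp only [Finset.mul_sum]
  -- For `d = 1` the quotient is `0` by the convention on division by zero; there are then no mixed
  -- moments.
  have hle : a / (d - 1) ≤ a := by
    rcases le_or_gt (Fintype.card A) 1 with h1 | h1
    · have : d = 1 := le_antisymm (by rw [hd]; exact_mod_cast h1) hd1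
      simpa [this] using ha0
    · have : (2 : ℝ) ≤ d := by rw [hd]; exact_mod_cast h1
      exact div_le_self ha0 (by linarith)
  have hle0 : 0 ≤ a / (d - 1) := div_nonneg ha0 (by linarith)
  have hn : 0 ≤ ∑ i, n i ^ 2 := Finset.sum_nonneg fun _ _ => sq_nonneg _
  have hc2 : 0 ≤ ∑ i, c i ^ 2 := Finset.sum_nonneg fun _ _ => sq_nonneg _
  have haub : a ≤ (∑ j, c j ^ 2) / d ^ 2 := by
    rw [ha]; gcongr; nlinarith
  change ∫ U, (∑ i, n i * g i U) ^ 2 ∂haarUnitary A ≤ _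
  rw [hexp, hval]
  calc _ ≤ (a + a / (d - 1)) * ∑ i, n i ^ 2 := by
        have : 0 ≤ a / (d - 1) * (∑ i, n i) ^ 2 := mul_nonneg hle0 (sq_nonneg _)
        linarith
    _ ≤ (2 * ((∑ j, c j ^ 2) / d ^ 2)) * ∑ i, n i ^ 2 := by
        gcongr; linarith
    _ = _ := by ring

/-- In eigenbases of the two operators only the squared moduli of the entries of a unitary appear.
Bi-invariance of the Haar measure later absorbs the factors `Wᴴ` and `V`. -/
theorem trace_conjDiag_rotation (U V W : Matrix A A ℂ) (m n : A → ℝ) :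
    (U * conjDiag V m * Uᴴ * conjDiag W n).trace
      = ((∑ i, n i * ∑ j, m j * Complex.normSq ((Wᴴ * U * V) i j) : ℝ) : ℂ) := by
  have h1 : (U * conjDiag V m * Uᴴ * conjDiag W n).trace
      = (conjDiag (Wᴴ * U * V) m * diagonal fun i => (n i : ℂ)).trace := by
    have := conj_conjDiag Wᴴ (U * V) m
    rw [conjTranspose_conjTranspose] at this
    rw [conj_conjDiag, conjDiag.eq_1 W, ← Matrix.mul_assoc, Matrix.trace_mul_comm, Matrix.mul_assoc Wᴴ,
      ← this]
    simp only [Matrix.mul_assoc]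
  rw [h1, Matrix.trace]
  push_cast
  refine Finset.sum_congr rfl fun i _ => ?_
  rw [Matrix.diag_apply, mul_diagonal, conjDiag_diag, mul_comm]
  push_cast; rfl

theorem integral_haarUnitary_mul_mul {V W : Matrix A A ℂ} (hV : V ∈ unitaryGroup A ℂ)
    (hW : W ∈ unitaryGroup A ℂ) (F : Matrix A A ℂ → ℝ) :
    ∫ U, F (W * (U : Matrix A A ℂ) * V) ∂haarUnitary A = ∫ U, F (U : Matrix A A ℂ) ∂haarUnitary A := by
  calc ∫ U, F (W * (U : Matrix A A ℂ) * V) ∂haarUnitary A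
      = ∫ U, (fun U : unitaryGroup A ℂ => F (W * (U : Matrix A A ℂ))) (U * ⟨V, hV⟩)
          ∂haarUnitary A := by
        refine integral_congr_ae (Filter.Eventually.of_forall fun U => ?_)
        exact congrArg F (Matrix.mul_assoc _ _ _)
    _ = ∫ U, (fun U : unitaryGroup A ℂ => F (U : Matrix A A ℂ)) (⟨W, hW⟩ * U) ∂haarUnitary A :=
        integral_mul_right_eq_self (μ := haarUnitary A)
          (fun U : unitaryGroup A ℂ => F (W * (U : Matrix A A ℂ))) ⟨V, hV⟩
    _ = _ := integral_mul_left_eq_self (μ := haarUnitary A)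
        (fun U : unitaryGroup A ℂ => F (U : Matrix A A ℂ)) ⟨W, hW⟩

/-- The squared Hilbert–Schmidt norm. -/
def frobSq {ι κ : Type*} [Fintype ι] [Fintype κ] (M : Matrix ι κ ℂ) : ℝ :=
  ∑ i, ∑ j, Complex.normSq (M i j)

theorem frobSq_nonneg {ι κ : Type*} [Fintype ι] [Fintype κ] (M : Matrix ι κ ℂ) : 0 ≤ frobSq M :=
  Finset.sum_nonneg fun _ _ => Finset.sum_nonneg fun _ _ => Complex.normSq_nonneg _

omit [DecidableEq A] in
theorem trace_mul_self_re {M : Matrix A A ℂ} (hM : M.IsHermitian) :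
    (M * M).trace.re = frobSq M := by
  rw [Matrix.trace, Complex.re_sum, frobSq]
  refine Finset.sum_congr rfl fun i _ => ?_
  rw [Matrix.diag_apply, Matrix.mul_apply, Complex.re_sum]
  refine Finset.sum_congr rfl fun j _ => ?_
  rw [← hM.apply j i]
  change (M i j * (starRingEnd ℂ) (M i j)).re = _
  rw [Complex.mul_conj, Complex.ofReal_re]

theorem frobSq_conjDiag {V : Matrix A A ℂ} (hV : V ∈ unitaryGroup A ℂ) (d : A → ℝ) :
    frobSq (conjDiag V d) = ∑ i, d i ^ 2 := by
  rw [← trace_mul_self_re (conjDiag_isHermitian V d), conjDiag_mul hV, trace_conjDiag hV,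
    Complex.ofReal_re]
  exact Finset.sum_congr rfl fun i _ => (pow_two _).symm

theorem continuous_trace_rotation (M N : Matrix A A ℂ) :
    Continuous fun U : unitaryGroup A ℂ =>
      ((U : Matrix A A ℂ) * M * (U : Matrix A A ℂ)ᴴ * N).trace := by
  have : Continuous fun U : unitaryGroup A ℂ => (U : Matrix A A ℂ) := continuous_subtype_val
  fun_prop

theorem integral_normSq_trace_rotation_le_of_isHermitian {M N : Matrix A A ℂ} (hM : M.IsHermitian)
    (hN : N.IsHermitian) (h0 : M.trace = 0) :
    ∫ U, Complex.normSq ((U : Matrix A A ℂ) * M * (U : Matrix A A ℂ)ᴴ * N).trace ∂haarUnitary A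
      ≤ 2 / (Fintype.card A : ℝ) ^ 2 * frobSq M * frobSq N := by
  obtain ⟨V, hV, m, rfl⟩ := exists_conjDiag hM
  obtain ⟨W, hW, n, rfl⟩ := exists_conjDiag hN
  rw [trace_conjDiag hV] at h0
  have h0' : ∑ j, m j = 0 := by exact_mod_cast h0
  simp only [trace_conjDiag_rotation, Complex.normSq_ofReal, ← pow_two, frobSq_conjDiag hV,
    frobSq_conjDiag hW]
  rw [integral_haarUnitary_mul_mul hV (unitary_conjTranspose hW) fun X : Matrix A A ℂ =>
    (∑ i, n i * ∑ j, m j * Complex.normSq (X i j)) ^ 2]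
  exact integral_sum_rowSum_sq_le h0' n

theorem integral_trace_rotation_re {M N : Matrix A A ℂ} (hM : M.IsHermitian)
    (hN : N.IsHermitian) :
    ∫ U, ((U : Matrix A A ℂ) * M * (U : Matrix A A ℂ)ᴴ * N).trace.re ∂haarUnitary A
      = M.trace.re * N.trace.re / Fintype.card A := by
  obtain ⟨V, hV, m, rfl⟩ := exists_conjDiag hM
  obtain ⟨W, hW, n, rfl⟩ := exists_conjDiag hN
  simp only [trace_conjDiag_rotation, Complex.ofReal_re, trace_conjDiag hV, trace_conjDiag hW]
  rw [integral_haarUnitary_mul_mul hV (unitary_conjTranspose hW) fun X : Matrix A A ℂ =>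
    ∑ i, n i * ∑ j, m j * Complex.normSq (X i j)]
  have hcont : ∀ i j, Continuous fun U : unitaryGroup A ℂ =>
    m j * Complex.normSq ((U : Matrix A A ℂ) i j) := fun i j =>
      continuous_const.mul (continuous_normSq_entry i j)
  rw [integral_haarUnitary_sum (f := fun (i : A) (U : unitaryGroup A ℂ) => n i * ∑ j, m j *
    Complex.normSq ((U : Matrix A A ℂ) i j)) fun i => continuous_const.mul
    (continuous_finsetSum _ fun j _ => hcont i j)]
  simp only [integral_const_mul]
  rw [Finset.sum_congr rfl fun i _ => congrArg (n i * ·)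
    (integral_haarUnitary_sum (t := Finset.univ) fun j => hcont i j)]
  simp only [integral_const_mul, integral_normSq_entry]
  rw [← Finset.sum_mul, ← Finset.sum_mul]
  ring

omit [DecidableEq A] in
theorem exists_hermitian_split (M : Matrix A A ℂ) :
    ∃ H K : Matrix A A ℂ, H.IsHermitian ∧ K.IsHermitian ∧ M = H + Complex.I • K ∧
      frobSq H + frobSq K = frobSq M := by
  refine ⟨(1 / 2 : ℂ) • (M + Mᴴ), (-Complex.I / 2) • (M - Mᴴ), ?_, ?_, ?_, ?_⟩
  · ext i j
    simp
    ring
  · ext i j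
    simp
    ring
  · ext i j
    simp
    linear_combination ((1 / 2 : ℂ) * (M i j - (starRingEnd ℂ) (M j i))) * Complex.I_mul_I
  · have h1 : ∀ i j, Complex.normSq (((1 / 2 : ℂ) • (M + Mᴴ)) i j) +
        Complex.normSq (((-Complex.I / 2) • (M - Mᴴ)) i j)
        = (Complex.normSq (M i j) + Complex.normSq (M j i)) / 2 := by
      intro i j
      simp only [Matrix.smul_apply, Matrix.add_apply, Matrix.sub_apply, conjTranspose_apply,
        smul_eq_mul, Complex.normSq_mul]
      have : Complex.normSq (-Complex.I / 2) = 1 / 4 := by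
        rw [Complex.normSq_div, Complex.normSq_neg, Complex.normSq_I]; norm_num [Complex.normSq_apply]
      have h2 : Complex.normSq (1 / 2 : ℂ) = 1 / 4 := by norm_num [Complex.normSq_apply]
      rw [this, h2]
      simp only [Complex.normSq_apply, Complex.add_re, Complex.add_im, Complex.sub_re,
        Complex.sub_im, Complex.star_def, Complex.conj_re, Complex.conj_im]
      ring
    simp only [frobSq, ← Finset.sum_add_distrib, h1]
    simp only [← Finset.sum_div, Finset.sum_add_distrib]
    rw [Finset.sum_comm (f := fun i j => Complex.normSq (M j i))]
    ring

theorem normSq_add_four_le (a b c d : ℂ) : Complex.normSq (a + b + (c + d)) ≤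
    4 * (Complex.normSq a + Complex.normSq b + (Complex.normSq c + Complex.normSq d)) := by
  simp only [Complex.normSq_apply, Complex.add_re, Complex.add_im]
  nlinarith [sq_nonneg (a.re - b.re), sq_nonneg (a.re - c.re), sq_nonneg (a.re - d.re),
    sq_nonneg (b.re - c.re), sq_nonneg (b.re - d.re), sq_nonneg (c.re - d.re),
    sq_nonneg (a.im - b.im), sq_nonneg (a.im - c.im), sq_nonneg (a.im - d.im),
    sq_nonneg (b.im - c.im), sq_nonneg (b.im - d.im), sq_nonneg (c.im - d.im)]

/-- A second-moment bound for the Haar measure on the unitary group. -/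
theorem integral_normSq_trace_rotation_le {M : Matrix A A ℂ} (N : Matrix A A ℂ) (h0 : M.trace = 0) :
    ∫ U, Complex.normSq ((U : Matrix A A ℂ) * M * (U : Matrix A A ℂ)ᴴ * N).trace ∂haarUnitary A
      ≤ 8 / (Fintype.card A : ℝ) ^ 2 * frobSq M * frobSq N := by
  -- Off-diagonal blocks are not Hermitian, so both operators are split into Hermitian and
  -- skew-Hermitian parts. The four cross terms cost a factor `4`, turning `2` into `8`, and the
  -- squared norms recombine exactly. Both parts of `M` remain traceless because their traces are
  -- real.
  obtain ⟨H, K, hH, hK, rfl, hf⟩ := exists_hermitian_split M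
  obtain ⟨H', K', hH', hK', rfl, hf'⟩ := exists_hermitian_split N
  have htr : H.trace = 0 ∧ K.trace = 0 := by
    have hr : ∀ {Z : Matrix A A ℂ}, Z.IsHermitian → Z.trace.im = 0 := by
      intro Z hZ
      obtain ⟨V, hV, d, rfl⟩ := exists_conjDiag hZ
      rw [trace_conjDiag hV, Complex.ofReal_im]
    rw [trace_add, trace_smul, smul_eq_mul] at h0
    have h1 := congrArg Complex.re h0
    have h2 := congrArg Complex.im h0
    simp [hr hH, hr hK] at h1 h2
    exact ⟨Complex.ext h1 (hr hH), Complex.ext h2 (hr hK)⟩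
  set F : Matrix A A ℂ → Matrix A A ℂ → unitaryGroup A ℂ → ℝ := fun M N U =>
    Complex.normSq ((U : Matrix A A ℂ) * M * (U : Matrix A A ℂ)ᴴ * N).trace with hF
  have hFc : ∀ M N, Continuous (F M N) := fun M N =>
    Complex.continuous_normSq.comp (continuous_trace_rotation M N)
  have hpt : ∀ U, F (H + Complex.I • K) (H' + Complex.I • K') U
      ≤ 4 * (F H H' U + F K H' U + (F H K' U + F K K' U)) := by
    intro U
    have : ((U : Matrix A A ℂ) * (H + Complex.I • K) * (U : Matrix A A ℂ)ᴴ *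
        (H' + Complex.I • K')).trace
        = ((U : Matrix A A ℂ) * H * (U : Matrix A A ℂ)ᴴ * H').trace
        + Complex.I * ((U : Matrix A A ℂ) * K * (U : Matrix A A ℂ)ᴴ * H').trace
        + (Complex.I * ((U : Matrix A A ℂ) * H * (U : Matrix A A ℂ)ᴴ * K').trace
        + Complex.I * Complex.I * ((U : Matrix A A ℂ) * K * (U : Matrix A A ℂ)ᴴ * K').trace) := by
      simp only [Matrix.mul_add, Matrix.add_mul, Matrix.mul_smul, Matrix.smul_mul, trace_add,
        trace_smul, smul_eq_mul]
      ring
    simp only [hF]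
    rw [this]
    refine (normSq_add_four_le _ _ _ _).trans (le_of_eq ?_)
    simp only [Complex.normSq_mul, Complex.normSq_I, one_mul]
  have b1 := integral_normSq_trace_rotation_le_of_isHermitian hH hH' htr.1
  have b2 := integral_normSq_trace_rotation_le_of_isHermitian hK hH' htr.2
  have b3 := integral_normSq_trace_rotation_le_of_isHermitian hH hK' htr.1
  have b4 := integral_normSq_trace_rotation_le_of_isHermitian hK hK' htr.2
  calc ∫ U, F (H + Complex.I • K) (H' + Complex.I • K') U ∂haarUnitary A
      ≤ ∫ U, 4 * (F H H' U + F K H' U + (F H K' U + F K K' U)) ∂haarUnitary A :=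
        integral_mono (integrable_haarUnitary (hFc _ _)) (integrable_haarUnitary
          (continuous_const.mul (((hFc _ _).add (hFc _ _)).add ((hFc _ _).add (hFc _ _))))) hpt
    _ = 4 * ((∫ U, F H H' U ∂haarUnitary A + ∫ U, F K H' U ∂haarUnitary A) +
        (∫ U, F H K' U ∂haarUnitary A + ∫ U, F K K' U ∂haarUnitary A)) := by
        rw [integral_const_mul]
        exact congrArg (4 * ·) ((integral_add (f := fun U => F H H' U + F K H' U)
          (g := fun U => F H K' U + F K K' U) (integrable_haarUnitary ((hFc _ _).add (hFc _ _)))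
          (integrable_haarUnitary ((hFc _ _).add (hFc _ _)))).trans (congrArg₂ (· + ·)
          (integral_add (integrable_haarUnitary (hFc _ _)) (integrable_haarUnitary (hFc _ _)))
          (integral_add (integrable_haarUnitary (hFc _ _)) (integrable_haarUnitary (hFc _ _)))))
    _ ≤ 4 * ((2 / (Fintype.card A : ℝ) ^ 2 * frobSq H * frobSq H' +
          2 / (Fintype.card A : ℝ) ^ 2 * frobSq K * frobSq H') +
          (2 / (Fintype.card A : ℝ) ^ 2 * frobSq H * frobSq K' +
          2 / (Fintype.card A : ℝ) ^ 2 * frobSq K * frobSq K')) := by gcongr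
    _ = _ := by rw [← hf, ← hf']; ring

end Haar
end QDec

namespace QDec
open Matrix MeasureTheory

/-! ### Channel outputs as bilinear contractions over `A`. -/

section Contraction
variable {A E C : Type*} [Fintype A] [DecidableEq A] [Fintype E] [DecidableEq E]
  [Fintype C] [DecidableEq C]

/-- The block of an operator on `A ⊗ E` with indices `e, e'` on `E`. -/
def blk {A E : Type*} (X : Matrix (A × E) (A × E) ℂ) (e e' : E) : Matrix A A ℂ :=
  Matrix.of fun a a' => X (a, e) (a', e')

/-- The contraction over `A` of operators on `A ⊗ E` and `A ⊗ C`, normalised by `|A|`. For the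
Choi operator `Y` of a map `T`, this is `T ⊗ id` applied to `X`. -/
def contract (X : Matrix (A × E) (A × E) ℂ) (Y : Matrix (A × C) (A × C) ℂ) :
    Matrix (C × E) (C × E) ℂ :=
  Matrix.of fun p q => (Fintype.card A : ℂ) * (blk X p.2 q.2 * (blk Y p.1 q.1)ᵀ).trace

/-- The deviation of the contraction of a rotated operator from its mean. -/
def deviation (U : Matrix A A ℂ) (X : Matrix (A × E) (A × E) ℂ) (Y : Matrix (A × C) (A × C) ℂ) :
    Matrix (C × E) (C × E) ℂ :=
  contract (rotate U X) Y - traceFst Y ⊗ₖ traceFst X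

omit [DecidableEq A] [DecidableEq E] [Fintype E] in
theorem traceFst_apply (X : Matrix (A × E) (A × E) ℂ) (e e' : E) :
    traceFst X e e' = (blk X e e').trace := rfl

omit [DecidableEq A] [DecidableEq E] [DecidableEq C] [Fintype E] [Fintype C] in
theorem contract_apply (X : Matrix (A × E) (A × E) ℂ) (Y : Matrix (A × C) (A × C) ℂ)
    (p q : C × E) : contract X Y p q
      = (Fintype.card A : ℂ) * ∑ a, ∑ a', X (a, p.2) (a', q.2) * Y (a, p.1) (a', q.1) := rfl

omit [DecidableEq A] in
theorem blk_rotate (U : Matrix A A ℂ) (X : Matrix (A × E) (A × E) ℂ) (e e' : E) :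
    blk (rotate U X) e e' = U * blk X e e' * Uᴴ := by
  ext a a'
  simp only [blk, rotate, Matrix.of_apply, Matrix.mul_apply, Fintype.sum_prod_type,
    kroneckerMap_apply, conjTranspose_apply, Matrix.one_apply]
  simp [Finset.sum_mul, apply_ite (starRingEnd ℂ)]

omit [DecidableEq C] [DecidableEq A] [Fintype C] in
theorem deviation_apply (U : Matrix A A ℂ) (X : Matrix (A × E) (A × E) ℂ)
    (Y : Matrix (A × C) (A × C) ℂ) (p q : C × E) : deviation U X Y p q
      = (Fintype.card A : ℂ) * (U * blk X p.2 q.2 * Uᴴ * (blk Y p.1 q.1)ᵀ).trace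
        - (blk Y p.1 q.1).trace * (blk X p.2 q.2).trace := by
  rw [deviation, Matrix.sub_apply, contract, Matrix.of_apply, blk_rotate]
  rfl

omit [Fintype A] [DecidableEq A] [Fintype E] [DecidableEq E] in
theorem blk_sum_smul {α : Type*} (t : Finset α) (c : α → ℂ) (X : α → Matrix (A × E) (A × E) ℂ)
    (e e' : E) : blk (∑ i ∈ t, c i • X i) e e' = ∑ i ∈ t, c i • blk (X i) e e' := by
  ext a a'
  simp [blk, Matrix.sum_apply]

omit [DecidableEq C] [DecidableEq A] [Fintype C] in
theorem deviation_sum_left {α : Type*} (t : Finset α) (c : α → ℂ)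
    (X : α → Matrix (A × E) (A × E) ℂ) (U : Matrix A A ℂ) (Y : Matrix (A × C) (A × C) ℂ) :
    deviation U (∑ i ∈ t, c i • X i) Y = ∑ i ∈ t, c i • deviation U (X i) Y := by
  ext p q
  simp only [deviation_apply, Matrix.sum_apply, Matrix.smul_apply, blk_sum_smul,
    Matrix.sum_mul, Matrix.mul_smul, Matrix.smul_mul, trace_sum, trace_smul, smul_eq_mul,
    Finset.mul_sum, ← Finset.sum_sub_distrib]
  exact Finset.sum_congr rfl fun i _ => by ring

omit [DecidableEq C] [DecidableEq A] [Fintype C] in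
theorem deviation_sum_right {α : Type*} (t : Finset α) (c : α → ℂ)
    (Y : α → Matrix (A × C) (A × C) ℂ) (U : Matrix A A ℂ) (X : Matrix (A × E) (A × E) ℂ) :
    deviation U X (∑ i ∈ t, c i • Y i) = ∑ i ∈ t, c i • deviation U X (Y i) := by
  ext p q
  simp only [deviation_apply, Matrix.sum_apply, Matrix.smul_apply, blk_sum_smul,
    transpose_sum, transpose_smul, Matrix.mul_smul, trace_sum, trace_smul, smul_eq_mul,
    Finset.mul_sum, Finset.sum_mul, ← Finset.sum_sub_distrib]
  exact Finset.sum_congr rfl fun i _ => by ring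

omit [DecidableEq A] [Fintype E] [DecidableEq E] in
theorem traceFst_posSemidef {X : Matrix (A × E) (A × E) ℂ} (hX : X.PosSemidef) :
    (traceFst X).PosSemidef := by
  have : traceFst X = ∑ a, X.submatrix (fun e => (a, e)) (fun e => (a, e)) := by
    ext e e'; simp [traceFst, Matrix.sum_apply]
  rw [this]
  exact posSemidef_sum _ fun a _ => hX.submatrix _

omit [DecidableEq A] [DecidableEq E] in
theorem trace_traceFst (X : Matrix (A × E) (A × E) ℂ) : (traceFst X).trace = X.trace := by
  simp [Matrix.trace, traceFst, Fintype.sum_prod_type_right]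

omit [DecidableEq A] in
theorem rotate_posSemidef (U : Matrix A A ℂ) {X : Matrix (A × E) (A × E) ℂ} (hX : X.PosSemidef) :
    (rotate U X).PosSemidef := hX.mul_mul_conjTranspose_same _

-- The contraction is a positive multiple of a compression of `X ⊗ Y`: the principal submatrix on
-- which the two `A`-indices coincide is conjugated by `G`, which sums over the common index.
omit [DecidableEq A] [DecidableEq E] [DecidableEq C] in
theorem contract_posSemidef {X : Matrix (A × E) (A × E) ℂ} {Y : Matrix (A × C) (A × C) ℂ}
    (hX : X.PosSemidef) (hY : Y.PosSemidef) : (contract X Y).PosSemidef := by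
  classical
  have hK := (hX.kronecker hY).submatrix (fun z : A × (C × E) => ((z.1, z.2.2), (z.1, z.2.1)))
  let G : Matrix (A × (C × E)) (C × E) ℂ := Matrix.of fun z q => if z.2 = q then 1 else 0
  have hG := hK.conjTranspose_mul_mul_same G
  have h2 := hG.smul (a := (Fintype.card A : ℝ)) (by positivity)
  refine (congrArg Matrix.PosSemidef ?_).mpr h2
  ext p q
  rw [contract_apply]
  simp only [Matrix.smul_apply, Matrix.mul_apply, conjTranspose_apply, G, Matrix.of_apply,
    submatrix_apply, kroneckerMap_apply, Fintype.sum_prod_type (α₁ := A)]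
  simp [apply_ite, ite_mul]
  left
  rw [Finset.sum_comm]

end Contraction
end QDec

namespace QDec
open Matrix MeasureTheory

/-! ### Haar averages of the deviation and of the trace. -/

section Moments
variable {A E C : Type*} [Fintype A] [DecidableEq A] [Fintype E] [DecidableEq E]
  [Fintype C] [DecidableEq C]

theorem frobSq_sub_trace_le [Nonempty A] (M : Matrix A A ℂ) :
    frobSq (M - (M.trace / Fintype.card A) • (1 : Matrix A A ℂ)) ≤ frobSq M := by
  set d : ℝ := ((Fintype.card A : ℕ) : ℝ) with hd
  have hd0 : 0 < d := by rw [hd]; exact_mod_cast Fintype.card_pos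
  set m : ℂ := M.trace / Fintype.card A with hm
  have hmd : M.trace = d * m := by
    have : (d : ℂ) ≠ 0 := by exact_mod_cast hd0.ne'
    rw [hm, hd]; push_cast
    rw [mul_div_cancel₀]
    simp
  have hent : ∀ i j, Complex.normSq ((M - m • (1 : Matrix A A ℂ)) i j) = Complex.normSq (M i j) +
      (if i = j then Complex.normSq m - 2 * (M i j * star m).re else 0) := by
    intro i j
    by_cases h : i = j
    · subst h
      simp [Complex.normSq_sub]
      ring
    · simp [h]
  simp only [frobSq, hent, Finset.sum_add_distrib, Finset.sum_ite_eq, Finset.mem_univ, if_true,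
    Finset.sum_sub_distrib, ← Finset.mul_sum]
  have h1 : ∑ i, (M i i * star m).re = d * Complex.normSq m := by
    rw [← Complex.re_sum, ← Finset.sum_mul]
    change (M.trace * (starRingEnd ℂ) m).re = _
    rw [hmd, mul_assoc, Complex.mul_conj, ← Complex.ofReal_mul, Complex.ofReal_re]
  rw [h1]
  simp only [Finset.sum_const, Finset.card_univ, nsmul_eq_mul, ← hd]
  have := mul_nonneg hd0.le (Complex.normSq_nonneg m)
  linarith

omit [Fintype C] [DecidableEq C] in
theorem continuous_deviation_apply (X : Matrix (A × E) (A × E) ℂ) (Y : Matrix (A × C) (A × C) ℂ)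
    (p q : C × E) : Continuous fun U : unitaryGroup A ℂ =>
      deviation (U : Matrix A A ℂ) X Y p q := by
  simp only [deviation_apply]
  exact (continuous_const.mul (continuous_trace_rotation _ _)).sub continuous_const

-- Since `U 1 Uᴴ = 1`, subtracting the mean amounts to replacing the block of `X` by its traceless
-- part, and the trace moment bound applies. The factor `|A|²` from the contraction cancels the `1 /
-- |A|²` of that bound.
omit [DecidableEq C] [Fintype C] in
theorem integral_normSq_deviation_apply_le [Nonempty A] (X : Matrix (A × E) (A × E) ℂ)
    (Y : Matrix (A × C) (A × C) ℂ) (p q : C × E) :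
    ∫ U, Complex.normSq (deviation (U : Matrix A A ℂ) X Y p q) ∂haarUnitary A
      ≤ 8 * frobSq (blk X p.2 q.2) * frobSq (blk Y p.1 q.1) := by
  set M := blk X p.2 q.2 with hM
  set N := (blk Y p.1 q.1)ᵀ with hN
  set d : ℝ := ((Fintype.card A : ℕ) : ℝ) with hd
  have hd0 : 0 < d := by rw [hd]; exact_mod_cast Fintype.card_pos
  have hdc : (Fintype.card A : ℂ) ≠ 0 := by exact_mod_cast Fintype.card_ne_zero
  set M' := M - (M.trace / Fintype.card A) • (1 : Matrix A A ℂ) with hM'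
  have h0 : M'.trace = 0 := by
    rw [hM', trace_sub, trace_smul, trace_one, smul_eq_mul, div_mul_cancel₀ _ hdc, sub_self]
  have hNt : frobSq (blk Y p.1 q.1) = frobSq N := by
    rw [frobSq, frobSq, Finset.sum_comm]; rfl
  have hpt : ∀ U : unitaryGroup A ℂ, Complex.normSq (deviation (U : Matrix A A ℂ) X Y p q)
      = d ^ 2 * Complex.normSq ((U : Matrix A A ℂ) * M' * (U : Matrix A A ℂ)ᴴ * N).trace := by
    intro U
    have hUU : (U : Matrix A A ℂ) * (U : Matrix A A ℂ)ᴴ = 1 := mem_unitaryGroup_iff.1 U.2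
    have : deviation (U : Matrix A A ℂ) X Y p q
        = (d : ℂ) * ((U : Matrix A A ℂ) * M' * (U : Matrix A A ℂ)ᴴ * N).trace := by
      rw [deviation_apply, ← hM, ← hN, hM', Matrix.mul_sub, Matrix.sub_mul, Matrix.sub_mul,
        trace_sub, Matrix.mul_smul, Matrix.mul_one, Matrix.smul_mul, hUU, Matrix.smul_mul,
        Matrix.one_mul, trace_smul, smul_eq_mul, mul_sub, hN, trace_transpose, hd]
      push_cast
      field_simp
    rw [this, Complex.normSq_mul, Complex.normSq_ofReal, pow_two]
  simp only [hpt]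
  rw [integral_const_mul, hNt]
  have := integral_normSq_trace_rotation_le N h0
  calc _ ≤ d ^ 2 * (8 / d ^ 2 * frobSq M' * frobSq N) := by gcongr
    _ = 8 * frobSq M' * frobSq N := by field_simp
    _ ≤ _ := by
      have := frobSq_sub_trace_le M
      have := frobSq_nonneg N
      gcongr

omit [DecidableEq A] [DecidableEq E] in
theorem sum_frobSq_blk (X : Matrix (A × E) (A × E) ℂ) :
    ∑ e, ∑ e', frobSq (blk X e e') = frobSq X := by
  simp only [frobSq, blk, Matrix.of_apply, Fintype.sum_prod_type]
  rw [Finset.sum_comm' (t' := Finset.univ) (s' := fun _ => Finset.univ) (by simp)]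
  calc ∑ e', ∑ e, ∑ i, ∑ j, Complex.normSq (X (i, e) (j, e'))
      = ∑ e', ∑ i, ∑ e, ∑ j, Complex.normSq (X (i, e) (j, e')) :=
        Finset.sum_congr rfl fun _ _ => Finset.sum_comm
    _ = ∑ i, ∑ e', ∑ e, ∑ j, Complex.normSq (X (i, e) (j, e')) := Finset.sum_comm
    _ = ∑ i, ∑ e, ∑ e', ∑ j, Complex.normSq (X (i, e) (j, e')) :=
        Finset.sum_congr rfl fun _ _ => Finset.sum_comm
    _ = _ := Finset.sum_congr rfl fun _ _ => Finset.sum_congr rfl fun _ _ => Finset.sum_comm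

omit [DecidableEq C] in
theorem continuous_frobSq_deviation (X : Matrix (A × E) (A × E) ℂ) (Y : Matrix (A × C) (A × C) ℂ) :
    Continuous fun U : unitaryGroup A ℂ => frobSq (deviation (U : Matrix A A ℂ) X Y) :=
  continuous_finsetSum _ fun p _ => continuous_finsetSum _ fun q _ =>
    Complex.continuous_normSq.comp (continuous_deviation_apply X Y p q)

omit [DecidableEq C] in
theorem integral_frobSq_deviation_le [Nonempty A] (X : Matrix (A × E) (A × E) ℂ)
    (Y : Matrix (A × C) (A × C) ℂ) :
    ∫ U, frobSq (deviation (U : Matrix A A ℂ) X Y) ∂haarUnitary A ≤ 8 * frobSq X * frobSq Y := by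
  have hc : ∀ p q, Continuous fun U : unitaryGroup A ℂ =>
      Complex.normSq (deviation (U : Matrix A A ℂ) X Y p q) := fun p q =>
    Complex.continuous_normSq.comp (continuous_deviation_apply X Y p q)
  simp only [frobSq.eq_1 (deviation _ X Y)]
  rw [integral_haarUnitary_sum (f := fun (p : C × E) (U : unitaryGroup A ℂ) =>
    ∑ q, Complex.normSq (deviation (U : Matrix A A ℂ) X Y p q))
    fun p => continuous_finsetSum _ fun q _ => hc p q]
  rw [Finset.sum_congr rfl fun p _ => integral_haarUnitary_sum (t := Finset.univ) fun q => hc p q]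
  refine (Finset.sum_le_sum fun p _ => Finset.sum_le_sum fun q _ =>
    integral_normSq_deviation_apply_le X Y p q).trans (le_of_eq ?_)
  rw [← sum_frobSq_blk X, ← sum_frobSq_blk Y]
  simp only [Fintype.sum_prod_type]
  simp only [Finset.mul_sum, Finset.sum_mul]
  refine Finset.sum_congr rfl fun c _ => ?_
  calc ∑ e, ∑ c', ∑ e', 8 * frobSq (blk X e e') * frobSq (blk Y c c')
      = ∑ c', ∑ e, ∑ e', 8 * frobSq (blk X e e') * frobSq (blk Y c c') := Finset.sum_comm
    _ = _ := rfl

omit [DecidableEq A] [DecidableEq C] in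
theorem trace_contract_rotate (U : Matrix A A ℂ) (X : Matrix (A × E) (A × E) ℂ)
    (Y : Matrix (A × C) (A × C) ℂ) : (contract (rotate U X) Y).trace
      = ∑ c, ∑ e, (Fintype.card A : ℂ) * (U * blk X e e * Uᴴ * (blk Y c c)ᵀ).trace := by
  simp only [Matrix.trace, Fintype.sum_prod_type, Matrix.diag_apply, contract, Matrix.of_apply,
    blk_rotate]

omit [DecidableEq C] in
theorem continuous_trace_contract (X : Matrix (A × E) (A × E) ℂ) (Y : Matrix (A × C) (A × C) ℂ) :
    Continuous fun U : unitaryGroup A ℂ => (contract (rotate (U : Matrix A A ℂ) X) Y).trace.re := by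
  simp only [trace_contract_rotate]
  exact Complex.continuous_re.comp (continuous_finsetSum _ fun c _ => continuous_finsetSum _
    fun e _ => continuous_const.mul (continuous_trace_rotation _ _))

omit [Fintype A] [DecidableEq A] [Fintype E] [DecidableEq E] in
theorem blk_self_isHermitian {X : Matrix (A × E) (A × E) ℂ} (hX : X.IsHermitian) (e : E) :
    (blk X e e).IsHermitian := hX.submatrix fun a => (a, e)

omit [DecidableEq C] in
theorem integral_trace_contract [Nonempty A] {X : Matrix (A × E) (A × E) ℂ}
    {Y : Matrix (A × C) (A × C) ℂ} (hX : X.IsHermitian) (hY : Y.IsHermitian) :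
    ∫ U, (contract (rotate (U : Matrix A A ℂ) X) Y).trace.re ∂haarUnitary A
      = X.trace.re * Y.trace.re := by
  have hd0 : (Fintype.card A : ℝ) ≠ 0 := by exact_mod_cast Fintype.card_ne_zero
  have hre : ∀ U : unitaryGroup A ℂ, (contract (rotate (U : Matrix A A ℂ) X) Y).trace.re
      = ∑ c, ∑ e, (Fintype.card A : ℝ) *
        ((U : Matrix A A ℂ) * blk X e e * (U : Matrix A A ℂ)ᴴ * (blk Y c c)ᵀ).trace.re := by
    intro U
    rw [trace_contract_rotate]
    simp only [Complex.re_sum]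
    refine Finset.sum_congr rfl fun c _ => Finset.sum_congr rfl fun e _ => ?_
    rw [← Complex.ofReal_natCast, Complex.re_ofReal_mul]
  have hc : ∀ c e, Continuous fun U : unitaryGroup A ℂ => (Fintype.card A : ℝ) *
      ((U : Matrix A A ℂ) * blk X e e * (U : Matrix A A ℂ)ᴴ * (blk Y c c)ᵀ).trace.re := fun c e =>
    continuous_const.mul (Complex.continuous_re.comp (continuous_trace_rotation _ _))
  simp only [hre]
  rw [integral_haarUnitary_sum (f := fun (c : C) (U : unitaryGroup A ℂ) =>
    ∑ e, (Fintype.card A : ℝ) *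
      ((U : Matrix A A ℂ) * blk X e e * (U : Matrix A A ℂ)ᴴ * (blk Y c c)ᵀ).trace.re)
    fun c => continuous_finsetSum _ fun e _ => hc c e]
  rw [Finset.sum_congr rfl fun c _ => integral_haarUnitary_sum (t := Finset.univ) fun e => hc c e]
  have hint : ∀ c e, ∫ U, (Fintype.card A : ℝ) *
      ((U : Matrix A A ℂ) * blk X e e * (U : Matrix A A ℂ)ᴴ * (blk Y c c)ᵀ).trace.re ∂haarUnitary A
      = (blk Y c c).trace.re * (blk X e e).trace.re := by
    intro c e
    rw [integral_const_mul, integral_trace_rotation_re (blk_self_isHermitian hX e)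
      (blk_self_isHermitian hY c).transpose, trace_transpose]
    field_simp
  simp only [hint]
  rw [← trace_traceFst X, ← trace_traceFst Y]
  simp only [← Finset.mul_sum, ← Finset.sum_mul, Matrix.trace, Complex.re_sum, Matrix.diag_apply,
    traceFst_apply]
  rw [mul_comm]

end Moments
end QDec

namespace QDec
open Matrix MeasureTheory

/-! ### Endpoint bounds for power traces, and spectral projections. -/

section SchattenBounds
variable {ι : Type*} [Fintype ι] [DecidableEq ι]

theorem absPow_smul {Z : Matrix ι ι ℂ} (hZ : Z.IsHermitian) {c : ℝ} (hc : 0 ≤ c) (p : ℝ) :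
    absPow p ((c : ℂ) • Z) = c ^ p * absPow p Z := by
  obtain ⟨V, hV, d, rfl⟩ := exists_conjDiag hZ
  rw [← conjDiag_smul, absPow_conjDiag hV, absPow_conjDiag hV, Finset.mul_sum]
  refine Finset.sum_congr rfl fun i _ => ?_
  rw [abs_mul, abs_of_nonneg hc, Real.mul_rpow hc (abs_nonneg _)]

/-- In an eigenbasis of `P - R`, each eigenvalue is a difference of two nonnegative diagonal
entries, so its modulus is at most their sum. -/
theorem absPow_one_sub_le {P R : Matrix ι ι ℂ} (hP : P.PosSemidef) (hR : R.PosSemidef) :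
    absPow 1 (P - R) ≤ P.trace.re + R.trace.re := by
  obtain ⟨V, hV, d, hd⟩ := exists_conjDiag (hP.1.sub hR.1)
  have htr : ∀ Z : Matrix ι ι ℂ, ∑ k, ((Vᴴ * Z * V) k k).re = Z.trace.re := by
    intro Z
    rw [← Complex.re_sum]
    change (Vᴴ * Z * V).trace.re = _
    rw [Matrix.trace_mul_comm, ← Matrix.mul_assoc,
      show V * Vᴴ = 1 from mem_unitaryGroup_iff.1 hV, Matrix.one_mul]
  have hnn : ∀ {Z : Matrix ι ι ℂ}, Z.PosSemidef → ∀ k, 0 ≤ ((Vᴴ * Z * V) k k).re := fun hZ k =>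
    (Complex.le_def.1 ((hZ.conjTranspose_mul_mul_same V).diag_nonneg (i := k))).1
  have hdk : ∀ k, d k = ((Vᴴ * P * V) k k).re - ((Vᴴ * R * V) k k).re := by
    intro k
    have h1 : (Vᴴ * (P - R) * V) k k = (d k : ℂ) := by
      rw [hd, conj_conjDiag_self hV]; simp
    rw [Matrix.mul_sub, Matrix.sub_mul, Matrix.sub_apply] at h1
    rw [← Complex.sub_re, h1, Complex.ofReal_re]
  rw [hd, absPow_conjDiag hV, ← htr P, ← htr R, ← Finset.sum_add_distrib]
  refine Finset.sum_le_sum fun k _ => ?_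
  rw [Real.rpow_one, hdk]
  have h1 := hnn hP k
  have h2 := hnn hR k
  rw [abs_le]
  constructor <;> linarith

/-- Eigenvalue by eigenvalue, `u^p ≤ u + u²` for `u ≥ 0`. This plays the role of interpolation
between the trace norm and the Hilbert–Schmidt norm. It loses only a constant when both terms are of
the same size, as happens for projections. -/
theorem absPow_le_add_frobSq {Z : Matrix ι ι ℂ} (hZ : Z.IsHermitian) {p : ℝ} (hp1 : 1 ≤ p)
    (hp2 : p ≤ 2) : absPow p Z ≤ absPow 1 Z + frobSq Z := by
  obtain ⟨V, hV, d, rfl⟩ := exists_conjDiag hZ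
  rw [absPow_conjDiag hV, absPow_conjDiag hV, frobSq_conjDiag hV, ← Finset.sum_add_distrib]
  refine Finset.sum_le_sum fun i _ => ?_
  rw [Real.rpow_one, ← sq_abs (d i)]
  have h0 := abs_nonneg (d i)
  rcases le_total |d i| 1 with h | h
  · have := Real.rpow_le_rpow_of_exponent_ge' h0 h zero_le_one hp1
    rw [Real.rpow_one] at this
    nlinarith [sq_nonneg |d i|]
  · have := Real.rpow_le_rpow_of_exponent_le h hp2
    rw [Real.rpow_two] at this
    linarith

/-- The spectral projection of `conjDiag V x` for the eigenvalue `l`. -/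
noncomputable def specProj (V : Matrix ι ι ℂ) (x : ι → ℝ) (l : ℝ) : Matrix ι ι ℂ :=
  conjDiag V fun i => if x i = l then 1 else 0

theorem specProj_posSemidef (V : Matrix ι ι ℂ) (x : ι → ℝ) (l : ℝ) :
    (specProj V x l).PosSemidef :=
  conjDiag_posSemidef V fun i => by split_ifs <;> norm_num

/-- The multiplicity of the value `l` of `x`. -/
noncomputable def multiplicityAt (x : ι → ℝ) (l : ℝ) : ℝ := ∑ i, if x i = l then 1 else 0

theorem trace_specProj {V : Matrix ι ι ℂ} (hV : V ∈ unitaryGroup ι ℂ) (x : ι → ℝ) (l : ℝ) :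
    (specProj V x l).trace.re = multiplicityAt x l := by
  rw [specProj, trace_conjDiag hV, Complex.ofReal_re, multiplicityAt]

theorem frobSq_specProj {V : Matrix ι ι ℂ} (hV : V ∈ unitaryGroup ι ℂ) (x : ι → ℝ) (l : ℝ) :
    frobSq (specProj V x l) = multiplicityAt x l := by
  rw [specProj, frobSq_conjDiag hV, multiplicityAt]
  exact Finset.sum_congr rfl fun i _ => by split_ifs <;> norm_num

omit [DecidableEq ι] in
theorem sum_image_mul_multiplicityAt (x : ι → ℝ) (f : ℝ → ℝ) :
    ∑ l ∈ Finset.univ.image x, f l * multiplicityAt x l = ∑ i, f (x i) := by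
  simp only [multiplicityAt, Finset.mul_sum, mul_ite, mul_one, mul_zero]
  rw [Finset.sum_comm]
  refine Finset.sum_congr rfl fun i _ => ?_
  rw [Finset.sum_ite_eq, if_pos (Finset.mem_image_of_mem x (Finset.mem_univ i))]

theorem conjDiag_eq_sum_specProj (V : Matrix ι ι ℂ) (x : ι → ℝ) :
    conjDiag V x = ∑ l ∈ Finset.univ.image x, (l : ℂ) • specProj V x l := by
  ext i j
  simp only [Matrix.sum_apply, Matrix.smul_apply, specProj, conjDiag_apply, smul_eq_mul,
    Finset.mul_sum]
  rw [Finset.sum_comm]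
  refine Finset.sum_congr rfl fun k _ => ?_
  have : ∀ l : ℝ, (l : ℂ) * (((if x k = l then (1 : ℝ) else 0 : ℝ) : ℂ) * (V i k * star (V j k)))
      = if x k = l then (l : ℂ) * (V i k * star (V j k)) else 0 := by
    intro l; split_ifs <;> simp
  simp only [this]
  rw [Finset.sum_ite_eq, if_pos (Finset.mem_image_of_mem x (Finset.mem_univ k))]

end SchattenBounds

/-! ### Average deviation for operators with few distinct eigenvalues. -/

section OneShot
variable {A E C : Type*} [Fintype A] [DecidableEq A] [Fintype E] [DecidableEq E]
  [Fintype C] [DecidableEq C]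

omit [DecidableEq A] [DecidableEq C] in
theorem deviation_isHermitian (U : Matrix A A ℂ) {X : Matrix (A × E) (A × E) ℂ}
    {Y : Matrix (A × C) (A × C) ℂ} (hX : X.PosSemidef) (hY : Y.PosSemidef) :
    (deviation U X Y).IsHermitian :=
  (contract_posSemidef (rotate_posSemidef U hX) hY).1.sub
    ((traceFst_posSemidef hY).kronecker (traceFst_posSemidef hX)).1

omit [DecidableEq A] [DecidableEq E] [DecidableEq C] in
theorem trace_traceFst_kronecker {X : Matrix (A × E) (A × E) ℂ} (hX : X.PosSemidef)
    (Y : Matrix (A × C) (A × C) ℂ) :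
    (traceFst Y ⊗ₖ traceFst X).trace.re = X.trace.re * Y.trace.re := by
  have him : X.trace.im = 0 := (Complex.le_def.1 hX.trace_nonneg).2.symm
  rw [trace_kronecker, trace_traceFst, trace_traceFst, Complex.mul_re, him]
  ring

omit [DecidableEq A] in
theorem absPow_deviation_le (U : Matrix A A ℂ) {X : Matrix (A × E) (A × E) ℂ}
    {Y : Matrix (A × C) (A × C) ℂ} (hX : X.PosSemidef) (hY : Y.PosSemidef) {p : ℝ} (hp1 : 1 ≤ p)
    (hp2 : p ≤ 2) : absPow p (deviation U X Y) ≤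
      (contract (rotate U X) Y).trace.re + X.trace.re * Y.trace.re + frobSq (deviation U X Y) := by
  refine (absPow_le_add_frobSq (deviation_isHermitian U hX hY) hp1 hp2).trans ?_
  gcongr
  rw [← trace_traceFst_kronecker hX Y]
  exact absPow_one_sub_le (contract_posSemidef (rotate_posSemidef U hX) hY)
    ((traceFst_posSemidef hY).kronecker (traceFst_posSemidef hX))

/-- The average `p`-th power of the Schatten `p`-norm of the deviation. -/
theorem lintegral_absPow_deviation_le [Nonempty A] {V : Matrix (A × E) (A × E) ℂ}
    (hV : V ∈ unitaryGroup (A × E) ℂ) {W : Matrix (A × C) (A × C) ℂ}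
    (hW : W ∈ unitaryGroup (A × C) ℂ) {x : A × E → ℝ} {y : A × C → ℝ} (hx : ∀ i, 0 ≤ x i)
    (hy : ∀ i, 0 ≤ y i) {p : ℝ} (hp1 : 1 ≤ p) (hp2 : p ≤ 2) :
    ∫⁻ U, ENNReal.ofReal (absPow p (deviation (U : Matrix A A ℂ) (conjDiag V x) (conjDiag W y)))
        ∂haarUnitary A
      ≤ ENNReal.ofReal (10 * (((Finset.univ.image x).card * (Finset.univ.image y).card : ℕ) : ℝ)
          ^ (p - 1) * ((∑ i, x i ^ p) * ∑ i, y i ^ p)) := by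
  set I := Finset.univ.image x with hI
  set J := Finset.univ.image y with hJ
  have hI0 : ∀ l ∈ I, 0 ≤ l := by
    intro l hl
    obtain ⟨i, -, rfl⟩ := Finset.mem_image.1 hl
    exact hx i
  have hJ0 : ∀ l ∈ J, 0 ≤ l := by
    intro l hl
    obtain ⟨i, -, rfl⟩ := Finset.mem_image.1 hl
    exact hy i
  set N : ℝ := ((I.card * J.card : ℕ) : ℝ) with hN
  set P := specProj V x with hP
  set Q := specProj W y with hQ
  have hPp := specProj_posSemidef V x
  have hQp := specProj_posSemidef W y
  set h : ℝ × ℝ → unitaryGroup A ℂ → ℝ := fun z U =>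
    (contract (rotate (U : Matrix A A ℂ) (P z.1)) (Q z.2)).trace.re
      + (P z.1).trace.re * (Q z.2).trace.re + frobSq (deviation (U : Matrix A A ℂ) (P z.1) (Q z.2))
    with hh
  have hhc : ∀ z, Continuous (h z) := fun z =>
    ((continuous_trace_contract _ _).add continuous_const).add (continuous_frobSq_deviation _ _)
  -- The constant is `1 + 1 + 8`: the mean trace of the contraction, the trace of its mean, and the
  -- Hilbert–Schmidt bound. For a projection the trace and the squared Hilbert–Schmidt norm are both
  -- the rank.
  have hint : ∀ z, ∫ U, h z U ∂haarUnitary A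
      ≤ 10 * (multiplicityAt x z.1 * multiplicityAt y z.2) := by
    intro z
    have e1 := integral_trace_contract (hPp z.1).1 (hQp z.2).1
    have e2 := integral_frobSq_deviation_le (P z.1) (Q z.2)
    have e3 : ∫ U, h z U ∂haarUnitary A =
        (∫ U, (contract (rotate (U : Matrix A A ℂ) (P z.1)) (Q z.2)).trace.re ∂haarUnitary A
          + ∫ _U, (P z.1).trace.re * (Q z.2).trace.re ∂haarUnitary A)
        + ∫ U, frobSq (deviation (U : Matrix A A ℂ) (P z.1) (Q z.2)) ∂haarUnitary A := by
      rw [← integral_add (integrable_haarUnitary (continuous_trace_contract _ _))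
        (integrable_const _)]
      exact integral_add (integrable_haarUnitary ((continuous_trace_contract _ _).add
        continuous_const)) (integrable_haarUnitary (continuous_frobSq_deviation _ _))
    rw [e3, e1, integral_const, probReal_univ, one_smul]
    rw [hP, hQ, frobSq_specProj hV, frobSq_specProj hW] at e2
    rw [hP, hQ, trace_specProj hV, trace_specProj hW]
    linarith
  have hdec : ∀ U : Matrix A A ℂ, deviation U (conjDiag V x) (conjDiag W y)
      = ∑ z ∈ I ×ˢ J, ((z.1 * z.2 : ℝ) : ℂ) • deviation U (P z.1) (Q z.2) := by
    intro U
    rw [conjDiag_eq_sum_specProj V x, conjDiag_eq_sum_specProj W y, deviation_sum_left,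
      Finset.sum_product]
    refine Finset.sum_congr rfl fun l _ => ?_
    rw [deviation_sum_right, Finset.smul_sum]
    refine Finset.sum_congr rfl fun m _ => ?_
    rw [smul_smul]; push_cast; rfl
  have hdevH : ∀ (U : Matrix A A ℂ) (z : ℝ × ℝ), (deviation U (P z.1) (Q z.2)).IsHermitian :=
    fun U z => deviation_isHermitian U (hPp z.1) (hQp z.2)
  have hpt : ∀ U : unitaryGroup A ℂ,
      absPow p (deviation (U : Matrix A A ℂ) (conjDiag V x) (conjDiag W y))
        ≤ N ^ (p - 1) * ∑ z ∈ I ×ˢ J, (z.1 * z.2) ^ p * h z U := by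
    intro U
    rw [hdec]
    have hz : ∀ z ∈ I ×ˢ J, 0 ≤ z.1 * z.2 := fun z hz =>
      mul_nonneg (hI0 _ (Finset.mem_product.1 hz).1) (hJ0 _ (Finset.mem_product.1 hz).2)
    refine (absPow_sum_le _ _ (fun z _ => ?_) hp1).trans ?_
    · exact (hdevH U z).smul (by simp [IsSelfAdjoint])
    · rw [Finset.card_product]
      refine mul_le_mul_of_nonneg_left (Finset.sum_le_sum fun z hzm => ?_)
        (Real.rpow_nonneg (Nat.cast_nonneg _) _)
      rw [absPow_smul (hdevH U z) (hz z hzm)]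
      exact mul_le_mul_of_nonneg_left (absPow_deviation_le _ (hPp z.1) (hQp z.2) hp1 hp2)
        (Real.rpow_nonneg (hz z hzm) _)
  have hFc : Continuous fun U => N ^ (p - 1) * ∑ z ∈ I ×ˢ J, (z.1 * z.2) ^ p * h z U :=
    continuous_const.mul (continuous_finsetSum _ fun z _ => continuous_const.mul (hhc z))
  -- The left integrand needs no measurability here: `∫⁻` is monotone, and the majorant is
  -- continuous.
  refine (lintegral_mono fun U => ENNReal.ofReal_le_ofReal (hpt U)).trans ?_
  rw [← ofReal_integral_eq_lintegral_ofReal (integrable_haarUnitary hFc)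
    (Filter.Eventually.of_forall fun U => (absPow_nonneg (deviation_isHermitian _
      (conjDiag_posSemidef V hx) (conjDiag_posSemidef W hy)) p).trans (hpt U))]
  refine ENNReal.ofReal_le_ofReal ?_
  rw [integral_const_mul, integral_haarUnitary_sum (f := fun (z : ℝ × ℝ) (U : unitaryGroup A ℂ) =>
    (z.1 * z.2) ^ p * h z U) fun z => continuous_const.mul (hhc z)]
  simp only [integral_const_mul]
  have hNn : 0 ≤ N ^ (p - 1) := Real.rpow_nonneg (Nat.cast_nonneg _) _
  rw [mul_comm (10 : ℝ), mul_assoc]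
  refine mul_le_mul_of_nonneg_left ?_ hNn
  -- Grouping by distinct eigenvalues, `l^p` times the multiplicity adds up to the full power sum,
  -- so the splitting loses nothing beyond `N ^ (p - 1)` and the constant.
  rw [← sum_image_mul_multiplicityAt x fun l => l ^ p, ← sum_image_mul_multiplicityAt y fun l => l ^ p,
    Finset.sum_mul_sum, ← Finset.sum_product', Finset.mul_sum]
  refine Finset.sum_le_sum fun z hz => ?_
  have h1 := hI0 _ (Finset.mem_product.1 hz).1
  have h2 := hJ0 _ (Finset.mem_product.1 hz).2
  rw [Real.mul_rpow h1 h2]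
  calc z.1 ^ p * z.2 ^ p * ∫ U, h z U ∂haarUnitary A
      ≤ z.1 ^ p * z.2 ^ p * (10 * (multiplicityAt x z.1 * multiplicityAt y z.2)) := by
        gcongr
        exact hint z
    _ = _ := by ring

end OneShot
end QDec

namespace QDec
open Matrix MeasureTheory

/-! ### Powers of Kronecker products and support projections. -/

section Kronecker
variable {ι κ : Type*} [Fintype ι] [DecidableEq ι] [Fintype κ] [DecidableEq κ]

theorem conjDiag_kronecker (V : Matrix ι ι ℂ) (W : Matrix κ κ ℂ) (d : ι → ℝ) (e : κ → ℝ) :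
    conjDiag V d ⊗ₖ conjDiag W e = conjDiag (V ⊗ₖ W) fun i => d i.1 * e i.2 := by
  rw [conjDiag, conjDiag, conjDiag, conjTranspose_kronecker, mul_kronecker_mul, mul_kronecker_mul,
    diagonal_kronecker_diagonal]
  push_cast; rfl

theorem mpow_kronecker {M : Matrix ι ι ℂ} {N : Matrix κ κ ℂ} (hM : M.PosSemidef)
    (hN : N.PosSemidef) (r : ℝ) : mpow (M ⊗ₖ N) r = mpow M r ⊗ₖ mpow N r := by
  obtain ⟨V, hV, d, hd, rfl⟩ := exists_conjDiag_nonneg hM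
  obtain ⟨W, hW, e, he, rfl⟩ := exists_conjDiag_nonneg hN
  rw [conjDiag_kronecker, mpow_conjDiag hV, mpow_conjDiag hW, conjDiag_kronecker,
    mpow_conjDiag (kronecker_mem_unitary hV hW)]
  congr 1; ext i
  exact Real.mul_rpow (hd _) (he _)

theorem mpow_one (r : ℝ) : mpow (1 : Matrix ι ι ℂ) r = 1 := by
  have h1 : (1 : Matrix ι ι ℂ) ∈ unitaryGroup ι ℂ := one_mem _
  rw [← conjDiag_one h1, mpow_conjDiag h1]
  simp

/-- Twice the weight exponent plus one is `1 / p`. Applied to a marginal, this shows that the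
marginal of a weighted operator is the `1/p`-th power of the original marginal. -/
theorem mpow_mul_mul_mpow_self {M : Matrix ι ι ℂ} (hM : M.PosSemidef) {p : ℝ} (hp : 0 < p) :
    mpow M ((1 - p) / (2 * p)) * M * mpow M ((1 - p) / (2 * p)) = mpow M (1 / p) := by
  obtain ⟨V, hV, d, hd, rfl⟩ := exists_conjDiag_nonneg hM
  rw [mpow_conjDiag hV, mpow_conjDiag hV, conjDiag_mul hV, conjDiag_mul hV]
  congr 1; ext i
  rcases (hd i).eq_or_lt with h | h
  · rw [← h, mul_zero, zero_mul, Real.zero_rpow (by positivity)]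
  · rw [mul_right_comm, ← Real.rpow_add h, ← Real.rpow_add_one h.ne']
    congr 1; field_simp; ring

/-- The support projection of a positive semidefinite operator, as the product with the
pseudo-inverse. -/
noncomputable def suppProj (M : Matrix ι ι ℂ) : Matrix ι ι ℂ := M * mpow M (-1)

theorem suppProj_spec {M : Matrix ι ι ℂ} (hM : M.PosSemidef) :
    (suppProj M).IsHermitian ∧ (1 - suppProj M) * M = 0 := by
  obtain ⟨V, hV, d, hd, rfl⟩ := exists_conjDiag_nonneg hM
  have h : suppProj (conjDiag V d) = conjDiag V fun i => d i * d i ^ (-1 : ℝ) := by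
    rw [suppProj, mpow_conjDiag hV, conjDiag_mul hV]
  refine ⟨h ▸ conjDiag_isHermitian _ _, ?_⟩
  rw [Matrix.sub_mul, Matrix.one_mul, h, conjDiag_mul hV, sub_eq_zero]
  congr 1; ext i
  rcases (hd i).eq_or_lt with h | h
  · simp [← h]
  · rw [Real.rpow_neg_one, mul_inv_cancel₀ h.ne', one_mul]

end Kronecker

/-! ### Moving local factors through partial trace, rotation and contraction. -/

section Blocks
variable {A E C : Type*} [Fintype A] [DecidableEq A] [Fintype E] [DecidableEq E]
  [Fintype C] [DecidableEq C]

omit [DecidableEq E] in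
theorem blk_one_kronecker_mul (R R' : Matrix E E ℂ) (X : Matrix (A × E) (A × E) ℂ) (e e' : E) :
    blk (((1 : Matrix A A ℂ) ⊗ₖ R) * X * ((1 : Matrix A A ℂ) ⊗ₖ R')) e e'
      = ∑ f, ∑ f', (R e f * R' f' e') • blk X f f' := by
  ext a a'
  simp only [blk, Matrix.of_apply, Matrix.mul_apply, Fintype.sum_prod_type, kroneckerMap_apply,
    Matrix.one_apply, Matrix.sum_apply, Matrix.smul_apply, smul_eq_mul]
  simp [Finset.sum_mul]
  rw [Finset.sum_comm]
  exact Finset.sum_congr rfl fun f _ => Finset.sum_congr rfl fun f' _ => by ring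

omit [DecidableEq E] in
theorem traceFst_one_kronecker_mul (R R' : Matrix E E ℂ) (X : Matrix (A × E) (A × E) ℂ) :
    traceFst (((1 : Matrix A A ℂ) ⊗ₖ R) * X * ((1 : Matrix A A ℂ) ⊗ₖ R'))
      = R * traceFst X * R' := by
  ext e e'
  rw [traceFst_apply, blk_one_kronecker_mul]
  simp only [trace_sum, trace_smul, smul_eq_mul, Matrix.mul_apply, traceFst_apply, Finset.sum_mul]
  rw [Finset.sum_comm]
  exact Finset.sum_congr rfl fun f _ => Finset.sum_congr rfl fun f' _ => by ring

omit [DecidableEq E] [DecidableEq C] in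
theorem contract_one_kronecker_mul (R R' : Matrix E E ℂ) (S S' : Matrix C C ℂ)
    (X : Matrix (A × E) (A × E) ℂ) (Y : Matrix (A × C) (A × C) ℂ) :
    contract (((1 : Matrix A A ℂ) ⊗ₖ R) * X * ((1 : Matrix A A ℂ) ⊗ₖ R'))
      (((1 : Matrix A A ℂ) ⊗ₖ S) * Y * ((1 : Matrix A A ℂ) ⊗ₖ S'))
      = (S ⊗ₖ R) * contract X Y * (S' ⊗ₖ R') := by
  ext p q
  rw [contract, Matrix.of_apply, blk_one_kronecker_mul, blk_one_kronecker_mul]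
  have hL : ((∑ f, ∑ f', (R p.2 f * R' f' q.2) • blk X f f') *
      (∑ g, ∑ g', (S p.1 g * S' g' q.1) • blk Y g g')ᵀ).trace
      = ∑ g', ∑ f', ∑ g, ∑ f, (S p.1 g * R p.2 f) * (blk X f f' * (blk Y g g')ᵀ).trace *
        (S' g' q.1 * R' f' q.2) := by
    simp only [transpose_sum, transpose_smul, Finset.sum_mul_sum,
      trace_sum, Matrix.smul_mul, Matrix.mul_smul, trace_smul, smul_eq_mul]
    rw [Finset.sum_comm]
    simp_rw [Finset.sum_comm (s := (Finset.univ : Finset E)) (t := (Finset.univ : Finset C))]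
    rw [Finset.sum_comm]
    refine Finset.sum_congr rfl fun g' _ => Finset.sum_congr rfl fun g _ => ?_
    rw [Finset.sum_comm]
    exact Finset.sum_congr rfl fun f' _ => Finset.sum_congr rfl fun f _ => by ring
  have hR : ((S ⊗ₖ R) * contract X Y * (S' ⊗ₖ R')) p q = ∑ g', ∑ f', ∑ g, ∑ f,
      (Fintype.card A : ℂ) * ((S p.1 g * R p.2 f) * (blk X f f' * (blk Y g g')ᵀ).trace *
        (S' g' q.1 * R' f' q.2)) := by
    rw [Matrix.mul_apply, Fintype.sum_prod_type]
    refine Finset.sum_congr rfl fun g' _ => Finset.sum_congr rfl fun f' _ => ?_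
    rw [Matrix.mul_apply, Fintype.sum_prod_type, Finset.sum_mul]
    refine Finset.sum_congr rfl fun g _ => ?_
    rw [Finset.sum_mul]
    refine Finset.sum_congr rfl fun f _ => ?_
    simp only [kroneckerMap_apply, contract, Matrix.of_apply]
    ring
  rw [hL, hR]
  simp only [Finset.mul_sum]

theorem rotate_one_kronecker_mul (U : Matrix A A ℂ) (R R' : Matrix E E ℂ)
    (X : Matrix (A × E) (A × E) ℂ) :
    rotate U (((1 : Matrix A A ℂ) ⊗ₖ R) * X * ((1 : Matrix A A ℂ) ⊗ₖ R'))
      = ((1 : Matrix A A ℂ) ⊗ₖ R) * rotate U X * ((1 : Matrix A A ℂ) ⊗ₖ R') := by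
  have h1 : (U ⊗ₖ (1 : Matrix E E ℂ)) * ((1 : Matrix A A ℂ) ⊗ₖ R)
      = ((1 : Matrix A A ℂ) ⊗ₖ R) * (U ⊗ₖ (1 : Matrix E E ℂ)) := by
    rw [← mul_kronecker_mul, ← mul_kronecker_mul]; simp
  have h2 : ((1 : Matrix A A ℂ) ⊗ₖ R') * (U ⊗ₖ (1 : Matrix E E ℂ))ᴴ
      = (U ⊗ₖ (1 : Matrix E E ℂ))ᴴ * ((1 : Matrix A A ℂ) ⊗ₖ R') := by
    rw [conjTranspose_kronecker, ← mul_kronecker_mul, ← mul_kronecker_mul]; simp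
  calc _ = ((U ⊗ₖ (1 : Matrix E E ℂ)) * ((1 : Matrix A A ℂ) ⊗ₖ R)) * X *
        (((1 : Matrix A A ℂ) ⊗ₖ R') * (U ⊗ₖ (1 : Matrix E E ℂ))ᴴ) := by
        simp only [rotate, Matrix.mul_assoc]
    _ = _ := by rw [h1, h2]; simp only [rotate, Matrix.mul_assoc]

/-- With `L = 1 ⊗ (1 - R)`, the marginal of `L X L` vanishes, hence so does its trace. Writing `X =
K Kᴴ`, this says `L K = 0`, so `L X = 0` and by adjunction `X L = 0`. -/
theorem one_kronecker_suppProj_mul {X : Matrix (A × E) (A × E) ℂ} (hX : X.PosSemidef) :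
    ((1 : Matrix A A ℂ) ⊗ₖ suppProj (traceFst X)) * X *
      ((1 : Matrix A A ℂ) ⊗ₖ suppProj (traceFst X)) = X := by
  obtain ⟨hH, h0⟩ := suppProj_spec (traceFst_posSemidef hX)
  set R := suppProj (traceFst X) with hR
  set L : Matrix (A × E) (A × E) ℂ := (1 : Matrix A A ℂ) ⊗ₖ (1 - R) with hL
  have hLH : Lᴴ = L := by
    rw [hL, conjTranspose_kronecker, conjTranspose_one, conjTranspose_sub, conjTranspose_one, hH.eq]
  have hLX : L * X = 0 := by
    obtain ⟨V, hV, d, hd, hXV⟩ := exists_conjDiag_nonneg hX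
    set K := conjDiag V fun i => √(d i) with hK
    have hKH : Kᴴ = K := conjDiag_isHermitian _ _
    have hKK : X = K * Kᴴ := by
      rw [hKH, hK, conjDiag_mul hV, hXV]
      congr 1; ext i
      rw [Real.mul_self_sqrt (hd i)]
    have htr : (L * X * L).trace = 0 := by
      rw [← trace_traceFst, hL, traceFst_one_kronecker_mul, h0, Matrix.zero_mul, trace_zero]
    have h1 : (L * K) * (L * K)ᴴ = L * X * L := by
      rw [conjTranspose_mul, hLH, hKK]
      simp only [Matrix.mul_assoc]
    rw [← h1, trace_mul_conjTranspose_self_eq_zero_iff] at htr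
    rw [hKK, ← Matrix.mul_assoc, htr, Matrix.zero_mul]
  have hXL : X * L = 0 := by
    have := congrArg conjTranspose hLX
    rwa [conjTranspose_mul, hLH, hX.1.eq, conjTranspose_zero] at this
  have hR1 : (1 : Matrix A A ℂ) ⊗ₖ R = 1 - L := by
    rw [hL, ← one_kronecker_one]
    ext i j
    simp only [kroneckerMap_apply, Matrix.sub_apply]
    ring
  rw [hR1, Matrix.sub_mul, hLX, sub_zero, Matrix.one_mul, Matrix.mul_sub, hXL, sub_zero,
    Matrix.mul_one]

/-- Support projections of the marginals can be inserted around `X` and `Y` and moved out of the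
contraction. Each one has the marginal itself as its left factor, which exhibits the range
inclusion. -/
theorem supp_contract_le {X : Matrix (A × E) (A × E) ℂ} {Y : Matrix (A × C) (A × C) ℂ}
    (hX : X.PosSemidef) (hY : Y.PosSemidef) (U : Matrix A A ℂ) :
    supp (contract (rotate U X) Y) ≤ supp (traceFst Y ⊗ₖ traceFst X) := by
  have h : contract (rotate U X) Y = (traceFst Y ⊗ₖ traceFst X) *
      ((mpow (traceFst Y) (-1) ⊗ₖ mpow (traceFst X) (-1)) * contract (rotate U X) Y *
        (suppProj (traceFst Y) ⊗ₖ suppProj (traceFst X))) := by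
    conv_lhs => rw [← one_kronecker_suppProj_mul hX, ← one_kronecker_suppProj_mul hY,
      rotate_one_kronecker_mul, contract_one_kronecker_mul]
    rw [suppProj.eq_1 (traceFst Y), suppProj.eq_1 (traceFst X), mul_kronecker_mul]
    simp only [Matrix.mul_assoc]
  rw [h]
  rintro _ ⟨v, rfl⟩
  refine ⟨((mpow (traceFst Y) (-1) ⊗ₖ mpow (traceFst X) (-1)) * contract (rotate U X) Y *
        (suppProj (traceFst Y) ⊗ₖ suppProj (traceFst X))) *ᵥ v, ?_⟩
  simp only [mulVecLin_apply, mulVec_mulVec]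

end Blocks
end QDec

namespace QDec
open Matrix MeasureTheory

/-! ### The one-shot decoupling bound. -/

section OneShotError
variable {A E C : Type*} [Fintype A] [DecidableEq A] [Fintype E] [DecidableEq E]
  [Fintype C] [DecidableEq C]

theorem maxEntangled_apply (b a b' a' : A) : maxEntangled A (b, a) (b', a')
    = (Fintype.card A : ℂ)⁻¹ * ((if b = a then 1 else 0) * if b' = a' then 1 else 0) := by
  simp only [maxEntangled, Matrix.smul_apply, Matrix.sum_apply, kroneckerMap_apply, smul_eq_mul,
    Matrix.single_apply]
  congr 1
  by_cases h1 : b = a <;> by_cases h2 : b' = a' <;>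
    simp [h1, h2, ite_and, eq_comm]

omit [Fintype C] [DecidableEq C] in
theorem choi_apply (T : Matrix A A ℂ →ₗ[ℂ] Matrix C C ℂ) (a a' : A) (c c' : C) :
    choi T (a, c) (a', c') = (Fintype.card A : ℂ)⁻¹ * T (single a a' 1) c c' := by
  have h : (Matrix.of fun b b' => maxEntangled A (b, a) (b', a'))
      = (Fintype.card A : ℂ)⁻¹ • single a a' (1 : ℂ) := by
    ext b b'
    rw [Matrix.of_apply, maxEntangled_apply, Matrix.smul_apply, smul_eq_mul, Matrix.single_apply]
    by_cases h1 : b = a <;> by_cases h2 : b' = a' <;>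
      simp [h1, h2, @eq_comm _ a b, @eq_comm _ a' b']
  change T (Matrix.of fun b b' => maxEntangled A (b, a) (b', a')) c c' = _
  rw [h, map_smul, Matrix.smul_apply, smul_eq_mul]

omit [Fintype C] [DecidableEq C] in
theorem apply_eq_sum_single (T : Matrix A A ℂ →ₗ[ℂ] Matrix C C ℂ) (M : Matrix A A ℂ) :
    T M = ∑ a, ∑ a', M a a' • T (single a a' 1) := by
  conv_lhs => rw [matrix_eq_sum_single M]
  simp only [map_sum]
  refine Finset.sum_congr rfl fun a _ => Finset.sum_congr rfl fun a' _ => ?_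
  rw [← map_smul, smul_single, smul_eq_mul, mul_one]

omit [Fintype C] [DecidableEq C] [Fintype E] [DecidableEq E] in
theorem ampliation_eq_contract [Nonempty A] (T : Matrix A A ℂ →ₗ[ℂ] Matrix C C ℂ)
    (Z : Matrix (A × E) (A × E) ℂ) : ampliation T E Z = contract Z (choi T) := by
  have hd : (Fintype.card A : ℂ) ≠ 0 := by exact_mod_cast Fintype.card_ne_zero
  ext p q
  rw [contract_apply]
  change T (Matrix.of fun a a' => Z (a, p.2) (a', q.2)) p.1 q.1 = _
  rw [apply_eq_sum_single]
  simp only [Matrix.sum_apply, Matrix.smul_apply, smul_eq_mul, Matrix.of_apply, choi_apply,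
    Finset.mul_sum]
  refine Finset.sum_congr rfl fun a _ => Finset.sum_congr rfl fun a' _ => ?_
  field_simp

omit [Fintype C] [DecidableEq C] in
theorem mixedOutput_eq_traceFst (T : Matrix A A ℂ →ₗ[ℂ] Matrix C C ℂ) :
    mixedOutput T = traceFst (choi T) := by
  ext c c'
  rw [mixedOutput, apply_eq_sum_single]
  simp only [traceFst, Matrix.of_apply, choi_apply, Matrix.sum_apply, Matrix.smul_apply,
    Matrix.one_apply, smul_eq_mul]
  simp

omit [DecidableEq C] in
theorem trace_choi [Nonempty A] {T : Matrix A A ℂ →ₗ[ℂ] Matrix C C ℂ}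
    (hT : ∀ X, (T X).trace = X.trace) : (choi T).trace = 1 := by
  have hd : (Fintype.card A : ℂ) ≠ 0 := by exact_mod_cast Fintype.card_ne_zero
  rw [← trace_traceFst, ← mixedOutput_eq_traceFst, mixedOutput, hT, trace_smul, trace_one,
    smul_eq_mul, inv_mul_cancel₀ hd]

omit [DecidableEq A] [DecidableEq E] [DecidableEq C] in
theorem trace_ampliation {T : Matrix A A ℂ →ₗ[ℂ] Matrix C C ℂ}
    (hT : ∀ X, (T X).trace = X.trace) (Z : Matrix (A × E) (A × E) ℂ) :
    (ampliation T E Z).trace = Z.trace := by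
  have h : (ampliation T E Z).trace = ∑ e, (T (blk Z e e)).trace := by
    simp only [Matrix.trace, Fintype.sum_prod_type_right]
    rfl
  rw [h, ← trace_traceFst Z]
  simp only [hT]
  rfl

theorem trace_rotate {U : Matrix A A ℂ} (hU : U ∈ unitaryGroup A ℂ)
    (X : Matrix (A × E) (A × E) ℂ) : (rotate U X).trace = X.trace := by
  rw [← trace_traceFst, ← trace_traceFst X]
  refine Finset.sum_congr rfl fun e _ => ?_
  rw [Matrix.diag_apply, Matrix.diag_apply, traceFst_apply, traceFst_apply, blk_rotate,
    Matrix.trace_mul_comm, ← Matrix.mul_assoc, show Uᴴ * U = 1 from mem_unitaryGroup_iff'.1 hU,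
    Matrix.one_mul]

theorem expectation_le_lintegral {Ω : Type*} [MeasurableSpace Ω] (μ : Measure Ω) (f : Ω → EReal) :
    expectation μ f ≤ ((∫⁻ ω, (f ω).toENNReal ∂μ : ℝ≥0∞) : EReal) := by
  have h := EReal.sub_le_sub (le_refl ((∫⁻ ω, (f ω).toENNReal ∂μ : ℝ≥0∞) : EReal))
    (EReal.coe_ennreal_nonneg (∫⁻ ω, (-f ω).toENNReal ∂μ))
  rwa [sub_zero] at h

/-- The weighted operator `(1 ⊗ X_B^t) X (1 ⊗ X_B^t)` with `t = (1 - p) / (2 p)`. -/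
noncomputable def weighted {E : Type*} [Fintype E] [DecidableEq E] (p : ℝ)
    (X : Matrix (A × E) (A × E) ℂ) : Matrix (A × E) (A × E) ℂ :=
  ((1 : Matrix A A ℂ) ⊗ₖ mpow (traceFst X) ((1 - p) / (2 * p))) * X *
    ((1 : Matrix A A ℂ) ⊗ₖ mpow (traceFst X) ((1 - p) / (2 * p)))

theorem weighted_posSemidef (p : ℝ) {X : Matrix (A × E) (A × E) ℂ} (hX : X.PosSemidef) :
    (weighted p X).PosSemidef := by
  have h := hX.mul_mul_conjTranspose_same
    ((1 : Matrix A A ℂ) ⊗ₖ mpow (traceFst X) ((1 - p) / (2 * p)))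
  rwa [conjTranspose_kronecker, conjTranspose_one,
    (mpow_isHermitian (traceFst_posSemidef hX).1 _).eq] at h

theorem sandwichedQ_one_kronecker (p : ℝ) {X : Matrix (A × E) (A × E) ℂ} (hX : X.PosSemidef) :
    sandwichedQ p X ((1 : Matrix A A ℂ) ⊗ₖ traceFst X) = (mpow (weighted p X) p).trace.re := by
  rw [sandwichedQ, mpow_kronecker PosSemidef.one (traceFst_posSemidef hX), mpow_one, weighted]

/-- The state conditions and the support inclusion hold for every `U`, so the finite branch of
`relEntropy` applies and the norm bound can be used pointwise. -/
theorem relEntropy_toENNReal_le [Nonempty A] {T : Matrix A A ℂ →ₗ[ℂ] Matrix C C ℂ}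
    (hT : ∀ X, (T X).trace = X.trace) (hY : (choi T).PosSemidef) {X : Matrix (A × E) (A × E) ℂ}
    (hX : IsState X) {s : ℝ} (hs : 0 < s) (hs1 : s ≤ 1) (U : unitaryGroup A ℂ) :
    (relEntropy (ampliation T E (rotate (U : Matrix A A ℂ) X))
      (mixedOutput T ⊗ₖ traceFst X)).toENNReal ≤ ENNReal.ofReal (2 / (s * Real.log 2)) *
        ENNReal.ofReal (absPow (1 + s) (deviation (U : Matrix A A ℂ) (weighted (1 + s) X)
          (weighted (1 + s) (choi T)))) := by
  set p := 1 + s with hp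
  have hp0 : 0 < p := by rw [hp]; linarith
  have hlog : 0 < Real.log 2 := Real.log_pos (by norm_num)
  set S := ampliation T E (rotate (U : Matrix A A ℂ) X) with hS
  have hSc : S = contract (rotate (U : Matrix A A ℂ) X) (choi T) := ampliation_eq_contract _ _
  have hXE := traceFst_posSemidef hX.1
  have hYC := traceFst_posSemidef hY
  rw [mixedOutput_eq_traceFst]
  set σ := traceFst (choi T) ⊗ₖ traceFst X with hσ
  have hSstate : IsState S := by
    refine ⟨hSc ▸ contract_posSemidef (rotate_posSemidef _ hX.1) hY, ?_⟩
    rw [hS, trace_ampliation hT, trace_rotate U.2, hX.2]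
  have hσstate : IsState σ := by
    refine ⟨hYC.kronecker hXE, ?_⟩
    rw [hσ, trace_kronecker, trace_traceFst, trace_traceFst, trace_choi hT, hX.2, one_mul]
  have hsupp : supp S ≤ supp σ := hSc ▸ supp_contract_le hX.1 hY _
  -- The powers of `σ` are Kronecker products of powers of the two marginals. These local factors
  -- commute with the rotation on `A` and pass through the contraction onto its two inputs.
  have hdev : mpow σ ((1 - p) / (2 * p)) * S * mpow σ ((1 - p) / (2 * p)) - mpow σ (1 / p)
      = deviation (U : Matrix A A ℂ) (weighted p X) (weighted p (choi T)) := by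
    rw [deviation, weighted, weighted, rotate_one_kronecker_mul, contract_one_kronecker_mul,
      traceFst_one_kronecker_mul, traceFst_one_kronecker_mul, mpow_mul_mul_mpow_self hXE hp0,
      mpow_mul_mul_mpow_self hYC hp0, hσ, mpow_kronecker hYC hXE, mpow_kronecker hYC hXE, hSc]
  have hmain := trace_mul_mlog_sub_le_absPow hSstate hσstate hsupp hs hs1
  rw [← hp, hdev] at hmain
  rw [relEntropy, if_pos hsupp, EReal.toENNReal_of_ne_top (EReal.coe_ne_top _), EReal.toReal_coe,
    ← ENNReal.ofReal_mul (by positivity)]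
  exact ENNReal.ofReal_le_ofReal hmain

/-- The one-shot decoupling bound, with a polynomial loss in the numbers of eigenvalues. -/
theorem decouplingError_le [Nonempty A] {T : Matrix A A ℂ →ₗ[ℂ] Matrix C C ℂ}
    (hT : ∀ X, (T X).trace = X.trace) (hY : (choi T).PosSemidef) {X : Matrix (A × E) (A × E) ℂ}
    (hX : IsState X) {s : ℝ} (hs : 0 < s) (hs1 : s ≤ 1)
    {V : Matrix (A × E) (A × E) ℂ} (hV : V ∈ unitaryGroup (A × E) ℂ)
    {W : Matrix (A × C) (A × C) ℂ} (hW : W ∈ unitaryGroup (A × C) ℂ) {x : A × E → ℝ}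
    {y : A × C → ℝ} (hx : ∀ i, 0 ≤ x i) (hy : ∀ i, 0 ≤ y i)
    (hXV : weighted (1 + s) X = conjDiag V x) (hYW : weighted (1 + s) (choi T) = conjDiag W y) :
    (decouplingError T X).toENNReal ≤ ENNReal.ofReal (2 / (s * Real.log 2) *
      (10 * (((Finset.univ.image x).card * (Finset.univ.image y).card : ℕ) : ℝ) ^ s *
        ((∑ i, x i ^ (1 + s)) * ∑ i, y i ^ (1 + s)))) := by
  have hlog : 0 < Real.log 2 := Real.log_pos (by norm_num)
  have h1 := EReal.toENNReal_le_toENNReal (expectation_le_lintegral (haarUnitary A) fun U =>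
    relEntropy (ampliation T E (rotate (U : Matrix A A ℂ) X)) (mixedOutput T ⊗ₖ traceFst X))
  rw [EReal.toENNReal_coe] at h1
  refine h1.trans ((lintegral_mono fun U => relEntropy_toENNReal_le hT hY hX hs hs1 U).trans ?_)
  rw [lintegral_const_mul' _ _ ENNReal.ofReal_ne_top, ENNReal.ofReal_mul (by positivity), hXV, hYW]
  have h2 := lintegral_absPow_deviation_le hV hW hx hy (p := 1 + s) (by linarith) (by linarith)
  rw [add_sub_cancel_left] at h2
  gcongr

end OneShotError
end QDec

namespace QDec
open Matrix MeasureTheory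

/-! ### Multiplicativity under tensor powers and counting eigenvalues. -/

section TensorPower
variable {A E C : Type*} [Fintype A] [DecidableEq A] [Fintype E] [DecidableEq E]
  [Fintype C] [DecidableEq C]

omit [DecidableEq A] [DecidableEq E] in
theorem sum_prod_prod {R : Type*} [CommSemiring R] (n : ℕ) (f : Fin n → A → E → R) :
    ∑ p : (Fin n → A) × (Fin n → E), ∏ i, f i (p.1 i) (p.2 i)
      = ∏ i, ∑ z : A × E, f i z.1 z.2 := by
  classical
  rw [Finset.prod_univ_sum, Fintype.piFinset_univ]
  exact (Fintype.sum_equiv (Equiv.arrowProdEquivProdArrow (Fin n) (fun _ => A) (fun _ => E)) _ _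
    fun _ => rfl).symm

omit [DecidableEq A] [DecidableEq E] in
theorem tensorPow_mul (n : ℕ) (M N : Matrix (A × E) (A × E) ℂ) :
    tensorPow n (M * N) = tensorPow n M * tensorPow n N := by
  ext p q
  rw [Matrix.mul_apply]
  simp only [tensorPow, Matrix.of_apply, Matrix.mul_apply, ← Finset.prod_mul_distrib]
  exact (sum_prod_prod n fun i a e => M (p.1 i, p.2 i) (a, e) * N (a, e) (q.1 i, q.2 i)).symm

omit [Fintype A] [DecidableEq A] [Fintype E] [DecidableEq E] in
theorem tensorPow_conjTranspose (n : ℕ) (M : Matrix (A × E) (A × E) ℂ) :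
    tensorPow n Mᴴ = (tensorPow n M)ᴴ := by
  ext p q
  simp [tensorPow]

omit [Fintype A] [Fintype E] in
theorem tensorPow_diagonal (n : ℕ) (d : A × E → ℂ) :
    tensorPow n (diagonal d) = diagonal fun p => ∏ i, d (p.1 i, p.2 i) := by
  ext p q
  by_cases h : p = q
  · subst h
    simp [tensorPow]
  · rw [diagonal_apply_ne _ h]
    have : ∃ i, (p.1 i, p.2 i) ≠ (q.1 i, q.2 i) := by
      by_contra hc
      push Not at hc
      apply h
      ext i
      · exact congrArg Prod.fst (hc i)
      · exact congrArg Prod.snd (hc i)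
    obtain ⟨i, hi⟩ := this
    exact Finset.prod_eq_zero (Finset.mem_univ i) (diagonal_apply_ne _ hi)

theorem tensorPow_mem_unitaryGroup (n : ℕ) {V : Matrix (A × E) (A × E) ℂ}
    (hV : V ∈ unitaryGroup (A × E) ℂ) :
    tensorPow n V ∈ unitaryGroup ((Fin n → A) × (Fin n → E)) ℂ := by
  have h : V * Vᴴ = 1 := mem_unitaryGroup_iff.1 hV
  rw [mem_unitaryGroup_iff, star_eq_conjTranspose, ← tensorPow_conjTranspose, ← tensorPow_mul, h,
    ← diagonal_one, tensorPow_diagonal]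
  simp

theorem tensorPow_conjDiag (n : ℕ) (V : Matrix (A × E) (A × E) ℂ) (d : A × E → ℝ) :
    tensorPow n (conjDiag V d)
      = conjDiag (tensorPow n V) fun p => ∏ i, d (p.1 i, p.2 i) := by
  rw [conjDiag, tensorPow_mul, tensorPow_mul, tensorPow_conjTranspose, tensorPow_diagonal, conjDiag]
  push_cast; rfl

theorem tensorPow_posSemidef (n : ℕ) {M : Matrix (A × E) (A × E) ℂ} (hM : M.PosSemidef) :
    (tensorPow n M).PosSemidef := by
  obtain ⟨V, hV, d, hd, rfl⟩ := exists_conjDiag_nonneg hM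
  rw [tensorPow_conjDiag]
  exact conjDiag_posSemidef _ fun p => Finset.prod_nonneg fun i _ => hd _

theorem mpow_tensorPow (n : ℕ) {M : Matrix (A × E) (A × E) ℂ} (hM : M.PosSemidef) (r : ℝ) :
    mpow (tensorPow n M) r = tensorPow n (mpow M r) := by
  obtain ⟨V, hV, d, hd, rfl⟩ := exists_conjDiag_nonneg hM
  rw [tensorPow_conjDiag, mpow_conjDiag hV, mpow_conjDiag (tensorPow_mem_unitaryGroup n hV),
    tensorPow_conjDiag]
  congr 1; ext p
  exact (Real.finsetProd_rpow _ _ (fun i _ => hd _) r).symm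

omit [DecidableEq A] [DecidableEq E] in
theorem trace_tensorPow (n : ℕ) (M : Matrix (A × E) (A × E) ℂ) :
    (tensorPow n M).trace = M.trace ^ n := by
  have h := sum_prod_prod n fun (_ : Fin n) a e => M (a, e) (a, e)
  simp only [Finset.prod_const, Finset.card_univ, Fintype.card_fin] at h
  exact h

theorem isState_tensorPow (n : ℕ) {M : Matrix (A × E) (A × E) ℂ} (hM : IsState M) :
    IsState (tensorPow n M) :=
  ⟨tensorPow_posSemidef n hM.1, by rw [trace_tensorPow, hM.2, one_pow]⟩

omit [Fintype A] in
theorem one_apply_eq_prod {n : ℕ} (a b : Fin n → A) :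
    (1 : Matrix (Fin n → A) (Fin n → A) ℂ) a b = ∏ i, (1 : Matrix A A ℂ) (a i) (b i) := by
  by_cases h : a = b
  · subst h
    rw [Matrix.one_apply_eq]
    exact (Finset.prod_eq_one fun i _ => Matrix.one_apply_eq _).symm
  · obtain ⟨i, hi⟩ := Function.ne_iff.1 h
    rw [Matrix.one_apply_ne h]
    exact (Finset.prod_eq_zero (Finset.mem_univ i) (by rw [Matrix.one_apply_ne hi])).symm

omit [Fintype E] [DecidableEq E] in
theorem one_kronecker_traceFst_tensorPow (n : ℕ) (X : Matrix (A × E) (A × E) ℂ) :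
    (1 : Matrix (Fin n → A) (Fin n → A) ℂ) ⊗ₖ traceFst (tensorPow n X)
      = tensorPow n ((1 : Matrix A A ℂ) ⊗ₖ traceFst X) := by
  ext p q
  simp only [kroneckerMap_apply, tensorPow, traceFst, Matrix.of_apply, one_apply_eq_prod,
    Finset.prod_mul_distrib]
  congr 1
  rw [Finset.prod_univ_sum, Fintype.piFinset_univ]

theorem weighted_eq_mpow (p : ℝ) {X : Matrix (A × E) (A × E) ℂ} (hX : X.PosSemidef) :
    weighted p X = mpow ((1 : Matrix A A ℂ) ⊗ₖ traceFst X) ((1 - p) / (2 * p)) * X *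
      mpow ((1 : Matrix A A ℂ) ⊗ₖ traceFst X) ((1 - p) / (2 * p)) := by
  rw [mpow_kronecker PosSemidef.one (traceFst_posSemidef hX), mpow_one, weighted]

theorem weighted_tensorPow (n : ℕ) (p : ℝ) {X : Matrix (A × E) (A × E) ℂ} (hX : X.PosSemidef) :
    weighted p (tensorPow n X) = tensorPow n (weighted p X) := by
  rw [weighted_eq_mpow p (tensorPow_posSemidef n hX), weighted_eq_mpow p hX,
    one_kronecker_traceFst_tensorPow,
    mpow_tensorPow n (PosSemidef.one.kronecker (traceFst_posSemidef hX)), tensorPow_mul,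
    tensorPow_mul]

omit [Fintype C] [DecidableEq C] in
theorem channelPow_single (n : ℕ) (T : Matrix A A ℂ →ₗ[ℂ] Matrix C C ℂ) (a a' : Fin n → A)
    (c c' : Fin n → C) :
    channelPow n T (single a a' 1) c c' = ∏ i, T (single (a i) (a' i) 1) (c i) (c' i) := by
  change ∑ b : Fin n → A, ∑ b' : Fin n → A, (single a a' (1 : ℂ)) b b' *
    ∏ i, T (single (b i) (b' i) 1) (c i) (c' i) = _
  simp [Matrix.single_apply, ite_and]

omit [Fintype C] [DecidableEq C] in
theorem choi_channelPow (n : ℕ) (T : Matrix A A ℂ →ₗ[ℂ] Matrix C C ℂ) :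
    choi (channelPow n T) = tensorPow n (choi T) := by
  ext ⟨a, c⟩ ⟨a', c'⟩
  rw [choi_apply, channelPow_single]
  simp only [tensorPow, Matrix.of_apply, choi_apply, Finset.prod_mul_distrib, Finset.prod_const,
    Finset.card_univ, Fintype.card_fin, Fintype.card_pi]
  push_cast
  rw [inv_pow]

omit [DecidableEq C] in
theorem trace_channelPow (n : ℕ) {T : Matrix A A ℂ →ₗ[ℂ] Matrix C C ℂ}
    (hT : ∀ X, (T X).trace = X.trace) (X : Matrix (Fin n → A) (Fin n → A) ℂ) :
    (channelPow n T X).trace = X.trace := by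
  have h1 : ∀ a a' : Fin n → A, (channelPow n T (single a a' 1)).trace
      = (single a a' (1 : ℂ)).trace := by
    intro a a'
    simp only [Matrix.trace, Matrix.diag_apply, channelPow_single]
    have h2 : ∑ c : Fin n → C, ∏ i, T (single (a i) (a' i) 1) (c i) (c i)
        = ∏ i, (T (single (a i) (a' i) 1)).trace := by
      simp only [Matrix.trace, Matrix.diag_apply]
      rw [Finset.prod_univ_sum, Fintype.piFinset_univ]
    rw [h2]
    simp only [hT]
    change _ = (single a a' (1 : ℂ)).trace
    by_cases h : a = a'
    · subst h
      simp
    · obtain ⟨i, hi⟩ := Function.ne_iff.1 h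
      rw [trace_single_eq_of_ne _ _ _ h]
      exact Finset.prod_eq_zero (Finset.mem_univ i) (trace_single_eq_of_ne _ _ _ hi)
  rw [apply_eq_sum_single]
  simp only [trace_sum, trace_smul, h1]
  conv_rhs => rw [matrix_eq_sum_single X]
  simp only [trace_sum]
  refine Finset.sum_congr rfl fun a _ => Finset.sum_congr rfl fun a' _ => ?_
  rw [← trace_smul, smul_single, smul_eq_mul, mul_one]

/-- Method of types: the product depends only on how often each `z : κ` occurs among the `n`
factors, and each count lies in `{0, …, n}`. -/
theorem card_image_prod_le {κ : Type*} [Fintype κ] [DecidableEq κ] {β : Type*} [Fintype β] (n : ℕ)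
    (d : κ → ℝ) (g : β → Fin n → κ) :
    (Finset.univ.image fun p => ∏ i, d (g p i)).card ≤ (n + 1) ^ Fintype.card κ := by
  classical
  have hsub : (Finset.univ.image fun p => ∏ i, d (g p i)) ⊆
      Finset.univ.image fun k : κ → Fin (n + 1) => ∏ z, d z ^ (k z : ℕ) := by
    intro t ht
    obtain ⟨p, -, rfl⟩ := Finset.mem_image.1 ht
    refine Finset.mem_image.2 ⟨fun z => ⟨(Finset.univ.filter fun i => g p i = z).card, ?_⟩,
      Finset.mem_univ _, ?_⟩
    · exact Nat.lt_succ_of_le ((Finset.card_le_univ _).trans (by simp))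
    · rw [← Finset.prod_fiberwise Finset.univ (g p) fun i => d (g p i)]
      refine Finset.prod_congr rfl fun z _ => ?_
      rw [Finset.prod_congr rfl fun i hi => by rw [(Finset.mem_filter.1 hi).2], Finset.prod_const]
  refine (Finset.card_le_card hsub).trans (Finset.card_image_le.trans ?_)
  simp

omit [DecidableEq A] [DecidableEq E] in
theorem sum_prod_rpow (n : ℕ) {d : A × E → ℝ} (hd : ∀ i, 0 ≤ d i) (r : ℝ) :
    ∑ p : (Fin n → A) × (Fin n → E), (∏ i, d (p.1 i, p.2 i)) ^ r = (∑ z, d z ^ r) ^ n := by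
  have h := sum_prod_prod n fun (_ : Fin n) a e => d (a, e) ^ r
  simp only [Finset.prod_const, Finset.card_univ, Fintype.card_fin] at h
  rw [← h]
  exact Finset.sum_congr rfl fun p _ => (Real.finsetProd_rpow _ _ (fun i _ => hd _) r).symm

end TensorPower
end QDec

namespace QDec
open Matrix MeasureTheory Filter

/-! ### The asymptotic exponent. -/

section Exponent
variable {A E C : Type*} [Fintype A] [DecidableEq A] [Fintype E] [DecidableEq E]
  [Fintype C] [DecidableEq C]

theorem maxEntangled_posSemidef : (maxEntangled A).PosSemidef := by
  let v : A × A → ℂ := fun z => if z.1 = z.2 then 1 else 0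
  have h : maxEntangled A = ((Fintype.card A : ℝ)⁻¹) • vecMulVec v (star v) := by
    ext ⟨b, a⟩ ⟨b', a'⟩
    rw [maxEntangled_apply, Matrix.smul_apply, vecMulVec_apply]
    simp [v, apply_ite (starRingEnd ℂ)]
  rw [h]
  exact (posSemidef_vecMulVec_self_star v).smul (by positivity)

-- Complete positivity is available for ancillas `Fin k`, so the copy of `A` is reindexed by `Fin
-- |A|` and back.
omit [DecidableEq C] in
theorem choi_posSemidef {T : Matrix A A ℂ →ₗ[ℂ] Matrix C C ℂ} (hT : IsChannel T) :
    (choi T).PosSemidef := by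
  let e := Fintype.equivFin A
  have h1 := hT.completelyPositive (Fintype.card A)
    ((maxEntangled A).submatrix (fun z => (z.1, e.symm z.2)) fun z => (z.1, e.symm z.2))
    (maxEntangled_posSemidef.submatrix _)
  have h2 := h1.submatrix fun z : A × C => (z.2, e z.1)
  have h3 : choi T = (ampliation T (Fin (Fintype.card A)) ((maxEntangled A).submatrix
      (fun z => (z.1, e.symm z.2)) fun z => (z.1, e.symm z.2))).submatrix
        (fun z : A × C => (z.2, e z.1)) fun z : A × C => (z.2, e z.1) := by
    ext z w
    simp [choi, ampliation]
  rw [h3]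
  exact h2

theorem decouplingError_tensorPow_le [Nonempty A] {T : Matrix A A ℂ →ₗ[ℂ] Matrix C C ℂ}
    (hT : IsChannel T) {X : Matrix (A × E) (A × E) ℂ} (hX : IsState X) {s : ℝ} (hs : 0 < s)
    (hs1 : s ≤ 1) (n : ℕ) :
    (decouplingError (channelPow n T) (tensorPow n X)).toENNReal ≤
      ENNReal.ofReal (20 / (s * Real.log 2) *
        (((n + 1 : ℕ) : ℝ) ^ (Fintype.card (A × E) + Fintype.card (A × C)) *
        (sandwichedQ (1 + s) X ((1 : Matrix A A ℂ) ⊗ₖ traceFst X) *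
          sandwichedQ (1 + s) (choi T) ((1 : Matrix A A ℂ) ⊗ₖ traceFst (choi T))) ^ n)) := by
  have hY := choi_posSemidef hT
  have hlog : 0 < Real.log 2 := Real.log_pos (by norm_num)
  obtain ⟨V, hV, x, hx, hXV⟩ := exists_conjDiag_nonneg (weighted_posSemidef (1 + s) hX.1)
  obtain ⟨W, hW, y, hy, hYW⟩ := exists_conjDiag_nonneg (weighted_posSemidef (1 + s) hY)
  have h := decouplingError_le (trace_channelPow n hT.trace_preserving)
    ((choi_channelPow n T).symm ▸ tensorPow_posSemidef n hY) (isState_tensorPow n hX) hs hs1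
    (tensorPow_mem_unitaryGroup n hV) (tensorPow_mem_unitaryGroup n hW)
    (x := fun p => ∏ i, x (p.1 i, p.2 i)) (y := fun p => ∏ i, y (p.1 i, p.2 i))
    (fun p => Finset.prod_nonneg fun i _ => hx _) (fun p => Finset.prod_nonneg fun i _ => hy _)
    (by rw [weighted_tensorPow n _ hX.1, hXV, tensorPow_conjDiag])
    (by rw [choi_channelPow, weighted_tensorPow n _ hY, hYW, tensorPow_conjDiag])
  refine h.trans (ENNReal.ofReal_le_ofReal ?_)
  rw [sandwichedQ_one_kronecker _ hX.1, sandwichedQ_one_kronecker _ hY, hXV, hYW,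
    trace_mpow_conjDiag hV, trace_mpow_conjDiag hW, sum_prod_rpow n hx, sum_prod_rpow n hy,
    ← mul_pow]
  set N : ℕ := (Finset.univ.image fun p : (Fin n → A) × (Fin n → E) =>
    ∏ i, x (p.1 i, p.2 i)).card * (Finset.univ.image fun p : (Fin n → A) × (Fin n → C) =>
    ∏ i, y (p.1 i, p.2 i)).card with hN
  have hNle : N ≤ (n + 1) ^ (Fintype.card (A × E) + Fintype.card (A × C)) := by
    rw [pow_add]
    exact Nat.mul_le_mul
      (card_image_prod_le n x fun (p : (Fin n → A) × (Fin n → E)) i => (p.1 i, p.2 i))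
      (card_image_prod_le n y fun (p : (Fin n → A) × (Fin n → C)) i => (p.1 i, p.2 i))
  have hNs : (N : ℝ) ^ s ≤ ((n + 1 : ℕ) : ℝ) ^ (Fintype.card (A × E) + Fintype.card (A × C)) := by
    -- Here `s ≤ 1` enters, together with `N` being a natural number; zero is treated separately.
    have h1 : (N : ℝ) ^ s ≤ N := by
      rcases Nat.eq_zero_or_pos N with h0 | h0
      · rw [h0, Nat.cast_zero, Real.zero_rpow hs.ne']
      · calc (N : ℝ) ^ s ≤ (N : ℝ) ^ (1 : ℝ) :=
              Real.rpow_le_rpow_of_exponent_le (by exact_mod_cast h0) hs1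
          _ = N := Real.rpow_one _
    exact h1.trans (by exact_mod_cast hNle)
  have hq : 0 ≤ ((∑ i, x i ^ (1 + s)) * ∑ i, y i ^ (1 + s)) ^ n :=
    pow_nonneg (mul_nonneg (Finset.sum_nonneg fun i _ => Real.rpow_nonneg (hx i) _)
      (Finset.sum_nonneg fun i _ => Real.rpow_nonneg (hy i) _)) n
  calc _ = 20 / (s * Real.log 2) * ((N : ℝ) ^ s *
        ((∑ i, x i ^ (1 + s)) * ∑ i, y i ^ (1 + s)) ^ n) := by ring
    _ ≤ _ := by gcongr

theorem sandwichedQ_nonneg (p : ℝ) {X : Matrix (A × E) (A × E) ℂ} (hX : X.PosSemidef) :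
    0 ≤ sandwichedQ p X ((1 : Matrix A A ℂ) ⊗ₖ traceFst X) := by
  rw [sandwichedQ_one_kronecker p hX, ← absPow_eq_trace_mpow (weighted_posSemidef p hX)]
  exact absPow_nonneg (weighted_posSemidef p hX).1 p

theorem eventually_mul_pow_le_one (K : ℝ) (k : ℕ) {r : ℝ} (hr0 : 0 ≤ r) (hr1 : r < 1) :
    ∀ᶠ n : ℕ in atTop, K * (((n + 1 : ℕ) : ℝ) ^ k * r ^ n) ≤ 1 := by
  have h1 : Tendsto (fun n : ℕ => |K| * 2 ^ k * ((n : ℝ) ^ k * r ^ n)) atTop (nhds 0) := by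
    have := (tendsto_pow_const_mul_const_pow_of_abs_lt_one k
      (by rwa [abs_of_nonneg hr0] : |r| < 1)).const_mul (|K| * 2 ^ k)
    rwa [mul_zero] at this
  filter_upwards [h1.eventually (gt_mem_nhds one_pos), eventually_ge_atTop 1] with n hn hn1
  refine le_trans ?_ hn.le
  have h2 : ((n + 1 : ℕ) : ℝ) ≤ 2 * n := by
    have : (1 : ℝ) ≤ n := by exact_mod_cast hn1
    push_cast; linarith
  calc K * (((n + 1 : ℕ) : ℝ) ^ k * r ^ n) ≤ |K| * ((2 * (n : ℝ)) ^ k * r ^ n) := by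
        gcongr
        exact le_abs_self K
    _ = _ := by rw [mul_pow]; ring

/-- The hypothesis on `u.toENNReal` also covers a vanishing error, for which `log2 u = ⊥`. -/
theorem le_neg_inv_mul_log2 {u : EReal} {c : ℝ} {n : ℕ} (hn : 0 < n)
    (hu : u.toENNReal ≤ ENNReal.ofReal ((2 : ℝ) ^ (-c * n))) :
    (c : EReal) ≤ (((-1 : ℝ) / (n : ℝ) : ℝ) : EReal) * log2 u := by
  have hlog : 0 < Real.log 2 := Real.log_pos (by norm_num)
  have hn' : (0 : ℝ) < n := by exact_mod_cast hn
  have h1 : log2 u ≤ ((-c * n : ℝ) : EReal) := by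
    have h2 := ENNReal.log_monotone hu
    rw [ENNReal.log_ofReal_of_pos (by positivity), Real.log_rpow (by norm_num)] at h2
    rw [log2]
    refine (EReal.div_le_div_right_of_nonneg (by exact_mod_cast hlog.le) h2).trans ?_
    rw [← EReal.coe_div, mul_div_assoc, div_self hlog.ne', mul_one]
  have h3 : (((1 : ℝ) / n : ℝ) : EReal) * log2 u ≤ ((-c : ℝ) : EReal) := by
    refine (mul_le_mul_of_nonneg_left h1 (by exact_mod_cast (by positivity))).trans ?_
    rw [← EReal.coe_mul]
    refine EReal.coe_le_coe_iff.2 (le_of_eq ?_)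
    field_simp
  have h4 := EReal.neg_le_neg_iff.2 h3
  rw [← EReal.coe_neg, neg_neg, ← EReal.neg_mul, ← EReal.coe_neg, ← neg_div] at h4
  exact h4

theorem le_decouplingExponent [Nonempty A] {T : Matrix A A ℂ →ₗ[ℂ] Matrix C C ℂ}
    (hT : IsChannel T) {X : Matrix (A × E) (A × E) ℂ} (hX : IsState X) {s : ℝ} (hs : 0 < s)
    (hs1 : s ≤ 1) :
    ((-Real.logb 2 (sandwichedQ (1 + s) X ((1 : Matrix A A ℂ) ⊗ₖ traceFst X)) -
      Real.logb 2 (sandwichedQ (1 + s) (choi T) ((1 : Matrix A A ℂ) ⊗ₖ traceFst (choi T))) : ℝ) :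
        EReal) ≤ decouplingExponent T X := by
  have hY := choi_posSemidef hT
  set a := sandwichedQ (1 + s) X ((1 : Matrix A A ℂ) ⊗ₖ traceFst X) with ha
  set b := sandwichedQ (1 + s) (choi T) ((1 : Matrix A A ℂ) ⊗ₖ traceFst (choi T)) with hb
  have ha0 : 0 ≤ a := sandwichedQ_nonneg _ hX.1
  have hb0 : 0 ≤ b := sandwichedQ_nonneg _ hY
  rw [decouplingExponent]
  -- Room below the target rate is what absorbs the polynomial factor: for every smaller `c` the
  -- ratio `a * b * 2 ^ c` is strictly less than one.
  refine EReal.ge_of_forall_gt_iff_ge.1 fun c hc => ?_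
  have hc' : c < -Real.logb 2 a - Real.logb 2 b := EReal.coe_lt_coe_iff.1 hc
  have hr0 : 0 ≤ a * b * (2 : ℝ) ^ c := by positivity
  have hr1 : a * b * (2 : ℝ) ^ c < 1 := by
    -- If `a` or `b` vanishes, the default value of `logb` carries no information, but the ratio is
    -- then `0`.
    rcases ha0.eq_or_lt with h | ha1
    · rw [← h]; simp
    rcases hb0.eq_or_lt with h | hb1
    · rw [← h]; simp
    have hab : (2 : ℝ) ^ (Real.logb 2 a + Real.logb 2 b) = a * b := by
      rw [← Real.logb_mul ha1.ne' hb1.ne', Real.rpow_logb (by norm_num) (by norm_num)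
        (mul_pos ha1 hb1)]
    rw [← hab, ← Real.rpow_add (by norm_num)]
    exact Real.rpow_lt_one_of_one_lt_of_neg (by norm_num) (by linarith)
  refine Filter.le_liminf_of_le (by isBoundedDefault) ?_
  filter_upwards [eventually_mul_pow_le_one (20 / (s * Real.log 2))
    (Fintype.card (A × E) + Fintype.card (A × C)) hr0 hr1, eventually_gt_atTop 0] with n hn hn0
  refine le_neg_inv_mul_log2 hn0 ((decouplingError_tensorPow_le hT hX hs hs1 n).trans
    (ENNReal.ofReal_le_ofReal ?_))
  have h2 : (0 : ℝ) < 2 ^ (-c * n) := Real.rpow_pos_of_pos (by norm_num) _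
  have h3 : (2 : ℝ) ^ (-c * n) * ((2 : ℝ) ^ c) ^ n = 1 := by
    rw [← Real.rpow_natCast, ← Real.rpow_mul (by norm_num), ← Real.rpow_add (by norm_num)]
    simp
  have h4 := mul_le_mul_of_nonneg_left hn h2.le
  rw [mul_one, mul_pow] at h4
  refine le_trans (le_of_eq ?_) h4
  rw [← ha, ← hb]
  set k := Fintype.card (A × E) + Fintype.card (A × C)
  linear_combination (-(20 / (s * Real.log 2) * (((n + 1 : ℕ) : ℝ) ^ k * (a * b) ^ n))) * h3

/-- The value `⊥` makes the final inequality trivial, so this dichotomy spares a proof that the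
support condition holds. -/
theorem condEntropy_eq {X : Matrix (A × E) (A × E) ℂ} (hX : X.trace = 1) (s : ℝ) :
    condEntropy (1 + s) X = ⊥ ∨ condEntropy (1 + s) X = ((-(1 / s *
      Real.logb 2 (sandwichedQ (1 + s) X ((1 : Matrix A A ℂ) ⊗ₖ traceFst X))) : ℝ) : EReal) := by
  rw [condEntropy, sandwichedRenyi]
  split_ifs
  · right
    rw [hX, add_sub_cancel_left, Complex.one_re, Real.logb_one, mul_zero, sub_zero, EReal.coe_neg]
  · left
    exact EReal.neg_top

end Exponent
end QDec

theorem mainTheorem5 {A E C : Type*} [Fintype A] [DecidableEq A] [Fintype E] [DecidableEq E]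
    [Fintype C] [DecidableEq C]
    (ρ : Matrix (A × E) (A × E) ℂ) (hρ : QDec.IsState ρ)
    (T : Matrix A A ℂ →ₗ[ℂ] Matrix C C ℂ) (hT : QDec.IsChannel T) :
    (⨆ s ∈ Set.Ioo (0 : ℝ) 1, ((s : ℝ) : EReal) *
        (QDec.condEntropy (1 + s) ρ + QDec.condEntropy (1 + s) (QDec.choi T)))
      ≤ QDec.decouplingExponent T ρ := by
  -- A state on an empty index type would have trace `0`.
  have hA : Nonempty A := by
    by_contra h
    rw [not_nonempty_iff] at h
    simpa [Matrix.trace] using hρ.trace_eq_one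
  refine iSup₂_le fun s hs => ?_
  rcases QDec.condEntropy_eq hρ.trace_eq_one s with h | h
  · rw [h, EReal.bot_add, EReal.coe_mul_bot_of_pos hs.1]
    exact bot_le
  rcases QDec.condEntropy_eq (QDec.trace_choi hT.trace_preserving) s with h' | h'
  · rw [h', EReal.add_bot, EReal.coe_mul_bot_of_pos hs.1]
    exact bot_le
  rw [h, h', ← EReal.coe_add, ← EReal.coe_mul]
  -- The outer factor `s` cancels the `1 / s` in both conditional entropies.
  refine le_trans (EReal.coe_le_coe_iff.2 (le_of_eq ?_))
    (QDec.le_decouplingExponent hT hρ hs.1 hs.2.le)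
  have := hs.1.ne'
  field_simp
  ring
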